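/- Let $\Sigma=(\sigma_{ij})$ be a symmetric positive definite $2\times2$ matrix, $\mu=(\mu_1,\mu_2)$ with $\mu_1<0$, $\mu_2<0$, and $R=(r_{ij})$ a $2\times 2$ matrix with $r_{11}>0$, $r_{22}>0$, $r_{11}r_{22}-r_{12}r_{21}>0$, $r_{22}\mu_1-r_{12}\mu_2<0$, $r_{11}\mu_2-r_{21}\mu_1<0$. Put $$\gamma(\theta)=\tfrac12\,\theta\cdot\Sigma\theta+\theta\cdot\mu,\quad \gamma_1(\theta)=r_{11}\theta_1+r_{21}\theta_2,\quad \gamma_2(\theta)=r_{12}\theta_1+r_{22}\theta_2 .$$ Let $\Theta_1^\pm(\theta_2)$ and $\Theta_2^\pm(\theta_1)$ be the roots of $\gamma(\cdot,\theta_2)=0$ and $\gamma(\theta_1,\cdot)=0$, $$\Theta_1^\pm(\theta_2)=\frac{-(\sigma_{12}\theta_2+\mu_1)\pm\sqrt{\theta_2^2(\sigma_{12}^2-\sigma_{11}\sigma_{22})+2\theta_2(\mu_1\sigma_{12}-\mu_2\sigma_{11})+\mu_1^2}}{\sigma_{11}}$$ (principal square root) and symmetrically for $\Theta_2^\pm$;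 let $\theta_2^-<0<\theta_2^+$ and $\theta_1^-<0<\theta_1^+$ be the zeros of the polynomials under the square roots of $\Theta_1^\pm$ and $\Theta_2^\pm$ respectively, and let $v=\Theta_2^\pm(\theta_1^-)$ be the common value of the two branches. Let $\mathcal R=\{\theta_2\in\mathbb C:\gamma(\theta_1,\theta_2)=0\text{ for some real }\theta_1\le\theta_1^-\}$ (a branch of hyperbola with vertex $v$), let $\mathcal G$ be the connected component of $\mathbb C\setminus\mathcal R$ containing $0$, and let $$w(\theta_2)=T_{\pi/\beta}\Big(-\frac{2\theta_2-(\theta_2^++\theta_2^-)}{\theta_2^+-\theta_2^-}\Big),\quad \beta=\arccos\Big(-\frac{\sigma_{12}}{\sqrt{\sigma_{11}\sigma_{22}}}\Big),\quad T_a(x)=\tfrac12\big\{(x+\sqrt{x^2-1})^a+(x-\sqrt{x^2-1})^a\big\}.$$ Let $q=p:=\dfrac{2r_{11}(\mu_1r_{21}-\mu_2r_{11})}{r_{11}^2\sigma_{22}-2r_{11}r_{21}\sigma_{12}+r_{21}^2\sigma_{11}}$ if $\gamma_1(\theta_1^-,v)>0$ and $q=v/2$ otherwise, and $W(\theta_2)=\dfrac{w(\theta_2)-w(v)}{w(\theta_2)-w(q)}$.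 Then $W$ is a bijection from $\mathcal G\setminus\{q\}$ onto $\mathbb C\setminus[0,1]$. Let $(W^{-1})^-(t)$ be the limit of $W^{-1}(u)$ as $u\to t$ with $\Im u<0$, $$G(\theta_2)=\frac{\gamma_1}{\gamma_2}(\Theta_1^-(\theta_2),\theta_2)\,\frac{\gamma_2}{\gamma_1}(\Theta_1^-(\overline{\theta_2}),\overline{\theta_2}),$$ and $H(t)=G((W^{-1})^-(t))$ for $t\in(0,1)$, extended to $t=0$ and $t=1$ by its limits. Then $H$ has a continuous argument on $[0,1]$; put $$\delta=\arg H(0)\in(-\pi,\pi],\qquad \Delta=[\arg H]_0^1,\qquad \chi=\Big\lfloor\frac{\delta+\Delta}{2\pi}\Big\rfloor .$$ Finally let $Z(t)=Z_0+B(t)+\mu t+RL(t)$ be a semimartingale reflected Brownian motion in $[0,\infty)^2$ with parameters $(\Sigma,\mu,R)$ and local time $L$, started from a stationary distribution, let $\nu_1(A)=\mathbb E\int_0^1\mathbf 1_{\{Z(t)\in\{0\}\times A\}}\,\mathrm dL^1(t)$, and let $\varphi_1$ be the meromorphic continuation to $\mathcal G$ of the Laplace transform $\theta_2\mapsto\int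 e^{\theta_2x}\,\nu_1(\mathrm dx)$, $\Re\theta_2\le0$; this continuation exists. Put $\psi_1=\varphi_1\circ W^{-1}$ on $\mathbb C\setminus[0,1]$. Then $\chi\in\{0,-1\}$ and - $\chi=0\iff\gamma_1(\theta_1^-,\Theta_2^\pm(\theta_1^-))\le0\iff\psi_1$ has no pole at infinity; - $\chi=-1\iff\gamma_1(\theta_1^-,\Theta_2^\pm(\theta_1^-))>0\iff\psi_1$ has a simple pole at infinity. -/

import Mathlib

open MeasureTheory ProbabilityTheory Filter Topology
open scoped NNReal ENNReal Matrix

noncomputable section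

/-- The parameters of a reflected Brownian motion in the quarter plane: covariance matrix `Sig`,
drift `mu` and reflection matrix `R`, whose columns are the reflection vectors. -/
structure RBMData where
  Sig : Matrix (Fin 2) (Fin 2) ℝ
  mu : Fin 2 → ℝ
  R : Matrix (Fin 2) (Fin 2) ℝ

namespace RBMData

variable (D : RBMData)

/-- The necessary and sufficient condition for the existence of a stationary distribution. -/
structure Stable : Prop where
  r11_pos : 0 < D.R 0 0
  r22_pos : 0 < D.R 1 1
  det_pos : 0 < D.R 0 0 * D.R 1 1 - D.R 0 1 * D.R 1 0
  drift1 : D.R 1 1 * D.mu 0 - D.R 0 1 * D.mu 1 < 0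
  drift2 : D.R 0 0 * D.mu 1 - D.R 1 0 * D.mu 0 < 0

/-! ### The kernel and the associated algebraic functions -/

/-- The kernel `γ(θ) = (θ · Σ θ) / 2 + θ · μ`. -/
def gam (x y : ℂ) : ℂ :=
  (1 / 2) * (D.Sig 0 0 * x ^ 2 + 2 * D.Sig 0 1 * x * y + D.Sig 1 1 * y ^ 2)
    + D.mu 0 * x + D.mu 1 * y

/-- `γ₁(θ) = R¹ · θ`. -/
def gam1 (x y : ℂ) : ℂ := D.R 0 0 * x + D.R 1 0 * y

/-- `γ₂(θ) = R² · θ`. -/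
def gam2 (x y : ℂ) : ℂ := D.R 0 1 * x + D.R 1 1 * y

/-- `γ₁` at a real point. -/
def gam1Real (x y : ℝ) : ℝ := D.R 0 0 * x + D.R 1 0 * y

/-- The branch `Θ₁⁻(θ₂)`, with the principal determination of the complex square root. -/
def Theta1Minus (y : ℂ) : ℂ :=
  (-(D.Sig 0 1 * y + D.mu 0)
    - Complex.sqrt (y ^ 2 * (D.Sig 0 1 ^ 2 - D.Sig 0 0 * D.Sig 1 1)
        + 2 * y * (D.mu 0 * D.Sig 0 1 - D.mu 1 * D.Sig 0 0) + D.mu 0 ^ 2)) / D.Sig 0 0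

/-- The discriminant under the root in `Θ₂^±(θ₁)`, at a real point. -/
def disc2 (x : ℝ) : ℝ :=
  x ^ 2 * (D.Sig 0 1 ^ 2 - D.Sig 0 0 * D.Sig 1 1)
    + 2 * x * (D.mu 1 * D.Sig 0 1 - D.mu 0 * D.Sig 1 1) + D.mu 1 ^ 2

/-- The branch `Θ₂⁺(θ₁)` at real points with non-negative discriminant. -/
def Theta2Plus (x : ℝ) : ℝ :=
  (-(D.Sig 0 1 * x + D.mu 1) + √(D.disc2 x)) / D.Sig 1 1

/-- The branch `Θ₂⁻(θ₁)` at real points with non-negative discriminant. -/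
def Theta2Minus (x : ℝ) : ℝ :=
  (-(D.Sig 0 1 * x + D.mu 1) - √(D.disc2 x)) / D.Sig 1 1

/-- `det Σ`. -/
def detSig : ℝ := D.Sig 0 0 * D.Sig 1 1 - D.Sig 0 1 ^ 2

/-- The branch point `θ₁⁻`. -/
def theta1Minus : ℝ :=
  ((D.mu 1 * D.Sig 0 1 - D.mu 0 * D.Sig 1 1)
    - √((D.mu 1 * D.Sig 0 1 - D.mu 0 * D.Sig 1 1) ^ 2 + D.mu 1 ^ 2 * D.detSig)) / D.detSig

/-- The branch point `θ₂⁻`. -/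
def theta2Minus : ℝ :=
  ((D.mu 0 * D.Sig 0 1 - D.mu 1 * D.Sig 0 0)
    - √((D.mu 0 * D.Sig 0 1 - D.mu 1 * D.Sig 0 0) ^ 2 + D.mu 0 ^ 2 * D.detSig)) / D.detSig

/-- The branch point `θ₂⁺`. -/
def theta2Plus : ℝ :=
  ((D.mu 0 * D.Sig 0 1 - D.mu 1 * D.Sig 0 0)
    + √((D.mu 0 * D.Sig 0 1 - D.mu 1 * D.Sig 0 0) ^ 2 + D.mu 0 ^ 2 * D.detSig)) / D.detSig

/-- The common value `Θ₂^±(θ₁⁻)`. -/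
def vertex : ℝ := D.Theta2Plus D.theta1Minus

/-- The two branches do agree at the branch point. -/
lemma vertex_eq_minus (h : 0 < D.detSig) : D.vertex = D.Theta2Minus D.theta1Minus := by
  have key : D.disc2 D.theta1Minus = 0 := by
    have h1 : D.detSig * D.theta1Minus = (D.mu 1 * D.Sig 0 1 - D.mu 0 * D.Sig 1 1)
        - √((D.mu 1 * D.Sig 0 1 - D.mu 0 * D.Sig 1 1) ^ 2 + D.mu 1 ^ 2 * D.detSig) := by
      unfold theta1Minus
      field_simp
    have h2 : √((D.mu 1 * D.Sig 0 1 - D.mu 0 * D.Sig 1 1) ^ 2 + D.mu 1 ^ 2 * D.detSig) ^ 2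
        = (D.mu 1 * D.Sig 0 1 - D.mu 0 * D.Sig 1 1) ^ 2 + D.mu 1 ^ 2 * D.detSig :=
      Real.sq_sqrt (by positivity)
    have h3 : √((D.mu 1 * D.Sig 0 1 - D.mu 0 * D.Sig 1 1) ^ 2 + D.mu 1 ^ 2 * D.detSig)
        = (D.mu 1 * D.Sig 0 1 - D.mu 0 * D.Sig 1 1) - D.detSig * D.theta1Minus := by linarith
    rw [h3] at h2
    have h4 : D.detSig * D.disc2 D.theta1Minus = 0 := by
      have h5 : D.disc2 D.theta1Minus = -D.detSig * D.theta1Minus ^ 2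
          + 2 * D.theta1Minus * (D.mu 1 * D.Sig 0 1 - D.mu 0 * D.Sig 1 1) + D.mu 1 ^ 2 := by
        unfold disc2 detSig
        ring
      rw [h5]
      linarith
    exact (mul_eq_zero.mp h4).resolve_left h.ne'
  simp [vertex, Theta2Plus, Theta2Minus, key]

/-- The number `γ₁(θ₁⁻, Θ₂^±(θ₁⁻))`. -/
def gam1Vertex : ℝ := D.gam1Real D.theta1Minus D.vertex

/-- The branch of hyperbola `𝓡`, with its vertex. -/
def curve : Set ℂ := {y | ∃ x : ℝ, x ≤ D.theta1Minus ∧ D.gam x y = 0}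

/-- The open domain `𝓖` that contains `0` and is bounded by `𝓡`. -/
def domain : Set ℂ := connectedComponentIn D.curveᶜ 0

/-! ### The conformal gluing function -/

/-- The angle `β`. -/
def beta : ℝ := Real.arccos (-(D.Sig 0 1 / √(D.Sig 0 0 * D.Sig 1 1)))

end RBMData

/-- The generalized Chebyshev polynomial `T_a(x) = cos (a arccos x)`. -/
def genChebyshev (a : ℝ) (x : ℂ) : ℂ :=
  (1 / 2) * ((x + Complex.sqrt (x ^ 2 - 1)) ^ (a : ℂ) + (x - Complex.sqrt (x ^ 2 - 1)) ^ (a : ℂ))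

namespace RBMData

variable (D : RBMData)

/-- The function `w`. -/
def w (y : ℂ) : ℂ :=
  genChebyshev (Real.pi / D.beta)
    (-((2 * y - (D.theta2Plus + D.theta2Minus)) / (D.theta2Plus - D.theta2Minus)))

/-- The ordinate `p` of the non-zero intersection point of the ellipse `γ = 0` and the line
`γ₁ = 0`. -/
def p : ℝ :=
  2 * D.R 0 0 * (D.mu 0 * D.R 1 0 - D.mu 1 * D.R 0 0) /
    (D.R 0 0 ^ 2 * D.Sig 1 1 - 2 * D.R 0 0 * D.R 1 0 * D.Sig 0 1 + D.R 1 0 ^ 2 * D.Sig 0 0)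

open Classical in
/-- The point `q` of the domain that `W` sends to infinity. -/
def q : ℝ := if 0 < D.gam1Vertex then D.p else D.vertex / 2

/-- The gluing function `W`. -/
def W (y : ℂ) : ℂ := (D.w y - D.w D.vertex) / (D.w y - D.w D.q)

/-- The inverse of `W : 𝓖 ∖ {q} → ℂ ∖ [0,1]`. -/
def Winv : ℂ → ℂ := Function.invFunOn D.W (D.domain \ {(D.q : ℂ)})

/-- The limit of `W⁻¹` at a point of the segment `[0,1]` from below. -/
def WinvMinus (t : ℝ) : ℂ := limUnder (𝓝[{u : ℂ | u.im < 0}] (t : ℂ)) D.Winv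

/-! ### The coefficient of the boundary value problem and its index -/

/-- The function `G`. -/
def G (y : ℂ) : ℂ :=
  D.gam1 (D.Theta1Minus y) y / D.gam2 (D.Theta1Minus y) y *
    (D.gam2 (D.Theta1Minus (star y)) (star y) / D.gam1 (D.Theta1Minus (star y)) (star y))

/-- The function `H = G ∘ (W⁻¹)⁻` on `[0,1]`; its values at the endpoints (where `(W⁻¹)⁻` is the
vertex, at which `G` may read `0/0`, and infinity) are its limits there. -/
def H : ℝ → ℂ := extendFrom (Set.Ioo 0 1) (fun t => D.G (D.WinvMinus t))

end RBMData

/-- `α` is a continuous determination of the argument of the non-vanishing function `f` on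
`[0,1]`. -/
structure IsArgLift (f : ℝ → ℂ) (α : ℝ → ℝ) : Prop where
  continuousOn : ContinuousOn α (Set.Icc 0 1)
  ne_zero : ∀ t ∈ Set.Icc (0 : ℝ) 1, f t ≠ 0
  eq_exp : ∀ t ∈ Set.Icc (0 : ℝ) 1, f t = ‖f t‖ * Complex.exp (α t * Complex.I)

open Classical in
/-- The variation `[arg f]_0^1` of the argument along `[0,1]`. -/
def argVariation (f : ℝ → ℂ) : ℝ :=
  if h : ∃ α, IsArgLift f α then h.choose 1 - h.choose 0 else 0

/-- The variation of the argument does not depend on the continuous determination. -/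
lemma argVariation_eq {f : ℝ → ℂ} {α : ℝ → ℝ} (hα : IsArgLift f α) :
    argVariation f = α 1 - α 0 := by
  have h : ∃ α, IsArgLift f α := ⟨α, hα⟩
  rw [argVariation, dif_pos h]
  set b := h.choose with hb
  have hβ : IsArgLift f b := h.choose_spec
  have hint : ∀ t ∈ Set.Icc (0 : ℝ) 1, ∃ n : ℤ, (b t - α t) / (2 * Real.pi) = n := by
    intro t ht
    have h0 : (‖f t‖ : ℂ) ≠ 0 := by
      simpa using hα.ne_zero t ht
    have h1 : Complex.exp (b t * Complex.I) = Complex.exp (α t * Complex.I) :=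
      mul_left_cancel₀ h0 ((hβ.eq_exp t ht).symm.trans (hα.eq_exp t ht))
    obtain ⟨n, hn⟩ := Complex.exp_eq_exp_iff_exists_int.mp h1
    refine ⟨n, ?_⟩
    have h2 : (b t : ℂ) = α t + n * (2 * Real.pi) := by
      apply mul_right_cancel₀ Complex.I_ne_zero
      rw [hn]
      ring
    have h3 : b t = α t + n * (2 * Real.pi) := by exact_mod_cast h2
    rw [h3]
    have := Real.pi_pos
    field_simp
    ring
  have hc : ContinuousOn (fun t => (b t - α t) / (2 * Real.pi)) (Set.Icc 0 1) :=
    (hβ.continuousOn.sub hα.continuousOn).div_const _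
  have hpre : IsPreconnected ((fun t => (b t - α t) / (2 * Real.pi)) '' Set.Icc (0 : ℝ) 1) :=
    isPreconnected_Icc.image _ hc
  have hsub : ((fun t => (b t - α t) / (2 * Real.pi)) '' Set.Icc (0 : ℝ) 1).Subsingleton := by
    have hcount : ((fun t => (b t - α t) / (2 * Real.pi)) '' Set.Icc (0 : ℝ) 1).Countable := by
      refine (Set.countable_range (fun n : ℤ => (n : ℝ))).mono ?_
      rintro _ ⟨t, ht, rfl⟩
      obtain ⟨n, hn⟩ := hint t ht
      exact ⟨n, hn.symm⟩
    exact hcount.isTotallyDisconnected _ subset_rfl hpre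
  have h01 : (b 1 - α 1) / (2 * Real.pi) = (b 0 - α 0) / (2 * Real.pi) :=
    hsub ⟨1, by simp, rfl⟩ ⟨0, by simp, rfl⟩
  have := Real.pi_pos
  field_simp at h01
  linarith

namespace RBMData

variable (D : RBMData)

/-- `δ = arg H(0) ∈ (-π, π]`. -/
def delta : ℝ := (D.H 0).arg

/-- `Δ = [arg H]_0^1`. -/
def Delta : ℝ := argVariation D.H

/-- The index `χ`. -/
def index : ℤ := ⌊(D.delta + D.Delta) / (2 * Real.pi)⌋

end RBMData

/-! ### Reflected Brownian motion and its boundary measures -/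

open Classical in
/-- The Lebesgue–Stieltjes measure `dℓ` on `[0,∞)` of a monotone path `ℓ`. -/
def pathMeasure (l : ℝ≥0 → ℝ) : Measure ℝ≥0 :=
  if h : Monotone l then h.stieltjesFunction.measure else 0

/-- `B` is a planar Brownian motion relative to the filtration `ℱ`, starting from the origin, with
covariance matrix `S`: the law `N(0, (t - s) S)` of its increments is given by the laws of their
linear combinations. -/
structure IsPlanarBM {Ω : Type*} {mΩ : MeasurableSpace Ω} (S : Matrix (Fin 2) (Fin 2) ℝ)
    (ℱ : Filtration ℝ≥0 mΩ) (P : Measure Ω) (B : ℝ≥0 → Ω → Fin 2 → ℝ) : Prop where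
  adapted : ∀ t, Measurable[ℱ t] (B t)
  start : ∀ᵐ ω ∂P, B 0 ω = 0
  continuous_paths : ∀ᵐ ω ∂P, Continuous fun t => B t ω
  indep : ∀ s t, s ≤ t →
    Indep (MeasurableSpace.comap (fun ω => B t ω - B s ω) inferInstance) (ℱ s) P
  law : ∀ s t, s ≤ t → ∀ v : Fin 2 → ℝ,
    P.map (fun ω => v ⬝ᵥ (B t ω - B s ω)) =
      gaussianReal 0 (Real.toNNReal (((t : ℝ) - s) * (v ⬝ᵥ (S *ᵥ v))))

namespace RBMData

variable (D : RBMData)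

/-- `Z = Z₀ + B + μ t + R L` is a semimartingale reflected Brownian motion in the quarter plane,
driven by the Brownian motion `B`, with local time `L`. -/
structure IsRBM {Ω : Type*} {mΩ : MeasurableSpace Ω} (ℱ : Filtration ℝ≥0 mΩ) (P : Measure Ω)
    (Z B L : ℝ≥0 → Ω → Fin 2 → ℝ) : Prop where
  bm : IsPlanarBM D.Sig ℱ P B
  adapted : ∀ t, Measurable[ℱ t] (Z t)
  adapted_local : ∀ t, Measurable[ℱ t] (L t)
  decomp : ∀ᵐ ω ∂P, ∀ t : ℝ≥0, Z t ω = Z 0 ω + B t ω + (t : ℝ) • D.mu + D.R *ᵥ L t ω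
  quadrant : ∀ᵐ ω ∂P, ∀ t i, 0 ≤ Z t ω i
  local_start : ∀ᵐ ω ∂P, L 0 ω = 0
  local_cont : ∀ᵐ ω ∂P, ∀ i, Continuous fun t => L t ω i
  local_mono : ∀ᵐ ω ∂P, ∀ i, Monotone fun t => L t ω i
  local_support : ∀ᵐ ω ∂P, ∀ i, pathMeasure (fun t => L t ω i) {t | Z t ω i ≠ 0} = 0

end RBMData

/-- The boundary measure `ν₁(A) = E[∫₀¹ 1_{Z(t) ∈ {0} × A} dL¹(t)]`. -/
def boundaryMeasure1 {Ω : Type*} {mΩ : MeasurableSpace Ω} (P : Measure Ω)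
    (Z L : ℝ≥0 → Ω → Fin 2 → ℝ) : Measure ℝ :=
  P.bind fun ω =>
    ((pathMeasure fun t => L t ω 0).restrict {t | t ≤ 1 ∧ Z t ω 0 = 0}).map fun t => Z t ω 1

/-- The Laplace transform `∫ e^{y x} ν(dx)`. -/
def laplace (ν : Measure ℝ) (y : ℂ) : ℂ := ∫ x, Complex.exp (y * x) ∂ν

/-- `φ` is a meromorphic continuation to `U` of the Laplace transform of `ν` (given on the
half-plane `Re y ≤ 0`). -/
structure IsMeromorphicLaplace (ν : Measure ℝ) (U : Set ℂ) (φ : ℂ → ℂ) : Prop where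
  meromorphic : MeromorphicOn φ U
  eq_laplace : ∀ y ∈ U, y.re ≤ 0 → φ y = laplace ν y

/-! ### Poles at infinity -/

/-- `ψ` is meromorphic at infinity, without a pole there. -/
def NoPoleAtInfinity (ψ : ℂ → ℂ) : Prop :=
  MeromorphicAt (fun z => ψ z⁻¹) 0 ∧ 0 ≤ meromorphicOrderAt (fun z => ψ z⁻¹) 0

/-- `ψ` has a simple pole at infinity. -/
def SimplePoleAtInfinity (ψ : ℂ → ℂ) : Prop :=
  MeromorphicAt (fun z => ψ z⁻¹) 0 ∧
    meromorphicOrderAt (fun z => ψ z⁻¹) 0 = ((-1 : ℤ) : WithTop ℤ)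

end

/-! The zero set of the kernel is a rational curve, and its trigonometric parametrization `X s`, `Y
s` makes every object explicit. Over `Y s` the kernel vanishes exactly at `X s` and `X (-s)`
(`Uniformization.gam_eq_zero_iff`). The domain is the image under `Y` of the strip 0 ≤ Re s < β, the
hyperbola is the image of the line Re s = β, its vertex is at s = β, and the origin is at a real s₀
strictly between 0 and β (`domain_eq`, `mem_curve_iff`). In this coordinate w is cos(πs/β). Hence w
maps the domain bijectively onto the plane cut along (-∞, -1], and W, a Möbius transformation of w,
is a bijection onto the complement of [0,1] (`bijOn_W`).

The index. The lower side of the segment corresponds to s = β - iη with η > 0, where Θ₁⁻ is real.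
There G is N divided by its conjugate, with N the product of γ₁ and the conjugate of γ₂ (`G_curve`).
Since Im N < 0, the unit vector M = iN/|N| stays in the right half-plane, and H = -M², so twice the
principal argument of M, minus π, is a continuous argument of H. As t → 1 the limit of M still has
positive real part. As t → 0 the limit is i, -i or 1 according as γ₁ is positive, negative or zero
at the vertex, because γ₂ is positive there. The integer part follows in each of these cases
(`index_eq`).

The pole. Stationarity and a telescoping sum of exponentials give the functional equation γΦ + γ₁φ₁
+ γ₂φ₂ = 0 at imaginary points (`functional_equation_imaginary`), and Phragmén–Lindelöf extends it
to the product of closed left half-planes. On the kernel it expresses φ₁ as -γ₂φ₂/γ₁ at (Θ₁⁻(y), y).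
This continues φ₁ to the whole domain, since 0 is the only point of the domain where y and Θ₁⁻(y)
both have non-negative real parts (`re_neg_or`). The origin is removable, so the only possible pole
is a zero of γ₁ at p.

On the real arc from the origin to the vertex, γ₁ is negative at first, by stability, and changes
sign at most once. If it is positive at the vertex, its zero on the arc is p = q; the zero is simple
and the numerator does not vanish, so φ₁ has a simple pole at q. Otherwise γ₁ does not vanish at q
and φ₁ is regular there (`order_continuation`). Finally W⁻¹ is a local analytic isomorphism from a
neighbourhood of infinity onto one of q, so ψ₁ has at infinity the order of φ₁ at q
(`exists_Winv_eq`, `laplace_continuation`). -/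

/-! ### Complex trigonometry -/

lemma Complex.cos_re_eq (s : ℂ) : (Complex.cos s).re = Real.cos s.re * Real.cosh s.im := by
  rw [Complex.cos_eq]
  simp [← Complex.ofReal_cos, ← Complex.ofReal_sin, ← Complex.ofReal_cosh, ← Complex.ofReal_sinh]

lemma Complex.cos_im_eq (s : ℂ) : (Complex.cos s).im = -(Real.sin s.re * Real.sinh s.im) := by
  rw [Complex.cos_eq]
  simp [← Complex.ofReal_cos, ← Complex.ofReal_sin, ← Complex.ofReal_cosh, ← Complex.ofReal_sinh]

lemma Complex.sin_re_eq (s : ℂ) : (Complex.sin s).re = Real.sin s.re * Real.cosh s.im := by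
  rw [Complex.sin_eq]
  simp [← Complex.ofReal_cos, ← Complex.ofReal_sin, ← Complex.ofReal_cosh, ← Complex.ofReal_sinh]

lemma Complex.sin_re_pos {s : ℂ} (h0 : 0 < s.re) (h1 : s.re < Real.pi) :
    0 < (Complex.sin s).re := by
  rw [Complex.sin_re_eq]
  exact mul_pos (Real.sin_pos_of_pos_of_lt_pi h0 h1) (Real.cosh_pos _)

lemma Complex.sq_sqrt' (z : ℂ) : Complex.sqrt z ^ 2 = z := by
  rw [Complex.sqrt, ← Nat.cast_ofNat, Complex.cpow_nat_inv_pow _ two_ne_zero]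

lemma Complex.sqrt_sq_of_re_pos {z : ℂ} (h : 0 < z.re) : Complex.sqrt (z ^ 2) = z := by
  have h1 := Complex.abs_arg_lt_pi_div_two_iff.2 (Or.inl h)
  rw [abs_lt] at h1
  rw [Complex.sqrt, ← Nat.cast_ofNat]
  exact Complex.pow_cpow_nat_inv two_ne_zero (by simpa using h1.1) (by simpa using h1.2.le)

/-- The two bases of the powers are exp(is) and exp(-is), in an order that depends on the branch of
the root but does not affect the sum. The bound on Re s makes is and -is their principal logarithms.
-/
lemma genChebyshev_cos (a : ℝ) {s : ℂ} (h : |s.re| < Real.pi) :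
    genChebyshev a (Complex.cos s) = Complex.cos (a * s) := by
  have key : ∀ u : ℂ, |u.re| < Real.pi →
      Complex.exp (u * Complex.I) ^ (a : ℂ) = Complex.exp (a * u * Complex.I) := by
    intro u hu
    rw [abs_lt] at hu
    rw [Complex.cpow_def_of_ne_zero (Complex.exp_ne_zero _), Complex.log_exp (by simpa using hu.1)
      (by simpa using hu.2.le)]
    ring_nf
  have hsq : Complex.sqrt (Complex.cos s ^ 2 - 1) ^ 2 = (Complex.sin s * Complex.I) ^ 2 := by
    rw [Complex.sq_sqrt', mul_pow, Complex.I_sq, Complex.sin_sq]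
    ring
  have hneg := key (-s) (by simpa using h)
  have hpos := key s h
  have e1 : Complex.cos s + Complex.sin s * Complex.I = Complex.exp (s * Complex.I) :=
    (Complex.exp_mul_I s).symm
  have e2 : Complex.cos s - Complex.sin s * Complex.I = Complex.exp (-s * Complex.I) := by
    rw [Complex.exp_mul_I, Complex.cos_neg, Complex.sin_neg]; ring
  have e3 : Complex.cos (a * s) = 1 / 2 * (Complex.exp (a * s * Complex.I)
      + Complex.exp (a * -s * Complex.I)) := by
    rw [Complex.cos]; ring_nf
  rw [genChebyshev, e3, ← hneg, ← hpos, ← e1, ← e2]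
  rcases sq_eq_sq_iff_eq_or_eq_neg.1 hsq with h | h <;> rw [h]
  rw [sub_neg_eq_add, ← sub_eq_add_neg, add_comm]

/-- The principal logarithm replaces a preimage by one with real part in (-π, π], and evenness of
the cosine then fixes the sign. -/
lemma Complex.exists_cos_eq (a : ℂ) :
    ∃ s : ℂ, 0 ≤ s.re ∧ s.re ≤ Real.pi ∧ Complex.cos s = a := by
  obtain ⟨s', rfl⟩ := Complex.cos_surjective a
  set t : ℂ := -Complex.I * Complex.log (Complex.exp (s' * Complex.I)) with ht
  have h1 : Complex.exp (t * Complex.I) = Complex.exp (s' * Complex.I) := by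
    rw [ht, show -Complex.I * Complex.log (Complex.exp (s' * Complex.I)) * Complex.I =
      -(Complex.I * Complex.I) * Complex.log (Complex.exp (s' * Complex.I)) by ring,
      Complex.I_mul_I, neg_neg, one_mul, Complex.exp_log (Complex.exp_ne_zero _)]
  have hc : Complex.cos t = Complex.cos s' := by
    rw [Complex.cos, Complex.cos, neg_mul, neg_mul, Complex.exp_neg, Complex.exp_neg, h1]
  have hre : t.re = Complex.arg (Complex.exp (s' * Complex.I)) := by
    rw [ht]; simp [Complex.log_im]
  have b1 := Complex.neg_pi_lt_arg (Complex.exp (s' * Complex.I))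
  have b2 := Complex.arg_le_pi (Complex.exp (s' * Complex.I))
  rw [← hre] at b1 b2
  rcases le_total 0 t.re with h | h
  · exact ⟨t, h, b2, hc⟩
  · exact ⟨-t, by simpa using h, by simpa using (by linarith : -t.re ≤ Real.pi), by
      rw [Complex.cos_neg, hc]⟩

lemma Complex.cos_inj_strip {s t : ℂ} (hs0 : 0 ≤ s.re) (hs1 : s.re < Real.pi) (ht0 : 0 ≤ t.re)
    (ht1 : t.re < Real.pi) (h : Complex.cos s = Complex.cos t) : t = s ∨ t = -s := by
  obtain ⟨k, hk⟩ := Complex.cos_eq_cos_iff.1 h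
  have hpi := Real.pi_pos
  have hk0 : k = 0 := by
    have hre : t.re = 2 * k * Real.pi + s.re ∨ t.re = 2 * k * Real.pi - s.re := by
      rcases hk with hk | hk
      · left; simp [hk]
      · right; simp [hk]
    have h1 : (k : ℝ) < 1 := by
      rcases hre with h | h <;> nlinarith
    have h2 : (-1 : ℝ) < k := by
      rcases hre with h | h <;> nlinarith
    have h1' : k < 1 := by exact_mod_cast h1
    have h2' : -1 < k := by exact_mod_cast h2
    omega
  subst hk0
  simpa using hk

/-- The cosine maps vertical lines to branches of hyperbolas with foci ±1; the two focal distances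
are cosh(Im s) ± cos(Re s). This makes Re s, up to sign and period, readable from `Y s`. -/
lemma norm_cos_add_one_sub (s : ℂ) :
    ‖Complex.cos s + 1‖ - ‖Complex.cos s - 1‖ = 2 * Real.cos s.re := by
  have hc := Real.one_le_cosh s.im
  have c1 := Real.cos_le_one s.re
  have c2 := Real.neg_one_le_cos s.re
  have e := Real.cosh_sq s.im
  have e' := Real.sin_sq_add_cos_sq s.re
  have h1 : ‖Complex.cos s + 1‖ = Real.cosh s.im + Real.cos s.re := by
    rw [Complex.norm_eq_sqrt_sq_add_sq, Real.sqrt_eq_iff_mul_self_eq (by positivity) (by linarith)]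
    simp only [Complex.add_re, Complex.add_im, Complex.cos_re_eq, Complex.cos_im_eq, Complex.one_re,
      Complex.one_im]
    have : Real.sin s.re ^ 2 * Real.sinh s.im ^ 2
      = (1 - Real.cos s.re ^ 2) * (Real.cosh s.im ^ 2 - 1) := by rw [e, ← e']; ring
    linear_combination this
  have h2 : ‖Complex.cos s - 1‖ = Real.cosh s.im - Real.cos s.re := by
    rw [Complex.norm_eq_sqrt_sq_add_sq, Real.sqrt_eq_iff_mul_self_eq (by positivity) (by linarith)]
    simp only [Complex.sub_re, Complex.sub_im, Complex.cos_re_eq, Complex.cos_im_eq, Complex.one_re,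
      Complex.one_im]
    have : Real.sin s.re ^ 2 * Real.sinh s.im ^ 2
      = (1 - Real.cos s.re ^ 2) * (Real.cosh s.im ^ 2 - 1) := by rw [e, ← e']; ring
    linear_combination this
  rw [h1, h2]; ring

/-! ### The uniformization of the kernel -/

/-- The parameters of a trigonometric uniformization of the ellipse `γ = 0`. -/
structure Uniformization (D : RBMData) where
  k : ℝ
  r₁ : ℝ
  r₂ : ℝ
  s₀ : ℝ
  k_pos : 0 < k
  r₁_pos : 0 < r₁
  r₂_pos : 0 < r₂
  s₀_pos : 0 < s₀
  s₀_lt : s₀ < D.beta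
  beta_lt : D.beta < Real.pi
  sig11 : D.Sig 0 0 = k / r₁ ^ 2
  sig22 : D.Sig 1 1 = k / r₂ ^ 2
  sig12 : D.Sig 0 1 = -(k * Real.cos D.beta / (r₁ * r₂))
  mu1 : D.mu 0 = -(k / r₁ * Real.sin D.beta * Real.sin s₀)
  mu2 : D.mu 1 = -(k / r₂ * Real.sin D.beta * Real.sin (D.beta - s₀))

/-- The angle s₀ is found by matching coefficients, with Q² the value at the drift of the adjugate
form of Σ: sin s₀ = -μ₁d/(aQ) and sin(β - s₀) = -μ₂d/(bQ). Negativity of μ₁ and μ₂ places s₀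
strictly between 0 and β. -/
lemma exists_uniformization (D : RBMData) (h11 : 0 < D.Sig 0 0) (h22 : 0 < D.Sig 1 1)
    (hdet : 0 < D.detSig) (hmu1 : D.mu 0 < 0) (hmu2 : D.mu 1 < 0) :
    Nonempty (Uniformization D) := by
  obtain ⟨a, ha, ha2⟩ : ∃ a, 0 < a ∧ a ^ 2 = D.Sig 0 0 := ⟨_, Real.sqrt_pos.2 h11, Real.sq_sqrt h11.le⟩
  obtain ⟨b, hb, hb2⟩ : ∃ a, 0 < a ∧ a ^ 2 = D.Sig 1 1 := ⟨_, Real.sqrt_pos.2 h22, Real.sq_sqrt h22.le⟩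
  obtain ⟨d, hd, hd2⟩ : ∃ a, 0 < a ∧ a ^ 2 = D.detSig := ⟨_, Real.sqrt_pos.2 hdet, Real.sq_sqrt hdet.le⟩
  have hab : √(D.Sig 0 0 * D.Sig 1 1) = a * b := by
    rw [← ha2, ← hb2, ← mul_pow, Real.sqrt_sq (by positivity)]
  have hd3 : d ^ 2 = a ^ 2 * b ^ 2 - D.Sig 0 1 ^ 2 := by rw [hd2, ha2, hb2]; rfl
  set c := D.Sig 0 1 with hc
  set m := D.mu 0
  set n := D.mu 1
  have hbeta : D.beta = Real.arccos (-(c / (a * b))) := by rw [RBMData.beta, hab]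
  have hcab : (c / (a * b)) ^ 2 < 1 := by
    rw [div_pow, div_lt_one (by positivity)]
    nlinarith
  have hcab' := abs_lt.1 ((sq_lt_one_iff_abs_lt_one _).1 hcab)
  have hcos : Real.cos D.beta = -(c / (a * b)) := by
    rw [hbeta, Real.cos_arccos] <;> linarith
  have hb1 : D.beta < Real.pi := by
    have := Real.arccos_lt_pi (x := -(c / (a * b)))
    rw [hbeta]; apply this.2; linarith
  have hb0 : 0 < D.beta := by rw [hbeta, Real.arccos_pos]; linarith
  have hsin : Real.sin D.beta = d / (a * b) := by
    rw [hbeta, Real.sin_arccos, Real.sqrt_eq_iff_mul_self_eq (by nlinarith) (by positivity)]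
    field_simp
    linarith
  have hQ : 0 < n ^ 2 * a ^ 2 - 2 * m * n * c + m ^ 2 * b ^ 2 := by
    have : a ^ 2 * (n ^ 2 * a ^ 2 - 2 * m * n * c + m ^ 2 * b ^ 2)
      = (a ^ 2 * n - m * c) ^ 2 + d ^ 2 * m ^ 2 := by rw [hd3]; ring
    have h2 : 0 < (a ^ 2 * n - m * c) ^ 2 + d ^ 2 * m ^ 2 := by
      have : 0 < d ^ 2 * m ^ 2 := by have := hmu1.ne; positivity
      positivity
    rw [← this] at h2
    exact pos_of_mul_pos_right h2 (by positivity)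
  obtain ⟨Q, hQ0, hQ2⟩ : ∃ Q, 0 < Q ∧ Q ^ 2 = n ^ 2 * a ^ 2 - 2 * m * n * c + m ^ 2 * b ^ 2 :=
    ⟨_, Real.sqrt_pos.2 hQ, Real.sq_sqrt hQ.le⟩
  have hx : ((m * c - n * a ^ 2) / (a * Q)) ^ 2 = 1 - (-m * d / (a * Q)) ^ 2 := by
    field_simp
    rw [hQ2, hd3]; ring
  have hxlt : ((m * c - n * a ^ 2) / (a * Q)) ^ 2 < 1 := by
    rw [hx]
    have : 0 < -m * d / (a * Q) := by
      have : 0 < -m := by linarith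
      positivity
    nlinarith
  have hx' := abs_lt.1 ((sq_lt_one_iff_abs_lt_one _).1 hxlt)
  have hcs : Real.cos (Real.arccos ((m * c - n * a ^ 2) / (a * Q))) = (m * c - n * a ^ 2) / (a * Q) :=
    Real.cos_arccos hx'.1.le hx'.2.le
  have hss : Real.sin (Real.arccos ((m * c - n * a ^ 2) / (a * Q))) = -m * d / (a * Q) := by
    have : 0 < -m := by linarith
    rw [Real.sin_arccos, hx, sub_sub_cancel, Real.sqrt_sq (by positivity)]
  have hs0 : 0 < Real.arccos ((m * c - n * a ^ 2) / (a * Q)) := Real.arccos_pos.2 hx'.2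
  have hs1 : Real.arccos ((m * c - n * a ^ 2) / (a * Q)) < Real.pi := Real.arccos_lt_pi.2 hx'.1
  set s₀ := Real.arccos ((m * c - n * a ^ 2) / (a * Q))
  have hsub : Real.sin (D.beta - s₀) = -n * d / (b * Q) := by
    rw [Real.sin_sub, hsin, hcos, hcs, hss]
    field_simp
    ring
  have hlt : s₀ < D.beta := by
    by_contra hcon
    push Not at hcon
    have h1 : Real.sin (s₀ - D.beta) ≥ 0 :=
      Real.sin_nonneg_of_nonneg_of_le_pi (by linarith) (by linarith)
    have h2 : 0 < Real.sin (D.beta - s₀) := by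
      rw [hsub]
      have : 0 < -n := by linarith
      positivity
    rw [← neg_sub, Real.sin_neg] at h2
    linarith
  -- The second and third entries are half the distances between the branch points θ₁^± and between
  -- θ₂^±.
  refine ⟨⟨a ^ 2 * b ^ 2 * Q ^ 2 / d ^ 4, b * Q / d ^ 2, a * Q / d ^ 2, s₀, by positivity,
    by positivity, by positivity, hs0, hlt, hb1, ?_, ?_, ?_, ?_, ?_⟩⟩
  · rw [← ha2]; field_simp
  · rw [← hb2]; field_simp
  · rw [hcos]; field_simp; rfl
  · rw [hsin, hss]; field_simp; rfl
  · rw [hsin, hsub]; field_simp; rfl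

namespace Uniformization

variable {D : RBMData} (U : Uniformization D)

/-- The first coordinate of the uniformization. -/
noncomputable def X (s : ℂ) : ℂ :=
  U.r₁ * (Complex.cos (U.s₀ - D.beta) - Complex.cos (s - D.beta))

/-- The second coordinate of the uniformization. -/
noncomputable def Y (s : ℂ) : ℂ := U.r₂ * (Complex.cos U.s₀ - Complex.cos s)

/-- The first coordinate of the uniformization, at real points. -/
noncomputable def XReal (s : ℝ) : ℝ :=
  U.r₁ * (Real.cos (U.s₀ - D.beta) - Real.cos (s - D.beta))

/-- The second coordinate of the uniformization, at real points. -/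
noncomputable def YReal (s : ℝ) : ℝ := U.r₂ * (Real.cos U.s₀ - Real.cos s)

lemma X_ofReal (s : ℝ) : U.X s = U.XReal s := by simp [X, XReal]

lemma Y_ofReal (s : ℝ) : U.Y s = U.YReal s := by simp [Y, YReal]

lemma beta_pos (U : Uniformization D) : 0 < D.beta := U.s₀_pos.trans U.s₀_lt

lemma sin_beta_pos (U : Uniformization D) : 0 < Real.sin D.beta :=
  Real.sin_pos_of_pos_of_lt_pi U.beta_pos U.beta_lt

lemma sin_s₀_pos : 0 < Real.sin U.s₀ :=
  Real.sin_pos_of_pos_of_lt_pi U.s₀_pos (U.s₀_lt.trans U.beta_lt)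

lemma continuous_Y : Continuous U.Y := by unfold Y; fun_prop

lemma Y_neg (s : ℂ) : U.Y (-s) = U.Y s := by simp [Y]

/-- As `Y` is even, s and -s lie over the same ordinate, so `X s` and `X (-s)` are the two roots of
a quadratic in x with leading coefficient σ₁₁/2. -/
lemma gam_Y (x s : ℂ) : D.gam x (U.Y s) = U.k / (2 * U.r₁ ^ 2) * (x - U.X s) * (x - U.X (-s)) := by
  have h1 : (U.r₁ : ℂ) ≠ 0 := by exact_mod_cast U.r₁_pos.ne'
  have h2 : (U.r₂ : ℂ) ≠ 0 := by exact_mod_cast U.r₂_pos.ne'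
  have e1 := Complex.sin_sq_add_cos_sq s
  have e2 := Complex.sin_sq_add_cos_sq (D.beta : ℂ)
  have e3 := Complex.sin_sq_add_cos_sq (U.s₀ : ℂ)
  rw [RBMData.gam, U.sig11, U.sig22, U.sig12, U.mu1, U.mu2, X, Y, X]
  push_cast
  simp only [Complex.cos_sub, Complex.sin_sub, Complex.cos_neg, Complex.sin_neg]
  set cs := Complex.cos s
  set ss := Complex.sin s
  set cb := Complex.cos (D.beta : ℂ)
  set sb := Complex.sin (D.beta : ℂ)
  set c0 := Complex.cos (U.s₀ : ℂ)
  set s0 := Complex.sin (U.s₀ : ℂ)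
  have f1 : ss ^ 2 = 1 - cs ^ 2 := by rw [← e1]; ring
  have f2 : sb ^ 2 = 1 - cb ^ 2 := by rw [← e2]; ring
  have f3 : s0 ^ 2 = 1 - c0 ^ 2 := by rw [← e3]; ring
  field_simp
  ring_nf
  simp only [f1, f2, f3]
  ring

lemma gam_eq_zero_iff (x s : ℂ) : D.gam x (U.Y s) = 0 ↔ x = U.X s ∨ x = U.X (-s) := by
  have h1 : (U.r₁ : ℂ) ≠ 0 := by exact_mod_cast U.r₁_pos.ne'
  have h2 : (U.k : ℂ) ≠ 0 := by exact_mod_cast U.k_pos.ne'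
  rw [U.gam_Y, mul_eq_zero, mul_eq_zero, sub_eq_zero, sub_eq_zero]
  simp [h1, h2]

lemma detSig_eq (U : Uniformization D) : D.detSig = (U.k / (U.r₁ * U.r₂) * Real.sin D.beta) ^ 2 := by
  have h1 := U.r₁_pos.ne'
  have h2 := U.r₂_pos.ne'
  rw [RBMData.detSig, U.sig11, U.sig22, U.sig12, mul_pow _ (Real.sin _), Real.sin_sq]
  field_simp

lemma detSig_pos (U : Uniformization D) : 0 < D.detSig := by
  rw [U.detSig_eq]
  have := U.r₁_pos
  have := U.r₂_pos
  have := U.k_pos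
  have := U.sin_beta_pos
  positivity

lemma sin_s₀_eq : Real.sin U.s₀ = Real.sin D.beta * Real.cos (D.beta - U.s₀)
    - Real.cos D.beta * Real.sin (D.beta - U.s₀) := by
  rw [← Real.sin_sub, sub_sub_cancel]

lemma theta1Minus_eq (U : Uniformization D) : D.theta1Minus = U.r₁ * (Real.cos (U.s₀ - D.beta) - 1) := by
  have h1 := U.r₁_pos
  have h2 := U.r₂_pos
  have hd := U.detSig_pos
  have e1 : D.mu 1 * D.Sig 0 1 - D.mu 0 * D.Sig 1 1
      = D.detSig * (U.r₁ * Real.cos (D.beta - U.s₀)) := by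
    rw [U.detSig_eq, U.sig22, U.sig12, U.mu1, U.mu2, U.sin_s₀_eq]
    field_simp
    ring
  have e2 : D.mu 1 ^ 2 = D.detSig * (U.r₁ * Real.sin (D.beta - U.s₀)) ^ 2 := by
    rw [U.detSig_eq, U.mu2]
    field_simp
  have e3 : √((D.mu 1 * D.Sig 0 1 - D.mu 0 * D.Sig 1 1) ^ 2 + D.mu 1 ^ 2 * D.detSig)
      = D.detSig * U.r₁ := by
    rw [Real.sqrt_eq_iff_mul_self_eq (by positivity) (by positivity), e1, e2, mul_pow, mul_pow,
      mul_pow, Real.sin_sq]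
    ring
  rw [RBMData.theta1Minus, e3, e1, ← neg_sub D.beta, Real.cos_neg]
  field_simp

lemma theta2_center (U : Uniformization D) : D.mu 0 * D.Sig 0 1 - D.mu 1 * D.Sig 0 0
    = D.detSig * (U.r₂ * Real.cos U.s₀) := by
  have h1 := U.r₁_pos
  have h2 := U.r₂_pos
  have : Real.cos U.s₀ = Real.cos D.beta * Real.cos (D.beta - U.s₀)
      + Real.sin D.beta * Real.sin (D.beta - U.s₀) := by rw [← Real.cos_sub, sub_sub_cancel]
  have e := Real.sin_sq D.beta
  rw [U.detSig_eq, U.sig11, U.sig12, U.mu1, U.mu2, U.sin_s₀_eq, this]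
  field_simp
  linear_combination (-U.k ^ 2 * Real.sin D.beta * Real.sin (D.beta - U.s₀)) * e

lemma theta2_radius (U : Uniformization D) :
    √((D.mu 0 * D.Sig 0 1 - D.mu 1 * D.Sig 0 0) ^ 2 + D.mu 0 ^ 2 * D.detSig)
      = D.detSig * U.r₂ := by
  have h1 := U.r₁_pos
  have h2 := U.r₂_pos
  have hd := U.detSig_pos
  have e2 : D.mu 0 ^ 2 = D.detSig * (U.r₂ * Real.sin U.s₀) ^ 2 := by
    rw [U.detSig_eq, U.mu1]
    field_simp
  rw [Real.sqrt_eq_iff_mul_self_eq (by positivity) (by positivity), U.theta2_center, e2, mul_pow,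
    mul_pow, mul_pow, Real.sin_sq]
  ring

lemma theta2Plus_eq (U : Uniformization D) : D.theta2Plus = U.r₂ * (Real.cos U.s₀ + 1) := by
  have hd := U.detSig_pos
  rw [RBMData.theta2Plus, U.theta2_radius, U.theta2_center]
  field_simp

lemma theta2Minus_eq (U : Uniformization D) : D.theta2Minus = U.r₂ * (Real.cos U.s₀ - 1) := by
  have hd := U.detSig_pos
  rw [RBMData.theta2Minus, U.theta2_radius, U.theta2_center]
  field_simp

/-- The two branches agree at the branch point, so the vertex equals their mean, which is free of
square roots. -/
lemma vertex_eq : D.vertex = U.YReal D.beta := by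
  have h1 := U.r₁_pos
  have h2 := U.r₂_pos
  have hk := U.k_pos
  have hv := D.vertex_eq_minus U.detSig_pos
  have h22 : 0 < D.Sig 1 1 := by rw [U.sig22]; positivity
  have h3 : D.vertex = -(D.Sig 0 1 * D.theta1Minus + D.mu 1) / D.Sig 1 1 := by
    have e : D.vertex = D.Theta2Plus D.theta1Minus := rfl
    rw [RBMData.Theta2Minus] at hv
    rw [RBMData.Theta2Plus] at e
    field_simp at hv e ⊢
    linarith
  have : Real.cos U.s₀ = Real.cos D.beta * Real.cos (D.beta - U.s₀)
      + Real.sin D.beta * Real.sin (D.beta - U.s₀) := by rw [← Real.cos_sub, sub_sub_cancel]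
  rw [h3, U.theta1Minus_eq, U.sig22, U.sig12, U.mu2, YReal, this, ← neg_sub D.beta, Real.cos_neg]
  field_simp
  ring

lemma theta1Minus_eq_XReal : D.theta1Minus = U.XReal D.beta := by
  rw [U.theta1Minus_eq, XReal, sub_self, Real.cos_zero]

/-- The discriminant is the square of a positive multiple of sin s. Since Re sin s > 0 in this
strip, the principal root is that multiple itself, which selects `X s` rather than `X (-s)`. -/
lemma Theta1Minus_Y {s : ℂ} (h0 : 0 < s.re) (h1 : s.re < Real.pi) :
    D.Theta1Minus (U.Y s) = U.X s := by
  have r1 : (U.r₁ : ℂ) ≠ 0 := by exact_mod_cast U.r₁_pos.ne'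
  have r2 : (U.r₂ : ℂ) ≠ 0 := by exact_mod_cast U.r₂_pos.ne'
  have hk : (U.k : ℂ) ≠ 0 := by exact_mod_cast U.k_pos.ne'
  have hc := U.theta2_center
  have hm : D.mu 0 ^ 2 = D.detSig * (U.r₂ * Real.sin U.s₀) ^ 2 := by
    have := U.r₁_pos.ne'
    have := U.r₂_pos.ne'
    rw [U.detSig_eq, U.mu1]
    field_simp
  have hdet := U.detSig_eq
  have hd : U.Y s ^ 2 * (D.Sig 0 1 ^ 2 - D.Sig 0 0 * D.Sig 1 1)
        + 2 * U.Y s * (D.mu 0 * D.Sig 0 1 - D.mu 1 * D.Sig 0 0) + D.mu 0 ^ 2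
      = (((U.k / U.r₁ * Real.sin D.beta : ℝ) : ℂ) * Complex.sin s) ^ 2 := by
    have a1 : (D.Sig 0 1 : ℂ) ^ 2 - D.Sig 0 0 * D.Sig 1 1 = -(D.detSig : ℂ) := by
      rw [RBMData.detSig]; push_cast; ring
    have a2 : (D.mu 0 : ℂ) * D.Sig 0 1 - D.mu 1 * D.Sig 0 0
        = D.detSig * (U.r₂ * Complex.cos U.s₀) := by exact_mod_cast congrArg (fun x : ℝ => (x : ℂ)) hc
    have a3 : (D.mu 0 : ℂ) ^ 2 = D.detSig * (U.r₂ * Complex.sin U.s₀) ^ 2 := by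
      exact_mod_cast congrArg (fun x : ℝ => (x : ℂ)) hm
    have a4 : (D.detSig : ℂ) = (U.k / (U.r₁ * U.r₂) * Complex.sin D.beta) ^ 2 := by
      exact_mod_cast congrArg (fun x : ℝ => (x : ℂ)) hdet
    rw [a1, a2, a3, a4, Y, mul_pow _ (Complex.sin s), Complex.sin_sq s, mul_pow _ (Complex.sin _),
      mul_pow (U.r₂ : ℂ) (Complex.sin _), Complex.sin_sq (U.s₀ : ℂ)]
    push_cast
    field_simp
    ring
  have hpos : 0 < (((U.k / U.r₁ * Real.sin D.beta : ℝ) : ℂ) * Complex.sin s).re := by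
    rw [Complex.re_ofReal_mul]
    have := U.r₁_pos
    have := U.k_pos
    have := U.sin_beta_pos
    have := Complex.sin_re_pos h0 h1
    positivity
  rw [RBMData.Theta1Minus, hd, Complex.sqrt_sq_of_re_pos hpos, X, Y, U.sig11, U.sig12, U.mu1]
  have e : Complex.sin (U.s₀ : ℂ) * Complex.sin D.beta
      = Complex.cos (U.s₀ - D.beta) - Complex.cos U.s₀ * Complex.cos D.beta := by
    rw [Complex.cos_sub]; ring
  push_cast
  rw [Complex.cos_sub s]
  field_simp
  linear_combination e

lemma chebyshev_argument (s : ℂ) :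
    -((2 * U.Y s - (D.theta2Plus + D.theta2Minus)) / (D.theta2Plus - D.theta2Minus))
      = Complex.cos s := by
  have r2 : (U.r₂ : ℂ) ≠ 0 := by exact_mod_cast U.r₂_pos.ne'
  rw [U.theta2Plus_eq, U.theta2Minus_eq, Y]
  push_cast
  have : (U.r₂ : ℂ) * (Complex.cos U.s₀ + 1) - U.r₂ * (Complex.cos U.s₀ - 1) = 2 * U.r₂ := by ring
  rw [this]
  field_simp
  ring

lemma w_Y {s : ℂ} (h : |s.re| < Real.pi) : D.w (U.Y s) = Complex.cos (Real.pi / D.beta * s) := by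
  rw [RBMData.w, U.chebyshev_argument, genChebyshev_cos _ h]
  push_cast
  rfl

lemma exists_Y_eq (y : ℂ) : ∃ s : ℂ, 0 ≤ s.re ∧ s.re ≤ Real.pi ∧ U.Y s = y := by
  have r2 : (U.r₂ : ℂ) ≠ 0 := by exact_mod_cast U.r₂_pos.ne'
  obtain ⟨s, h0, h1, hs⟩ := Complex.exists_cos_eq (Complex.cos U.s₀ - y / U.r₂)
  refine ⟨s, h0, h1, ?_⟩
  rw [Y, hs]
  field_simp
  ring

/-! ### The domain -/

/-- Twice the cosine of the real part of the uniformizing parameter. -/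
noncomputable def level (y : ℂ) : ℝ :=
  ‖Complex.cos U.s₀ - y / U.r₂ + 1‖ - ‖Complex.cos U.s₀ - y / U.r₂ - 1‖

lemma continuous_level : Continuous U.level := by unfold level; fun_prop

lemma level_Y (s : ℂ) : U.level (U.Y s) = 2 * Real.cos s.re := by
  have r2 : (U.r₂ : ℂ) ≠ 0 := by exact_mod_cast U.r₂_pos.ne'
  have : Complex.cos U.s₀ - U.Y s / U.r₂ = Complex.cos s := by
    rw [Y]; field_simp; ring
  rw [level, this, norm_cos_add_one_sub]

lemma X_mem_real {s : ℂ} (h : s.re = D.beta) :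
    U.X s = ((U.r₁ * (Real.cos (U.s₀ - D.beta) - Real.cosh s.im) : ℝ) : ℂ) := by
  have : s - D.beta = s.im * Complex.I := by
    apply Complex.ext <;> simp [h]
  rw [X, this, Complex.cos_mul_I]
  push_cast
  rfl

lemma cos_real_ge_one {z : ℂ} {x : ℝ} (hx : 1 ≤ x) (h : Complex.cos z = x) :
    Real.cos z.re = 1 ∨ (Real.sin z.re = 0 ∧ 0 < Real.cos z.re) := by
  have hre := congrArg Complex.re h
  have him := congrArg Complex.im h
  rw [Complex.cos_re_eq, Complex.ofReal_re] at hre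
  rw [Complex.cos_im_eq, Complex.ofReal_im, neg_eq_zero, mul_eq_zero, Real.sinh_eq_zero] at him
  have hc := Real.cosh_pos z.im
  rcases him with h | h
  · right
    exact ⟨h, by by_contra hcon; push Not at hcon; nlinarith⟩
  · left
    rw [h, Real.cosh_zero, mul_one] at hre
    have := Real.cos_le_one z.re
    linarith

lemma cos_eq_one_of {z : ℂ} {x : ℝ} (hx : 1 ≤ x) (h : Complex.cos z = x) : Real.cos z.re = 1 := by
  rcases cos_real_ge_one hx h with h | ⟨h1, h2⟩
  · exact h
  · have := Real.sin_sq_add_cos_sq z.re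
    rw [h1] at this
    nlinarith

/-- A real abscissa x ≤ θ₁⁻ forces cos(s - β) or cos(-s - β) to be real and at least 1, hence the
cosine of the real part of the argument to be 1. The second case is impossible because -Re s - β
lies strictly between -2π and 0. -/
lemma mem_curve_iff {s : ℂ} (h0 : 0 ≤ s.re) (h1 : s.re ≤ Real.pi) :
    U.Y s ∈ D.curve ↔ s.re = D.beta := by
  have r1 : (U.r₁ : ℂ) ≠ 0 := by exact_mod_cast U.r₁_pos.ne'
  have hr := U.r₁_pos
  have hb := U.beta_pos
  have hb' := U.beta_lt
  constructor
  · rintro ⟨x, hx, hg⟩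
    rw [U.theta1Minus_eq] at hx
    have hge : 1 ≤ Real.cos (U.s₀ - D.beta) - x / U.r₁ := by
      rw [le_sub_iff_add_le, ← le_sub_iff_add_le', div_le_iff₀ hr]
      linarith
    rcases (U.gam_eq_zero_iff _ _).1 hg with h | h
    · have e : Complex.cos (s - D.beta) = ((Real.cos (U.s₀ - D.beta) - x / U.r₁ : ℝ) : ℂ) := by
        push_cast
        rw [h, X]; field_simp; ring
      have := cos_eq_one_of hge e
      rw [Real.cos_eq_one_iff_of_lt_of_lt] at this <;> simp at * <;> linarith
    · have e : Complex.cos (-s - D.beta) = ((Real.cos (U.s₀ - D.beta) - x / U.r₁ : ℝ) : ℂ) := by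
        push_cast
        rw [h, X]; field_simp; ring
      have := cos_eq_one_of hge e
      rw [Real.cos_eq_one_iff_of_lt_of_lt] at this <;> simp at * <;> linarith
  · intro h
    refine ⟨U.r₁ * (Real.cos (U.s₀ - D.beta) - Real.cosh s.im), ?_, ?_⟩
    · rw [U.theta1Minus_eq]
      have := Real.one_le_cosh s.im
      gcongr
    · rw [← U.X_mem_real h, U.gam_eq_zero_iff]
      exact Or.inl rfl

lemma Y_s₀ : U.Y U.s₀ = 0 := by simp [Y]

lemma X_s₀ : U.X U.s₀ = 0 := by simp [X]

lemma cos_beta_lt_iff (U : Uniformization D) {t : ℝ} (h0 : 0 ≤ t) (h1 : t ≤ Real.pi) :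
    Real.cos D.beta < Real.cos t ↔ t < D.beta :=
  Real.strictAntiOn_cos.lt_iff_gt ⟨U.beta_pos.le, U.beta_lt.le⟩ ⟨h0, h1⟩

lemma curve_eq : D.curve = {y | U.level y = 2 * Real.cos D.beta} := by
  ext y
  obtain ⟨s, h0, h1, rfl⟩ := U.exists_Y_eq y
  rw [U.mem_curve_iff h0 h1, Set.mem_ofPred_eq, U.level_Y, mul_right_inj' two_ne_zero]
  exact (Real.injOn_cos.eq_iff ⟨h0, h1⟩ ⟨U.beta_pos.le, U.beta_lt.le⟩).symm

/-- The curve is a level set of `level`. The component of 0 cannot cross from the superlevel set to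
the disjoint open sublevel set, and the superlevel set is connected because it is the continuous
image of a convex strip. -/
lemma domain_eq : D.domain = {y | 2 * Real.cos D.beta < U.level y} := by
  have h0mem : (0 : ℂ) ∈ {y | 2 * Real.cos D.beta < U.level y} := by
    rw [Set.mem_ofPred_eq, ← U.Y_s₀, U.level_Y, Complex.ofReal_re]
    have := (U.cos_beta_lt_iff U.s₀_pos.le (U.s₀_lt.trans U.beta_lt).le).2 U.s₀_lt
    linarith
  apply Set.Subset.antisymm
  · have hpre : IsPreconnected D.domain := isPreconnected_connectedComponentIn
    have hsub : D.domain ⊆ D.curveᶜ := connectedComponentIn_subset _ _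
    have h0 : (0 : ℂ) ∈ D.domain := by
      apply mem_connectedComponentIn
      rw [U.curve_eq]
      exact (ne_of_lt h0mem).symm
    refine hpre.subset_left_of_subset_union (v := {y | U.level y < 2 * Real.cos D.beta})
      (isOpen_lt continuous_const U.continuous_level)
      (isOpen_lt U.continuous_level continuous_const) ?_ ?_ ⟨0, h0, h0mem⟩
    · rw [Set.disjoint_left]
      intro y h1 h2
      rw [Set.mem_ofPred_eq] at h1 h2
      exact lt_asymm h1 h2
    · intro y hy
      have := hsub hy
      rw [U.curve_eq] at this
      rcases lt_or_gt_of_ne (this : ¬ (_ = _)) with h | h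
      · exact Or.inr h
      · exact Or.inl h
  · have him : {y | 2 * Real.cos D.beta < U.level y} = U.Y '' {s | 0 ≤ s.re ∧ s.re < D.beta} := by
      ext y
      constructor
      · intro hy
        obtain ⟨s, h0, h1, rfl⟩ := U.exists_Y_eq y
        rw [Set.mem_ofPred_eq, U.level_Y, mul_lt_mul_iff_right₀ two_pos, U.cos_beta_lt_iff h0 h1] at hy
        exact ⟨s, ⟨h0, hy⟩, rfl⟩
      · rintro ⟨s, ⟨h0, h1⟩, rfl⟩
        rw [Set.mem_ofPred_eq, U.level_Y, mul_lt_mul_iff_right₀ two_pos,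
          U.cos_beta_lt_iff h0 (h1.trans U.beta_lt).le]
        exact h1
    have hconv : Convex ℝ {s : ℂ | 0 ≤ s.re ∧ s.re < D.beta} :=
      (convex_halfSpace_re_ge 0).inter (convex_halfSpace_re_lt D.beta)
    apply IsPreconnected.subset_connectedComponentIn
    · rw [him]
      exact hconv.isPreconnected.image _ U.continuous_Y.continuousOn
    · exact h0mem
    · intro y hy
      rw [U.curve_eq]
      exact (ne_of_lt hy).symm

lemma isOpen_domain (U : Uniformization D) : IsOpen D.domain := by
  rw [U.domain_eq]
  exact isOpen_lt continuous_const U.continuous_level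

lemma Y_mem_domain_iff {s : ℂ} (h0 : 0 ≤ s.re) (h1 : s.re ≤ Real.pi) :
    U.Y s ∈ D.domain ↔ s.re < D.beta := by
  rw [U.domain_eq, Set.mem_ofPred_eq, U.level_Y, mul_lt_mul_iff_right₀ two_pos,
    U.cos_beta_lt_iff h0 h1]

lemma exists_of_mem_domain {y : ℂ} (hy : y ∈ D.domain) :
    ∃ s : ℂ, 0 ≤ s.re ∧ s.re < D.beta ∧ U.Y s = y := by
  obtain ⟨s, h0, h1, rfl⟩ := U.exists_Y_eq y
  exact ⟨s, h0, (U.Y_mem_domain_iff h0 h1).1 hy, rfl⟩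

lemma X_re (s : ℂ) : (U.X s).re
    = U.r₁ * (Real.cos (U.s₀ - D.beta) - Real.cos (s.re - D.beta) * Real.cosh s.im) := by
  rw [X, Complex.re_ofReal_mul, Complex.sub_re, Complex.cos_re_eq, Complex.cos_re_eq]
  simp

lemma Y_re (s : ℂ) : (U.Y s).re
    = U.r₂ * (Real.cos U.s₀ - Real.cos s.re * Real.cosh s.im) := by
  rw [Y, Complex.re_ofReal_mul, Complex.sub_re, Complex.cos_re_eq, Complex.cos_re_eq]
  simp

/-- Over the domain, the two coordinates have non-negative real parts at the origin only. -/
lemma eq_s₀_of_re_nonneg {s : ℂ} (h0 : 0 ≤ s.re) (h1 : s.re < D.beta) (hX : 0 ≤ (U.X s).re)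
    (hY : 0 ≤ (U.Y s).re) : s = U.s₀ := by
  have hb := U.beta_pos
  have hb' := U.beta_lt
  have hs0 := U.s₀_pos
  have hs1 := U.s₀_lt
  have hsb := U.sin_beta_pos
  rw [U.X_re, mul_nonneg_iff_of_pos_left U.r₁_pos, sub_nonneg] at hX
  rw [U.Y_re, mul_nonneg_iff_of_pos_left U.r₂_pos, sub_nonneg] at hY
  have a1 : 0 ≤ Real.sin (D.beta - s.re) :=
    Real.sin_nonneg_of_nonneg_of_le_pi (by linarith) (by linarith)
  have a2 : 0 ≤ Real.sin s.re := Real.sin_nonneg_of_nonneg_of_le_pi h0 (by linarith)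
  have id1 : ∀ t : ℝ, Real.sin D.beta * Real.cos (t - s.re)
      = Real.sin (D.beta - s.re) * Real.cos t + Real.sin s.re * Real.cos (t - D.beta) := by
    intro t
    simp only [Real.sin_sub, Real.cos_sub]
    ring
  -- The two hypotheses are added with the weights sin(β - Re s) and sin(Re s); `id1` evaluates both
  -- sides of the result. Since cosh ≥ 1 ≥ cos, equality must hold throughout.
  have h2 : Real.cosh s.im ≤ Real.cos (U.s₀ - s.re) := by
    have e1 := id1 s.re
    have e2 := id1 U.s₀
    rw [sub_self, Real.cos_zero, mul_one] at e1
    refine le_of_mul_le_mul_left ?_ hsb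
    rw [e2, e1, add_mul, mul_assoc, mul_assoc]
    gcongr
  have h3 := Real.one_le_cosh s.im
  have h4 := Real.cos_le_one (U.s₀ - s.re)
  have h5 : Real.cosh s.im = 1 := by linarith
  have h6 : Real.cos (U.s₀ - s.re) = 1 := by linarith
  rw [Real.cos_eq_one_iff_of_lt_of_lt (by linarith) (by linarith)] at h6
  have h7 : s.im = 0 := by
    by_contra h
    have := Real.one_lt_cosh.2 h
    linarith
  apply Complex.ext <;> simp [h7]
  linarith

/-! ### The zeros of `γ₁` and `γ₂` -/

/-- Sum-to-product formulas split off the zero s = s₀, which is the origin; the other factor carries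
the second intersection of the line with the ellipse. -/
lemma gam1_eq (s : ℂ) : D.gam1 (U.X s) (U.Y s) = 2 * Complex.sin ((s - U.s₀) / 2) *
    (D.R 0 0 * U.r₁ * Complex.sin ((s + U.s₀) / 2 - D.beta)
      + D.R 1 0 * U.r₂ * Complex.sin ((s + U.s₀) / 2)) := by
  rw [RBMData.gam1, X, Y, Complex.cos_sub_cos, Complex.cos_sub_cos]
  have e1 : (U.s₀ - D.beta - (s - D.beta) : ℂ) / 2 = -((s - U.s₀) / 2) := by ring
  have e2 : (U.s₀ - s : ℂ) / 2 = -((s - U.s₀) / 2) := by ring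
  have e3 : (U.s₀ - D.beta + (s - D.beta) : ℂ) / 2 = (s + U.s₀) / 2 - D.beta := by ring
  have e4 : (U.s₀ + s : ℂ) / 2 = (s + U.s₀) / 2 := by ring
  rw [e1, e2, e3, e4, Complex.sin_neg]
  ring

/-- The factor of `γ₁` on the real ellipse that vanishes at the second intersection point. -/
noncomputable def gam1Factor (m : ℝ) : ℝ :=
  D.R 0 0 * U.r₁ * Real.sin (m - D.beta) + D.R 1 0 * U.r₂ * Real.sin m

lemma gam1Real_eq (s : ℝ) : D.gam1Real (U.XReal s) (U.YReal s)
    = 2 * Real.sin ((s - U.s₀) / 2) * U.gam1Factor ((s + U.s₀) / 2) := by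
  have h := U.gam1_eq s
  rw [X_ofReal, Y_ofReal] at h
  rw [RBMData.gam1] at h
  rw [RBMData.gam1Real, gam1Factor]
  exact_mod_cast h

lemma gam1Vertex_eq : D.gam1Vertex
    = 2 * Real.sin ((D.beta - U.s₀) / 2) * U.gam1Factor ((D.beta + U.s₀) / 2) := by
  rw [RBMData.gam1Vertex, U.vertex_eq, U.theta1Minus_eq_XReal, U.gam1Real_eq]

/-- Up to a positive constant this value is r₁₁μ₂ - r₂₁μ₁. -/
lemma gam1Factor_s₀_neg (h : D.Stable) : U.gam1Factor U.s₀ < 0 := by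
  have h1 := U.r₁_pos
  have h2 := U.r₂_pos
  have hk := U.k_pos
  have hs := U.sin_beta_pos
  have hd := h.drift2
  rw [U.mu1, U.mu2] at hd
  have e : D.R 0 0 * -(U.k / U.r₂ * Real.sin D.beta * Real.sin (D.beta - U.s₀))
      - D.R 1 0 * -(U.k / U.r₁ * Real.sin D.beta * Real.sin U.s₀)
      = U.k / (U.r₁ * U.r₂) * Real.sin D.beta * U.gam1Factor U.s₀ := by
    rw [gam1Factor, ← neg_sub D.beta, Real.sin_neg]
    field_simp
    ring
  rw [e] at hd
  exact (pos_iff_neg_of_mul_neg hd).1 (by positivity)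

lemma continuous_gam1Factor : Continuous U.gam1Factor := by unfold gam1Factor; fun_prop

/-- `γ₁/sin` is increasing along the arc. -/
lemma gam1Factor_mul_sin_lt {m m' : ℝ} (hR : 0 < D.R 0 0) (h0 : 0 < m) (h : m < m')
    (h1 : m' < Real.pi) : U.gam1Factor m * Real.sin m' < U.gam1Factor m' * Real.sin m := by
  have e : U.gam1Factor m' * Real.sin m - U.gam1Factor m * Real.sin m'
      = D.R 0 0 * U.r₁ * (Real.sin D.beta * Real.sin (m' - m)) := by
    simp only [gam1Factor, Real.sin_sub]
    ring
  have := U.r₁_pos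
  have := U.sin_beta_pos
  have : 0 < Real.sin (m' - m) := Real.sin_pos_of_pos_of_lt_pi (by linarith) (by linarith)
  have : 0 < D.R 0 0 * U.r₁ * (Real.sin D.beta * Real.sin (m' - m)) := by positivity
  linarith

lemma sin_half_sub_pos {s : ℝ} (h0 : U.s₀ < s) (h1 : s ≤ D.beta) :
    0 < Real.sin ((s - U.s₀) / 2) := by
  have := U.s₀_pos
  have := U.beta_lt
  exact Real.sin_pos_of_pos_of_lt_pi (by linarith) (by linarith)

lemma gam1Vertex_pos_iff : 0 < D.gam1Vertex ↔ 0 < U.gam1Factor ((D.beta + U.s₀) / 2) := by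
  have := U.sin_half_sub_pos U.s₀_lt le_rfl
  rw [U.gam1Vertex_eq, mul_pos_iff_of_pos_left (by positivity)]

/-- The quotient of `gam1Factor` by the sine increases strictly along the arc, so being non-positive
at the vertex it is negative before it. -/
lemma gam1Real_neg {s : ℝ} (hR : 0 < D.R 0 0) (h0 : U.s₀ < s) (h1 : s < D.beta)
    (hv : D.gam1Vertex ≤ 0) : D.gam1Real (U.XReal s) (U.YReal s) < 0 := by
  have := U.s₀_pos
  have := U.beta_lt
  have hf : U.gam1Factor ((D.beta + U.s₀) / 2) ≤ 0 := by
    by_contra hcon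
    push Not at hcon
    exact absurd (U.gam1Vertex_pos_iff.2 hcon) (not_lt.2 hv)
  have hlt := U.gam1Factor_mul_sin_lt hR (m := (s + U.s₀) / 2) (m' := (D.beta + U.s₀) / 2)
    (by linarith) (by linarith) (by linarith)
  have p1 : 0 < Real.sin ((s + U.s₀) / 2) :=
    Real.sin_pos_of_pos_of_lt_pi (by linarith) (by linarith)
  have p2 : 0 < Real.sin ((D.beta + U.s₀) / 2) :=
    Real.sin_pos_of_pos_of_lt_pi (by linarith) (by linarith)
  have hneg : U.gam1Factor ((s + U.s₀) / 2) < 0 := by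
    by_contra hcon
    push Not at hcon
    nlinarith
  have := U.sin_half_sub_pos h0 h1.le
  rw [U.gam1Real_eq]
  exact mul_neg_of_pos_of_neg (by positivity) hneg

lemma exists_gam1Real_eq_zero (h : D.Stable) (hv : 0 < D.gam1Vertex) :
    ∃ s, U.s₀ < s ∧ s < D.beta ∧ D.gam1Real (U.XReal s) (U.YReal s) = 0 := by
  have h1 := U.gam1Vertex_pos_iff.1 hv
  have h2 := U.gam1Factor_s₀_neg h
  have hs := U.s₀_lt
  have hc : ContinuousOn (fun s => U.gam1Factor ((s + U.s₀) / 2)) (Set.Icc U.s₀ D.beta) :=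
    (U.continuous_gam1Factor.comp (by fun_prop)).continuousOn
  have := intermediate_value_Ioo hs.le hc
  have hmem : (0 : ℝ) ∈ Set.Ioo (U.gam1Factor ((U.s₀ + U.s₀) / 2))
      (U.gam1Factor ((D.beta + U.s₀) / 2)) := by
    rw [add_self_div_two]; exact ⟨h2, h1⟩
  obtain ⟨s, ⟨hs1, hs2⟩, hs3⟩ := this hmem
  refine ⟨s, hs1, hs2, ?_⟩
  rw [U.gam1Real_eq, show U.gam1Factor ((s + U.s₀) / 2) = 0 from hs3, mul_zero]

lemma gam_real_zero (s : ℝ) : D.gam (U.XReal s) (U.YReal s) = 0 := by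
  rw [← X_ofReal, ← Y_ofReal, U.gam_eq_zero_iff]
  exact Or.inl rfl

lemma YReal_strictMonoOn : StrictMonoOn U.YReal (Set.Icc 0 Real.pi) := by
  intro a ha b hb hab
  have := Real.strictAntiOn_cos ha hb hab
  have := U.r₂_pos
  unfold YReal
  gcongr

lemma YReal_s₀ : U.YReal U.s₀ = 0 := by simp [YReal]

lemma YReal_pos {s : ℝ} (h0 : U.s₀ < s) (h1 : s ≤ Real.pi) : 0 < U.YReal s := by
  have := U.s₀_pos
  rw [← U.YReal_s₀]
  exact U.YReal_strictMonoOn ⟨by linarith, by linarith⟩ ⟨by linarith, h1⟩ h0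

end Uniformization

/-! ### The line γ₁ = 0 and the position of q -/

namespace RBMData

variable {D : RBMData}

/-- The quadratic form of the kernel along the line `γ₁ = 0`. -/
noncomputable def lineForm (D : RBMData) : ℝ :=
  D.R 0 0 ^ 2 * D.Sig 1 1 - 2 * D.R 0 0 * D.R 1 0 * D.Sig 0 1 + D.R 1 0 ^ 2 * D.Sig 0 0

lemma lineForm_pos (h11 : 0 < D.Sig 0 0) (hdet : 0 < D.detSig) (hR : 0 < D.R 0 0) :
    0 < D.lineForm := by
  have e : D.Sig 0 0 * D.lineForm
      = (D.R 1 0 * D.Sig 0 0 - D.R 0 0 * D.Sig 0 1) ^ 2 + D.R 0 0 ^ 2 * D.detSig := by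
    rw [lineForm, detSig]; ring
  have : 0 < D.Sig 0 0 * D.lineForm := by rw [e]; positivity
  exact pos_of_mul_pos_right this h11.le

lemma gam_line (hR : 0 < D.R 0 0) (hl : D.lineForm ≠ 0) (y : ℂ) :
    D.gam (-(D.R 1 0 * y / D.R 0 0)) y = D.lineForm / (2 * D.R 0 0 ^ 2) * y * (y - D.p) := by
  have hr : (D.R 0 0 : ℂ) ≠ 0 := by exact_mod_cast hR.ne'
  have hl' : (D.lineForm : ℂ) ≠ 0 := by exact_mod_cast hl
  have hp : D.p = 2 * D.R 0 0 * (D.mu 0 * D.R 1 0 - D.mu 1 * D.R 0 0) / D.lineForm := rfl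
  rw [hp, gam]
  push_cast
  field_simp
  rw [lineForm]
  push_cast
  ring

lemma eq_zero_or_eq_p (hR : 0 < D.R 0 0) (hl : D.lineForm ≠ 0) {x y : ℂ} (h : D.gam x y = 0)
    (h1 : D.gam1 x y = 0) : y = 0 ∨ y = D.p := by
  have hr : (D.R 0 0 : ℂ) ≠ 0 := by exact_mod_cast hR.ne'
  have hl' : (D.lineForm : ℂ) ≠ 0 := by exact_mod_cast hl
  have hx : x = -(D.R 1 0 * y / D.R 0 0) := by
    rw [gam1] at h1
    field_simp
    linear_combination h1
  rw [hx, gam_line hR hl, mul_eq_zero, mul_eq_zero, sub_eq_zero] at h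
  simpa [hr, hl'] using h

end RBMData

namespace Uniformization

variable {D : RBMData} (U : Uniformization D)

lemma sig11_pos (U : Uniformization D) : 0 < D.Sig 0 0 := by
  have := U.r₁_pos
  have := U.k_pos
  rw [U.sig11]; positivity

lemma lineForm_pos (U : Uniformization D) (h : D.Stable) : 0 < D.lineForm :=
  RBMData.lineForm_pos U.sig11_pos U.detSig_pos h.r11_pos

/-- The point sent to infinity by `W` lies on the open arc from the origin to the vertex. -/
lemma exists_q (h : D.Stable) : ∃ s, U.s₀ < s ∧ s < D.beta ∧ D.q = U.YReal s ∧
    (0 < D.gam1Vertex → D.q = D.p ∧ D.gam1Real (U.XReal s) (U.YReal s) = 0) := by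
  have hs0 := U.s₀_pos
  have hb := U.beta_lt
  by_cases hv : 0 < D.gam1Vertex
  · obtain ⟨s, h1, h2, h3⟩ := U.exists_gam1Real_eq_zero h hv
    have h4 : D.gam1 (U.XReal s) (U.YReal s) = 0 := by
      rw [RBMData.gam1Real] at h3
      rw [RBMData.gam1]
      exact_mod_cast h3
    have hq : D.q = D.p := if_pos hv
    refine ⟨s, h1, h2, ?_, fun _ => ⟨hq, h3⟩⟩
    have hpos := U.YReal_pos h1 (by linarith)
    rcases RBMData.eq_zero_or_eq_p h.r11_pos (U.lineForm_pos h).ne' (U.gam_real_zero s) h4 with h5 | h5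
    · exact absurd (by exact_mod_cast h5) hpos.ne'
    · rw [hq]; exact_mod_cast h5.symm
  · have hq : D.q = D.vertex / 2 := if_neg hv
    have hpos := U.YReal_pos U.s₀_lt hb.le
    have hc : ContinuousOn U.YReal (Set.Icc U.s₀ D.beta) := by
      unfold YReal; fun_prop
    have hmem : U.YReal D.beta / 2 ∈ Set.Ioo (U.YReal U.s₀) (U.YReal D.beta) := by
      rw [U.YReal_s₀]; constructor <;> linarith
    obtain ⟨s, ⟨h1, h2⟩, h3⟩ := intermediate_value_Ioo U.s₀_lt.le hc hmem
    exact ⟨s, h1, h2, by rw [hq, U.vertex_eq, ← h3], fun h => absurd h hv⟩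

end Uniformization

/-! ### The gluing function as a bijection -/

/-- The plane cut along `(-∞, -1]`. -/
def cutPlane : Set ℂ := {z | z.im = 0 → -1 < z.re}

lemma cos_mem_cutPlane {s : ℂ} (h0 : 0 ≤ s.re) (h1 : s.re < Real.pi) :
    Complex.cos s ∈ cutPlane := by
  intro h
  rw [Complex.cos_im_eq, neg_eq_zero, mul_eq_zero, Real.sinh_eq_zero] at h
  rw [Complex.cos_re_eq]
  rcases h with h | h
  · have : s.re = 0 := by
      by_contra hne
      have := Real.sin_pos_of_pos_of_lt_pi (lt_of_le_of_ne h0 (Ne.symm hne)) h1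
      exact this.ne' h
    rw [this, Real.cos_zero, one_mul]
    linarith [Real.cosh_pos s.im]
  · rw [h, Real.cosh_zero, mul_one, ← Real.cos_pi]
    exact Real.strictAntiOn_cos ⟨h0, h1.le⟩ ⟨Real.pi_pos.le, le_rfl⟩ h1

lemma re_lt_pi_of_cos_mem_cutPlane {s : ℂ} (h1 : s.re ≤ Real.pi)
    (h : Complex.cos s ∈ cutPlane) : s.re < Real.pi := by
  refine lt_of_le_of_ne h1 fun he => ?_
  have := h (by rw [Complex.cos_im_eq, he, Real.sin_pi]; simp)
  rw [Complex.cos_re_eq, he, Real.cos_pi] at this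
  linarith [Real.one_le_cosh s.im]

namespace Uniformization

variable {D : RBMData} (U : Uniformization D)

lemma w_Y_of_mem {s : ℂ} (h0 : 0 ≤ s.re) (h1 : s.re < D.beta) :
    D.w (U.Y s) = Complex.cos (Real.pi / D.beta * s) :=
  U.w_Y (by rw [abs_of_nonneg h0]; exact h1.trans U.beta_lt)

lemma scale_re (D : RBMData) (s : ℂ) : (Real.pi / D.beta * s : ℂ).re = Real.pi / D.beta * s.re := by
  rw [← Complex.ofReal_div, Complex.re_ofReal_mul]

lemma scale_re_nonneg (U : Uniformization D) {s : ℂ} (h0 : 0 ≤ s.re) :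
    0 ≤ (Real.pi / D.beta * s : ℂ).re := by
  rw [scale_re]
  have := U.beta_pos
  have := Real.pi_pos
  positivity

lemma scale_re_lt (U : Uniformization D) {s : ℂ} (h1 : s.re < D.beta) :
    (Real.pi / D.beta * s : ℂ).re < Real.pi := by
  rw [scale_re]
  have := U.beta_pos
  have := Real.pi_pos
  rw [div_mul_eq_mul_div, div_lt_iff₀ U.beta_pos]
  gcongr

/-- After scaling by π/β the strip has width π, where the cosine determines its argument up to sign,
and `Y` does not see the sign. -/
lemma w_injOn (U : Uniformization D) : Set.InjOn D.w D.domain := by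
  intro y hy y' hy' h
  obtain ⟨s, h0, h1, rfl⟩ := U.exists_of_mem_domain hy
  obtain ⟨t, h0', h1', rfl⟩ := U.exists_of_mem_domain hy'
  rw [U.w_Y_of_mem h0 h1, U.w_Y_of_mem h0' h1'] at h
  have hb : (Real.pi / D.beta : ℂ) ≠ 0 := by
    have := U.beta_pos.ne'
    have := Real.pi_ne_zero
    rw [← Complex.ofReal_div]
    exact_mod_cast div_ne_zero Real.pi_ne_zero U.beta_pos.ne'
  rcases Complex.cos_inj_strip (U.scale_re_nonneg h0) (U.scale_re_lt h1) (U.scale_re_nonneg h0')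
    (U.scale_re_lt h1') h with h | h
  · rw [mul_left_cancel₀ hb h]
  · rw [← mul_neg] at h
    rw [mul_left_cancel₀ hb h, Y_neg]

lemma w_image (U : Uniformization D) : D.w '' D.domain = cutPlane := by
  have hb := U.beta_pos
  have hpi := Real.pi_pos
  ext z
  constructor
  · rintro ⟨y, hy, rfl⟩
    obtain ⟨s, h0, h1, rfl⟩ := U.exists_of_mem_domain hy
    rw [U.w_Y_of_mem h0 h1]
    exact cos_mem_cutPlane (U.scale_re_nonneg h0) (U.scale_re_lt h1)
  · intro hz
    obtain ⟨s, h0, h1, rfl⟩ := Complex.exists_cos_eq z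
    have h1' := re_lt_pi_of_cos_mem_cutPlane h1 hz
    have hre : (D.beta / Real.pi * s : ℂ).re = D.beta / Real.pi * s.re := by
      rw [← Complex.ofReal_div, Complex.re_ofReal_mul]
    have hlt : (D.beta / Real.pi * s : ℂ).re < D.beta := by
      rw [hre, div_mul_eq_mul_div, div_lt_iff₀ hpi]
      gcongr
    have hnn : 0 ≤ (D.beta / Real.pi * s : ℂ).re := by rw [hre]; positivity
    refine ⟨U.Y (D.beta / Real.pi * s), ?_, ?_⟩
    · rwa [U.Y_mem_domain_iff hnn (hlt.trans U.beta_lt).le]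
    · rw [U.w_Y_of_mem hnn hlt]
      congr 1
      have h1 : (D.beta : ℂ) ≠ 0 := by exact_mod_cast hb.ne'
      have h2 : (Real.pi : ℂ) ≠ 0 := by exact_mod_cast hpi.ne'
      field_simp

lemma w_vertex (U : Uniformization D) : D.w D.vertex = -1 := by
  have h1 : (D.beta : ℂ) ≠ 0 := by exact_mod_cast U.beta_pos.ne'
  rw [U.vertex_eq, ← Y_ofReal, U.w_Y, div_mul_cancel₀ _ h1, Complex.cos_pi]
  rw [Complex.ofReal_re, abs_of_pos U.beta_pos]
  exact U.beta_lt

/-- The (real) value of `w` at `q`. -/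
lemma exists_w_q (U : Uniformization D) (h : D.Stable) : ∃ c : ℝ, -1 < c ∧ D.w D.q = c := by
  obtain ⟨s, h1, h2, h3, -⟩ := U.exists_q h
  have hs := U.s₀_pos
  refine ⟨Real.cos (Real.pi / D.beta * s), ?_, ?_⟩
  · have := cos_mem_cutPlane (U.scale_re_nonneg (s := s) (by simp; linarith))
      (U.scale_re_lt (s := s) (by simpa using h2))
    have h := this (by
      rw [← Complex.ofReal_div, ← Complex.ofReal_mul, ← Complex.ofReal_cos, Complex.ofReal_im])
    rwa [← Complex.ofReal_div, ← Complex.ofReal_mul, ← Complex.ofReal_cos, Complex.ofReal_re] at h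
  · rw [h3, ← Y_ofReal, U.w_Y_of_mem (by simp; linarith) (by simpa using h2)]
    push_cast
    rfl

lemma q_mem_domain (U : Uniformization D) (h : D.Stable) : (D.q : ℂ) ∈ D.domain := by
  obtain ⟨s, h1, h2, h3, -⟩ := U.exists_q h
  have hs := U.s₀_pos
  have := U.beta_lt
  rw [h3, ← Y_ofReal, U.Y_mem_domain_iff] <;> simp <;> linarith

lemma W_eq (U : Uniformization D) (y : ℂ) : D.W y = (D.w y + 1) / (D.w y - D.w D.q) := by
  rw [RBMData.W, U.w_vertex, sub_neg_eq_add]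

end Uniformization

/-- The Möbius transformation `z ↦ (z + 1) / (z - c)` maps the cut plane onto the complement of
`[0,1]`. -/
lemma bijOn_mobius {c : ℝ} (hc : -1 < c) :
    Set.BijOn (fun z : ℂ => (z + 1) / (z - c)) (cutPlane \ {(c : ℂ)})
      (((fun t : ℝ => (t : ℂ)) '' Set.Icc 0 1)ᶜ) := by
  have hc' : (1 + c : ℂ) ≠ 0 := by
    have : (1 + c : ℝ) ≠ 0 := by linarith
    exact_mod_cast this
  refine ⟨?_, ?_, ?_⟩
  · rintro z ⟨hz, hzc⟩ ⟨t, ⟨ht0, ht1⟩, ht⟩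
    have hzc' : z - c ≠ 0 := sub_ne_zero.2 hzc
    simp only at ht
    rw [eq_div_iff hzc'] at ht
    have ht1' : t ≠ 1 := by
      rintro rfl
      apply hc'
      push_cast at ht
      linear_combination -ht
    have ht2 : (1 - t : ℂ) ≠ 0 := by
      rw [sub_ne_zero]; exact_mod_cast ht1'.symm
    have hlt : 0 < 1 - t := by
      rcases lt_or_eq_of_le ht1 with h | h
      · linarith
      · exact absurd h ht1'
    have hz2 : z = ((-(1 + t * c) / (1 - t) : ℝ) : ℂ) := by
      push_cast
      rw [eq_div_iff ht2]
      linear_combination -ht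
    have := hz (by rw [hz2, Complex.ofReal_im])
    rw [hz2, Complex.ofReal_re, lt_div_iff₀ hlt] at this
    nlinarith
  · rintro z ⟨hz, hzc⟩ z' ⟨hz', hzc'⟩ h
    have h1 : z - c ≠ 0 := sub_ne_zero.2 hzc
    have h2 : z' - c ≠ 0 := sub_ne_zero.2 hzc'
    simp only at h
    rw [div_eq_div_iff h1 h2] at h
    have : (1 + c : ℂ) * (z' - z) = 0 := by linear_combination h
    rcases mul_eq_zero.1 this with h | h
    · exact absurd h hc'
    · exact (sub_eq_zero.1 h).symm
  · intro u hu
    have hu1 : u ≠ 1 := by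
      rintro rfl
      exact hu ⟨1, by simp, by simp⟩
    have hu1' : u - 1 ≠ 0 := sub_ne_zero.2 hu1
    -- The preimage of u is (1 + uc)/(u - 1). The value u = 1 is the image of infinity, and u = 0
    -- that of the tip -1 of the cut.
    have e : (1 + u * c) / (u - 1) - c = (1 + c) / (u - 1) := by
      field_simp; ring
    refine ⟨(1 + u * c) / (u - 1), ⟨?_, ?_⟩, ?_⟩
    · intro him
      set x := ((1 + u * c) / (u - 1)).re with hx
      have hz : (1 + u * c) / (u - 1) = (x : ℂ) := Complex.ext (by simp [hx]) (by simp [him])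
      by_contra hcon
      push Not at hcon
      apply hu
      have hxc : x - c < 0 := by linarith
      refine ⟨(x + 1) / (x - c), ⟨div_nonneg_of_nonpos (by linarith) hxc.le, ?_⟩, ?_⟩
      · rw [div_le_one_of_neg hxc]; linarith
      · have hxc' : (x - c : ℂ) ≠ 0 := by exact_mod_cast hxc.ne
        rw [div_eq_iff hu1'] at hz
        push_cast
        rw [div_eq_iff hxc']
        linear_combination hz
    · rw [Set.mem_singleton_iff, ← sub_eq_zero, e]
      exact div_ne_zero hc' hu1'
    · simp only
      rw [e]
      field_simp
      ring

namespace Uniformization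

variable {D : RBMData} (U : Uniformization D)

lemma bijOn_W (U : Uniformization D) (h : D.Stable) : Set.BijOn D.W (D.domain \ {(D.q : ℂ)})
    (((fun t : ℝ => (t : ℂ)) '' Set.Icc 0 1)ᶜ) := by
  obtain ⟨c, hc, hcq⟩ := U.exists_w_q h
  have hw : Set.BijOn D.w (D.domain \ {(D.q : ℂ)}) (cutPlane \ {(c : ℂ)}) := by
    have hb : Set.BijOn D.w D.domain cutPlane := by
      rw [← U.w_image]; exact U.w_injOn.bijOn_image
    rw [← hcq]
    exact hb.sdiff_singleton (U.q_mem_domain h)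
  refine ((bijOn_mobius hc).comp hw).congr fun y _ => ?_
  rw [U.W_eq, hcq]
  rfl

lemma Winv_eq (U : Uniformization D) (h : D.Stable) {y u : ℂ} (hy : y ∈ D.domain) (hq : y ≠ D.q) (hu : D.W y = u) :
    D.Winv u = y := by
  rw [← hu]
  exact (U.bijOn_W h).2.1.leftInvOn_invFunOn ⟨hy, hq⟩

end Uniformization

/-! ### Boundary values of the inverse gluing function -/

/-- A determination of the inverse hyperbolic cosine. -/
noncomputable def Complex.arcosh (z : ℂ) : ℂ := Complex.log (z + Complex.sqrt (z ^ 2 - 1))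

lemma Complex.cosh_arcosh (z : ℂ) : Complex.cosh (Complex.arcosh z) = z := by
  have h : (z + Complex.sqrt (z ^ 2 - 1)) * (z - Complex.sqrt (z ^ 2 - 1)) = 1 := by
    have := Complex.sq_sqrt' (z ^ 2 - 1)
    linear_combination -this
  have h0 : z + Complex.sqrt (z ^ 2 - 1) ≠ 0 := left_ne_zero_of_mul_eq_one h
  rw [Complex.arcosh, Complex.cosh, Complex.exp_neg, Complex.exp_log h0,
    ← eq_inv_of_mul_eq_one_right h]
  ring

lemma Complex.sqrt_ofReal_of_pos {x : ℝ} (h : 0 < x) : Complex.sqrt x = (√x : ℝ) := by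
  have : (x : ℂ) = ((√x : ℝ) : ℂ) ^ 2 := by rw [← Complex.ofReal_pow, Real.sq_sqrt h.le]
  rw [this, Complex.sqrt_sq_of_re_pos]
  rw [Complex.ofReal_re]
  exact Real.sqrt_pos.2 h

lemma Complex.arcosh_ofReal {x : ℝ} (h : 1 < x) : Complex.arcosh x = Real.arcosh x := by
  have h1 : 0 < x ^ 2 - 1 := by nlinarith
  have := Real.sqrt_nonneg (x ^ 2 - 1)
  have e : (x : ℂ) ^ 2 - 1 = ((x ^ 2 - 1 : ℝ) : ℂ) := by push_cast; rfl
  rw [Complex.arcosh, Real.arcosh, e, Complex.sqrt_ofReal_of_pos h1, ← Complex.ofReal_add,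
    Complex.ofReal_log (by linarith)]

lemma Complex.continuousAt_arcosh {x : ℝ} (h : 1 < x) : ContinuousAt Complex.arcosh x := by
  have h1 : 0 < x ^ 2 - 1 := by nlinarith
  have e : (x : ℂ) ^ 2 - 1 = ((x ^ 2 - 1 : ℝ) : ℂ) := by push_cast; rfl
  have hs : ContinuousAt (fun z : ℂ => Complex.sqrt (z ^ 2 - 1)) x := by
    refine ContinuousAt.comp (g := Complex.sqrt) (f := fun z : ℂ => z ^ 2 - 1) ?_ (by fun_prop)
    apply Complex.continuousAt_sqrt
    left
    rw [e, Complex.ofReal_re]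
    exact h1.le
  unfold Complex.arcosh
  refine (continuousAt_id.add hs).clog ?_
  left
  change 0 < ((x : ℂ) + Complex.sqrt ((x : ℂ) ^ 2 - 1)).re
  rw [e, Complex.sqrt_ofReal_of_pos h1, ← Complex.ofReal_add, Complex.ofReal_re]
  have := Real.sqrt_nonneg (x ^ 2 - 1)
  linarith

lemma Complex.cosh_im_eq (z : ℂ) : (Complex.cosh z).im = Real.sinh z.re * Real.sin z.im := by
  conv_lhs => rw [← Complex.re_add_im z]
  rw [Complex.cosh_add, Complex.cosh_mul_I, Complex.sinh_mul_I]
  simp [← Complex.ofReal_cos, ← Complex.ofReal_sin, ← Complex.ofReal_cosh, ← Complex.ofReal_sinh]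

lemma Complex.arcosh_im_le (z : ℂ) : (Complex.arcosh z).im ≤ Real.pi := Complex.log_im_le_pi _

lemma Complex.neg_pi_lt_arcosh_im (z : ℂ) : -Real.pi < (Complex.arcosh z).im :=
  Complex.neg_pi_lt_log_im _

namespace Uniformization

variable {D : RBMData} (U : Uniformization D)

/-- The height of the uniformizing parameter of `(W⁻¹)⁻(t)`, when `w(q) = c`. -/
noncomputable def height (D : RBMData) (c t : ℝ) : ℝ :=
  D.beta / Real.pi * Real.arcosh ((1 + t * c) / (1 - t))

lemma one_lt_height_arg {c t : ℝ} (hc : -1 < c) (h0 : 0 < t) (h1 : t < 1) :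
    1 < (1 + t * c) / (1 - t) := by
  rw [lt_div_iff₀ (by linarith)]
  nlinarith

/-- Below the segment the Möbius preimage z of u has Im z > 0, so l = arcosh(-z), having positive
real part, has Im l in (-π, 0). Then s = (β/π)(π - il) lies in the strip and cos(πs/β) = -cosh l =
z. -/
lemma Winv_eq_Y {c : ℝ} (h : D.Stable) (hc : -1 < c) (hcq : D.w D.q = c) {u : ℂ} (hu : u.im < 0)
    (hre : 0 < (Complex.arcosh (-((1 + u * c) / (u - 1)))).re) :
    D.Winv u = U.Y (D.beta / Real.pi *
      (Real.pi - Complex.I * Complex.arcosh (-((1 + u * c) / (u - 1))))) := by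
  set z : ℂ := (1 + u * c) / (u - 1) with hz
  set l := Complex.arcosh (-z) with hl
  have hu1 : u - 1 ≠ 0 := by
    intro h0
    have := congrArg Complex.im h0
    simp at this
    linarith
  have hc' : (1 + c : ℂ) ≠ 0 := by
    have : (1 + c : ℝ) ≠ 0 := by linarith
    exact_mod_cast this
  have hzc : z - c = (1 + c) / (u - 1) := by rw [hz]; field_simp; ring
  have hzc0 : z - c ≠ 0 := by rw [hzc]; exact div_ne_zero hc' hu1
  have him : 0 < z.im := by
    have e : z = c + (1 + c : ℝ) * (u - 1)⁻¹ := by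
      rw [← sub_eq_iff_eq_add', hzc]; push_cast; rfl
    rw [e, Complex.add_im, Complex.ofReal_im, zero_add, Complex.im_ofReal_mul, Complex.inv_im]
    have h1 : 0 < Complex.normSq (u - 1) := Complex.normSq_pos.2 hu1
    have h2 : 0 < -(u - 1).im := by simpa using hu
    have h3 : 0 < 1 + c := by linarith
    positivity
  have hcosh : Complex.cosh l = -z := Complex.cosh_arcosh _
  have hlim : l.im < 0 := by
    have h1 := congrArg Complex.im hcosh
    rw [Complex.cosh_im_eq, Complex.neg_im] at h1
    by_contra hcon
    push Not at hcon
    have h2 := Real.sin_nonneg_of_nonneg_of_le_pi hcon (Complex.arcosh_im_le _)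
    have h3 := Real.sinh_pos_iff.2 hre
    nlinarith
  have hlim' := Complex.neg_pi_lt_arcosh_im (-z)
  rw [← hl] at hlim'
  have hb := U.beta_pos
  have hpi := Real.pi_pos
  set s : ℂ := D.beta / Real.pi * (Real.pi - Complex.I * l) with hs
  have hsre : s.re = D.beta / Real.pi * (Real.pi + l.im) := by
    rw [hs, ← Complex.ofReal_div, Complex.re_ofReal_mul]
    simp
  have hs0 : 0 ≤ s.re := by
    rw [hsre]
    have : 0 < Real.pi + l.im := by linarith
    positivity
  have hs1 : s.re < D.beta := by
    rw [hsre, div_mul_eq_mul_div, div_lt_iff₀ hpi]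
    nlinarith
  have hscale : (Real.pi / D.beta * s : ℂ) = Real.pi - Complex.I * l := by
    have h1 : (D.beta : ℂ) ≠ 0 := by exact_mod_cast hb.ne'
    have h2 : (Real.pi : ℂ) ≠ 0 := by exact_mod_cast hpi.ne'
    rw [hs]
    field_simp
  have hw : D.w (U.Y s) = z := by
    rw [U.w_Y_of_mem hs0 hs1, hscale, Complex.cos_pi_sub, mul_comm, Complex.cos_mul_I, hcosh,
      neg_neg]
  apply U.Winv_eq h
  · exact (U.Y_mem_domain_iff hs0 (hs1.trans U.beta_lt).le).2 hs1
  · intro hq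
    apply hzc0
    rw [← hw, hq, hcq, sub_self]
  · rw [U.W_eq, hw, hcq, hzc, hz]
    field_simp
    ring

/-- The formula for W⁻¹ below the segment extends continuously to t, because there the argument of
arcosh is a real number greater than 1, away from the branch cut. The limit lies on the line Re s =
β, below the real axis. -/
lemma WinvMinus_eq {c : ℝ} (h : D.Stable) (hc : -1 < c) (hcq : D.w D.q = c) {t : ℝ} (h0 : 0 < t)
    (h1 : t < 1) :
    D.WinvMinus t = U.Y (D.beta - Complex.I * height D c t) := by
  have hpi : (Real.pi : ℂ) ≠ 0 := by exact_mod_cast Real.pi_ne_zero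
  have ht1 : (t : ℂ) - 1 ≠ 0 := by
    rw [sub_ne_zero]; exact_mod_cast h1.ne
  have hval : -((1 + (t : ℂ) * c) / (t - 1)) = (((1 + t * c) / (1 - t) : ℝ) : ℂ) := by
    push_cast
    rw [← div_neg, neg_sub]
  have harg := one_lt_height_arg hc h0 h1
  have hcont : ContinuousAt (fun u : ℂ => Complex.arcosh (-((1 + u * c) / (u - 1)))) t := by
    refine ContinuousAt.comp (g := Complex.arcosh) (f := fun u : ℂ => -((1 + u * c) / (u - 1))) ?_ ?_
    · rw [hval]; exact Complex.continuousAt_arcosh harg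
    · fun_prop (disch := exact ht1)
  have hat : Complex.arcosh (-((1 + (t : ℂ) * c) / (t - 1)))
      = Real.arcosh ((1 + t * c) / (1 - t)) := by
    rw [hval, Complex.arcosh_ofReal harg]
  have hev : ∀ᶠ u in 𝓝 (t : ℂ), 0 < (Complex.arcosh (-((1 + u * c) / (u - 1)))).re := by
    refine (Complex.continuous_re.continuousAt.comp hcont).eventually (lt_mem_nhds ?_)
    simp only [Function.comp]
    rw [hat, Complex.ofReal_re]
    exact Real.arcosh_pos harg
  have hne : (𝓝[{u : ℂ | u.im < 0}] (t : ℂ)).NeBot := by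
    rw [← mem_closure_iff_nhdsWithin_neBot, Complex.closure_setOfPred_im_lt]
    simp
  apply Filter.Tendsto.limUnder_eq
  have hlim : Tendsto (fun u : ℂ => U.Y (D.beta / Real.pi *
      (Real.pi - Complex.I * Complex.arcosh (-((1 + u * c) / (u - 1))))))
      (𝓝[{u : ℂ | u.im < 0}] (t : ℂ)) (𝓝 (U.Y (D.beta - Complex.I * height D c t))) := by
    have e : (D.beta - Complex.I * height D c t : ℂ) = D.beta / Real.pi *
      (Real.pi - Complex.I * Complex.arcosh (-((1 + (t : ℂ) * c) / (t - 1)))) := by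
      rw [hat, height]
      push_cast
      field_simp
    rw [e]
    refine (Tendsto.mono_left ?_ nhdsWithin_le_nhds)
    exact ContinuousAt.tendsto (U.continuous_Y.continuousAt.comp
      (continuousAt_const.mul (continuousAt_const.sub (continuousAt_const.mul hcont))))
  refine hlim.congr' ?_
  filter_upwards [self_mem_nhdsWithin, mem_nhdsWithin_of_mem_nhds hev] with u hu hu'
  exact (U.Winv_eq_Y h hc hcq hu hu').symm

lemma height_pos (U : Uniformization D) {c t : ℝ} (hc : -1 < c) (h0 : 0 < t) (h1 : t < 1) :
    0 < height D c t :=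
  mul_pos (div_pos U.beta_pos Real.pi_pos) (Real.arcosh_pos (one_lt_height_arg hc h0 h1))

lemma continuousOn_height {c : ℝ} (hc : -1 < c) : ContinuousOn (height D c) (Set.Ico 0 1) := by
  unfold height
  refine continuousOn_const.mul (Real.continuousOn_arcosh.comp ?_ ?_)
  · refine ContinuousOn.div (by fun_prop) (by fun_prop) ?_
    intro t ht
    have := ht.2
    linarith
  · intro t ht
    rw [Set.mem_Ici, le_div_iff₀ (by linarith [ht.2])]
    nlinarith [ht.1]

lemma tendsto_height_zero {c : ℝ} (hc : -1 < c) :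
    Tendsto (height D c) (𝓝[>] 0) (𝓝 0) := by
  have h := (continuousOn_height (D := D) hc) 0 ⟨le_rfl, one_pos⟩
  have e : height D c 0 = 0 := by simp [height]
  rw [ContinuousWithinAt, e] at h
  refine h.mono_left ?_
  rw [← nhdsWithin_Ioo_eq_nhdsGT (one_pos : (0 : ℝ) < 1)]
  exact nhdsWithin_mono _ Set.Ioo_subset_Ico_self

lemma tendsto_arcosh_atTop : Tendsto Real.arcosh atTop atTop := by
  refine tendsto_atTop_mono' _ ?_ Real.tendsto_log_atTop
  filter_upwards [eventually_ge_atTop 1] with x hx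
  rw [Real.arcosh]
  exact Real.log_le_log (by linarith) (by linarith [Real.sqrt_nonneg (x ^ 2 - 1)])

lemma tendsto_height_one (U : Uniformization D) {c : ℝ} (hc : -1 < c) :
    Tendsto (height D c) (𝓝[<] 1) atTop := by
  refine Tendsto.const_mul_atTop (div_pos U.beta_pos Real.pi_pos) (tendsto_arcosh_atTop.comp ?_)
  have h1 : Tendsto (fun t : ℝ => 1 - t) (𝓝[<] 1) (𝓝[>] 0) := by
    refine tendsto_nhdsWithin_iff.2 ⟨?_, ?_⟩
    · refine Tendsto.mono_left ?_ nhdsWithin_le_nhds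
      have : ContinuousAt (fun t : ℝ => 1 - t) 1 := by fun_prop
      simpa [ContinuousAt] using this
    · filter_upwards [self_mem_nhdsWithin] with t ht
      exact sub_pos.2 (Set.mem_Iio.1 ht)
  have h2 : Tendsto (fun t : ℝ => 1 + t * c) (𝓝[<] 1) (𝓝 (1 + 1 * c)) := by
    refine Tendsto.mono_left ?_ nhdsWithin_le_nhds
    exact ContinuousAt.tendsto (by fun_prop)
  have h3 := h2.pos_mul_atTop (by linarith) (tendsto_inv_nhdsGT_zero.comp h1)
  exact h3

end Uniformization

/-! ### Arguments of unimodular paths and hyperbolic arcs -/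

/-- If `-f` has a continuous square root of modulus one on `(0,1)`, with limits at the endpoints
that avoid the negative axis, then the variation of the argument of `f` can be read off. -/
lemma isArgLift_of_neg_sq {f M : ℝ → ℂ} {M0 M1 : ℂ} (hM : ContinuousOn M (Set.Ioo 0 1))
    (hf : ∀ t ∈ Set.Ioo (0 : ℝ) 1, f t = -(M t) ^ 2) (hn : ∀ t ∈ Set.Ioo (0 : ℝ) 1, ‖M t‖ = 1)
    (hre : ∀ t ∈ Set.Ioo (0 : ℝ) 1, 0 < (M t).re) (h0 : Tendsto M (𝓝[>] 0) (𝓝 M0))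
    (h1 : Tendsto M (𝓝[<] 1) (𝓝 M1)) (hM0 : M0 ∈ Complex.slitPlane)
    (hM1 : M1 ∈ Complex.slitPlane) :
    (∃ α, IsArgLift (extendFrom (Set.Ioo 0 1) f) α) ∧
    extendFrom (Set.Ioo 0 1) f 0 = -M0 ^ 2 ∧
    argVariation (extendFrom (Set.Ioo 0 1) f) = 2 * (M1.arg - M0.arg) := by
  set E := extendFrom (Set.Ioo (0 : ℝ) 1) M with hE
  have hEc : ContinuousOn E (Set.Icc 0 1) := continuousOn_Icc_extendFrom_Ioo hM h0 h1
  have hE0 : E 0 = M0 := eq_lim_at_left_extendFrom_Ioo one_pos h0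
  have hE1 : E 1 = M1 := eq_lim_at_right_extendFrom_Ioo one_pos h1
  have hEi : ∀ t ∈ Set.Ioo (0 : ℝ) 1, E t = M t := fun t ht => extendFrom_extends hM t ht
  have hcl : Set.Icc (0 : ℝ) 1 = closure (Set.Ioo 0 1) := (closure_Ioo zero_ne_one).symm
  -- The relation f = -M² passes to the endpoints by continuity, which identifies the limits of f
  -- there.
  have hfE : ∀ t ∈ Set.Icc (0 : ℝ) 1, extendFrom (Set.Ioo 0 1) f t = -(E t) ^ 2 := by
    intro t ht
    apply extendFrom_eq (by rwa [← hcl])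
    have h2 : Tendsto (fun t => -(E t) ^ 2) (𝓝[Set.Ioo 0 1] t) (𝓝 (-(E t) ^ 2)) :=
      (((hEc t ht).mono Set.Ioo_subset_Icc_self).pow 2).neg
    refine h2.congr' ?_
    filter_upwards [self_mem_nhdsWithin] with x hx
    rw [hf x hx, hEi x hx]
  have hnE : ∀ t ∈ Set.Icc (0 : ℝ) 1, ‖E t‖ = 1 := by
    intro t ht
    have hne : (𝓝[Set.Ioo 0 1] t).NeBot := by
      rw [← mem_closure_iff_nhdsWithin_neBot, ← hcl]; exact ht
    have h2 : Tendsto (fun t => ‖E t‖) (𝓝[Set.Ioo 0 1] t) (𝓝 ‖E t‖) :=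
      ((hEc t ht).mono Set.Ioo_subset_Icc_self).norm
    have h3 : Tendsto (fun t => ‖E t‖) (𝓝[Set.Ioo 0 1] t) (𝓝 1) := by
      refine tendsto_const_nhds.congr' ?_
      filter_upwards [self_mem_nhdsWithin] with x hx
      rw [hEi x hx, hn x hx]
    exact tendsto_nhds_unique h2 h3
  have hslit : ∀ t ∈ Set.Icc (0 : ℝ) 1, E t ∈ Complex.slitPlane := by
    intro t ht
    rcases eq_or_lt_of_le ht.1 with h | h
    · rw [← h, hE0]; exact hM0
    rcases eq_or_lt_of_le ht.2 with h' | h'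
    · rw [h', hE1]; exact hM1
    · rw [hEi t ⟨h, h'⟩]; exact Or.inl (hre t ⟨h, h'⟩)
  -- The term -π accounts for the sign in -E². The principal argument of E is continuous because E
  -- never meets the cut.
  have hlift : IsArgLift (extendFrom (Set.Ioo 0 1) f) (fun t => 2 * (E t).arg - Real.pi) := by
    refine ⟨?_, ?_, ?_⟩
    · refine (continuousOn_const.mul ?_).sub continuousOn_const
      intro t ht
      exact (Complex.continuousAt_arg (hslit t ht)).comp_continuousWithinAt (hEc t ht)
    · intro t ht h
      rw [hfE t ht, neg_eq_zero, sq_eq_zero_iff] at h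
      have := hnE t ht
      rw [h, norm_zero] at this
      exact zero_ne_one this
    · intro t ht
      have e := Complex.norm_mul_exp_arg_mul_I (E t)
      rw [hnE t ht, Complex.ofReal_one, one_mul] at e
      rw [hfE t ht, norm_neg, norm_pow, hnE t ht, one_pow, Complex.ofReal_one, one_mul]
      push_cast
      rw [sub_mul, Complex.exp_sub, Complex.exp_pi_mul_I, div_neg, div_one, mul_assoc, two_mul,
        Complex.exp_add, e, sq]
  refine ⟨⟨_, hlift⟩, ?_, ?_⟩
  · rw [hfE 0 (by simp), hE0]
  · rw [argVariation_eq hlift, hE0, hE1]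
    ring

/-- `I * N / |N|`. -/
noncomputable def turn (z : ℂ) : ℂ := Complex.I * (z / ‖z‖)

lemma norm_turn {z : ℂ} (h : z ≠ 0) : ‖turn z‖ = 1 := by
  have : ‖z‖ ≠ 0 := norm_ne_zero_iff.2 h
  rw [turn, norm_mul, Complex.norm_I, one_mul, norm_div, Complex.norm_real, norm_norm, div_self this]

lemma turn_re (z : ℂ) : (turn z).re = -z.im / ‖z‖ := by
  rw [turn, Complex.I_mul_re, Complex.div_ofReal_im, neg_div]

/-- The factor i rotates the lower half-plane onto the right half-plane, where the principal
argument is continuous. -/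
lemma turn_re_pos {z : ℂ} (h : z.im < 0) : 0 < (turn z).re := by
  have : z ≠ 0 := by rintro rfl; simp at h
  rw [turn_re]
  have := norm_pos_iff.2 this
  have : 0 < -z.im := by linarith
  positivity

lemma continuousAt_turn {z : ℂ} (h : z ≠ 0) : ContinuousAt turn z := by
  have : (‖z‖ : ℂ) ≠ 0 := by exact_mod_cast norm_ne_zero_iff.2 h
  unfold turn
  fun_prop (disch := assumption)

lemma turn_mul_ofReal {r : ℝ} (hr : 0 < r) (z : ℂ) : turn (r * z) = turn z := by
  have : (r : ℂ) ≠ 0 := by exact_mod_cast hr.ne'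
  rw [turn, turn, norm_mul, Complex.norm_real, Real.norm_of_nonneg hr.le, Complex.ofReal_mul,
    mul_div_mul_left _ _ this]

lemma turn_ofReal_pos {r : ℝ} (hr : 0 < r) : turn r = Complex.I := by
  have := turn_mul_ofReal hr 1
  rw [mul_one] at this
  rw [this, turn]; simp

lemma turn_ofReal_neg {r : ℝ} (hr : r < 0) : turn r = -Complex.I := by
  have := turn_mul_ofReal (neg_pos.2 hr) (-1)
  rw [mul_neg, mul_one, Complex.ofReal_neg, neg_neg] at this
  rw [this, turn]; simp

/-- The square of z/|z| is z divided by its conjugate, and I² = -1 cancels the sign. -/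
lemma neg_turn_sq (z : ℂ) : -(turn z) ^ 2 = z / starRingEnd ℂ z := by
  rcases eq_or_ne z 0 with rfl | h
  · simp [turn]
  have h1 : (‖z‖ : ℂ) ≠ 0 := by exact_mod_cast norm_ne_zero_iff.2 h
  have h2 : starRingEnd ℂ z ≠ 0 := by simpa using h
  have h3 : (‖z‖ : ℂ) ^ 2 = z * starRingEnd ℂ z := by
    rw [Complex.mul_conj, Complex.normSq_eq_norm_sq]; push_cast; rfl
  rw [turn, mul_pow, Complex.I_sq, div_pow, h3]
  field_simp

/-- A hyperbolic arc, `γ₁` or `γ₂` along the curve `𝓡`. -/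
noncomputable def hypArc (A B E η : ℝ) : ℂ := ⟨A - B * Real.cosh η, -(E * Real.sinh η)⟩

lemma hypArc_mul_conj_im (A₁ B₁ E₁ A₂ B₂ E₂ η : ℝ) :
    (hypArc A₁ B₁ E₁ η * starRingEnd ℂ (hypArc A₂ B₂ E₂ η)).im
      = -Real.sinh η * ((B₁ * E₂ - B₂ * E₁) * Real.cosh η - (A₁ * E₂ - A₂ * E₁)) := by
  simp [hypArc]
  ring

lemma continuous_hypArc (A B E : ℝ) : Continuous (hypArc A B E) := by
  have : hypArc A B E = fun η => ((A - B * Real.cosh η : ℝ) : ℂ)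
      + ((-(E * Real.sinh η) : ℝ) : ℂ) * Complex.I := by
    funext η
    exact Complex.mk_eq_add_mul_I _ _
  rw [this]
  have := Real.continuous_cosh
  have := Real.continuous_sinh
  fun_prop

lemma tendsto_exp_mul_hypArc (A B E : ℝ) :
    Tendsto (fun η => (Real.exp (-η) : ℂ) * hypArc A B E η) atTop
      (𝓝 ⟨-(B / 2), -(E / 2)⟩) := by
  have h : ∀ η, (Real.exp (-η) : ℂ) * hypArc A B E η
      = ((A * Real.exp (-η) - B * ((1 + Real.exp (-η) ^ 2) / 2) : ℝ) : ℂ)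
        + ((-(E * ((1 - Real.exp (-η) ^ 2) / 2)) : ℝ) : ℂ) * Complex.I := by
    intro η
    have e : Real.exp η * Real.exp (-η) = 1 := by rw [← Real.exp_add, add_neg_cancel, Real.exp_zero]
    rw [hypArc, Complex.mk_eq_add_mul_I, mul_add, ← mul_assoc, ← Complex.ofReal_mul,
      ← Complex.ofReal_mul, Real.cosh_eq, Real.sinh_eq]
    congr 3
    · linear_combination (-B / 2) * e
    · linear_combination (-E / 2) * e
  simp only [h]
  have h0 := Real.tendsto_exp_neg_atTop_nhds_zero
  have hc : Continuous fun x : ℝ => ((A * x - B * ((1 + x ^ 2) / 2) : ℝ) : ℂ)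
        + ((-(E * ((1 - x ^ 2) / 2)) : ℝ) : ℂ) * Complex.I := by fun_prop
  have := (hc.tendsto 0).comp h0
  have e0 : (⟨-(B / 2), -(E / 2)⟩ : ℂ) = ((A * 0 - B * ((1 + 0 ^ 2) / 2) : ℝ) : ℂ)
        + ((-(E * ((1 - 0 ^ 2) / 2)) : ℝ) : ℂ) * Complex.I := by
    rw [← Complex.mk_eq_add_mul_I]
    ring_nf
  rw [e0]
  exact this

/-- The direction of `γ₁ γ₂⁻¹` along the curve. -/
lemma tendsto_turn_hypArc_zero {A₁ B₁ E₁ A₂ B₂ E₂ : ℝ} (h2 : 0 < A₂ - B₂)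
    (hE : A₁ = B₁ → 0 < E₁) :
    Tendsto (fun η => turn (hypArc A₁ B₁ E₁ η * starRingEnd ℂ (hypArc A₂ B₂ E₂ η))) (𝓝[>] 0)
      (𝓝 (if 0 < A₁ - B₁ then Complex.I else if A₁ - B₁ < 0 then -Complex.I else 1)) := by
  have c1 := continuous_hypArc A₁ B₁ E₁
  have c2 : Continuous fun η => starRingEnd ℂ (hypArc A₂ B₂ E₂ η) :=
    Complex.continuous_conj.comp (continuous_hypArc A₂ B₂ E₂)
  have v1 : hypArc A₁ B₁ E₁ 0 = ((A₁ - B₁ : ℝ) : ℂ) := by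
    apply Complex.ext <;> simp [hypArc]
  have v2 : starRingEnd ℂ (hypArc A₂ B₂ E₂ 0) = ((A₂ - B₂ : ℝ) : ℂ) := by
    apply Complex.ext <;> simp [hypArc]
  -- When the arc starts at 0, the positive factor 2 sinh(η/2) is divided out, which `turn` ignores.
  -- The remaining product tends to -iE₁(A₂ - B₂), whose turn is 1.
  by_cases h : A₁ = B₁
  · have e : ∀ η, hypArc A₁ B₁ E₁ η = ((2 * Real.sinh (η / 2) : ℝ) : ℂ) *
        (⟨-(A₁ * Real.sinh (η / 2)), -(E₁ * Real.cosh (η / 2))⟩ : ℂ) := by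
      intro η
      have d1 : Real.cosh η = 2 * Real.sinh (η / 2) ^ 2 + 1 := by
        have := Real.cosh_two_mul (η / 2)
        rw [mul_div_cancel₀ η two_ne_zero, Real.cosh_sq] at this
        linarith
      have d2 : Real.sinh η = 2 * Real.sinh (η / 2) * Real.cosh (η / 2) := by
        have := Real.sinh_two_mul (η / 2)
        rwa [mul_div_cancel₀ η two_ne_zero] at this
      apply Complex.ext
      · simp only [hypArc, Complex.re_ofReal_mul]
        rw [← h, d1]; ring
      · simp only [hypArc, Complex.im_ofReal_mul]
        rw [d2]; ring
    rw [if_neg (by simp [h]), if_neg (by simp [h])]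
    have c3 : Continuous fun η : ℝ =>
        (⟨-(A₁ * Real.sinh (η / 2)), -(E₁ * Real.cosh (η / 2))⟩ : ℂ) := by
      have : (fun η : ℝ => (⟨-(A₁ * Real.sinh (η / 2)), -(E₁ * Real.cosh (η / 2))⟩ : ℂ))
          = fun η : ℝ => ((-(A₁ * Real.sinh (η / 2)) : ℝ) : ℂ)
            + ((-(E₁ * Real.cosh (η / 2)) : ℝ) : ℂ) * Complex.I := by
        funext η
        exact Complex.mk_eq_add_mul_I _ _
      rw [this]
      have := Real.continuous_cosh
      have := Real.continuous_sinh
      fun_prop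
    have hE := hE h
    have hlim : Tendsto (fun η => (⟨-(A₁ * Real.sinh (η / 2)), -(E₁ * Real.cosh (η / 2))⟩ : ℂ)
        * starRingEnd ℂ (hypArc A₂ B₂ E₂ η)) (𝓝 0) (𝓝 (⟨-(A₁ * Real.sinh (0 / 2)),
        -(E₁ * Real.cosh (0 / 2))⟩ * starRingEnd ℂ (hypArc A₂ B₂ E₂ 0))) := (c3.mul c2).tendsto 0
    have hv : (⟨-(A₁ * Real.sinh (0 / 2)), -(E₁ * Real.cosh (0 / 2))⟩ : ℂ)
        * starRingEnd ℂ (hypArc A₂ B₂ E₂ 0) = ((E₁ * (A₂ - B₂) : ℝ) : ℂ) * (-Complex.I) := by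
      rw [v2]
      apply Complex.ext <;> simp
    have hne : ((E₁ * (A₂ - B₂) : ℝ) : ℂ) * (-Complex.I) ≠ 0 := by
      refine mul_ne_zero ?_ (neg_ne_zero.2 Complex.I_ne_zero)
      exact_mod_cast (mul_pos hE h2).ne'
    rw [hv] at hlim
    have hlim2 := (continuousAt_turn hne).tendsto.comp hlim
    have hv2 : turn (((E₁ * (A₂ - B₂) : ℝ) : ℂ) * (-Complex.I)) = 1 := by
      rw [turn_mul_ofReal (mul_pos hE h2), turn]
      simp
    rw [hv2] at hlim2
    refine (hlim2.mono_left nhdsWithin_le_nhds).congr' ?_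
    filter_upwards [self_mem_nhdsWithin] with η hη
    rw [e, mul_assoc, turn_mul_ofReal]
    · rfl
    · have : 0 < Real.sinh (η / 2) := Real.sinh_pos_iff.2 (half_pos (Set.mem_Ioi.1 hη))
      positivity
  · have hlim : Tendsto (fun η => hypArc A₁ B₁ E₁ η * starRingEnd ℂ (hypArc A₂ B₂ E₂ η)) (𝓝 0)
        (𝓝 (hypArc A₁ B₁ E₁ 0 * starRingEnd ℂ (hypArc A₂ B₂ E₂ 0))) := (c1.mul c2).tendsto 0
    rw [v1, v2, ← Complex.ofReal_mul] at hlim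
    have hne : ((A₁ - B₁) * (A₂ - B₂)) ≠ 0 := mul_ne_zero (sub_ne_zero.2 h) h2.ne'
    have hlim2 := (continuousAt_turn (z := (((A₁ - B₁) * (A₂ - B₂) : ℝ) : ℂ))
      (by exact_mod_cast hne)).tendsto.comp hlim
    refine (Tendsto.mono_left ?_ nhdsWithin_le_nhds)
    rcases lt_or_gt_of_ne (sub_ne_zero.2 h) with h' | h'
    · rw [if_neg (by linarith), if_pos h', ← turn_ofReal_neg (mul_neg_of_neg_of_pos h' h2)]
      exact hlim2
    · rw [if_pos h', ← turn_ofReal_pos (mul_pos h' h2)]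
      exact hlim2

/-- Multiplied by exp(-2η), the product converges to a number with imaginary part -(B₁E₂ - B₂E₁)/4 <
0; its direction therefore has a limit, which is not real. -/
lemma tendsto_turn_hypArc_atTop {A₁ B₁ E₁ A₂ B₂ E₂ : ℝ} (hd : 0 < B₁ * E₂ - B₂ * E₁) :
    ∃ M : ℂ, 0 < M.re ∧ Tendsto
      (fun η => turn (hypArc A₁ B₁ E₁ η * starRingEnd ℂ (hypArc A₂ B₂ E₂ η))) atTop (𝓝 M) := by
  have h1 := tendsto_exp_mul_hypArc A₁ B₁ E₁
  have h2 := (Complex.continuous_conj.tendsto _).comp (tendsto_exp_mul_hypArc A₂ B₂ E₂)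
  have h := h1.mul h2
  set L : ℂ := ⟨-(B₁ / 2), -(E₁ / 2)⟩ * starRingEnd ℂ ⟨-(B₂ / 2), -(E₂ / 2)⟩ with hL
  have him : L.im < 0 := by
    have : L.im = -(B₁ * E₂ - B₂ * E₁) / 4 := by
      rw [hL]
      simp
      ring
    rw [this]
    linarith
  have hne : L ≠ 0 := by intro h0; rw [h0] at him; simp at him
  refine ⟨turn L, turn_re_pos him, ?_⟩
  refine ((continuousAt_turn hne).tendsto.comp h).congr fun η => ?_
  simp only [Function.comp, map_mul, Complex.conj_ofReal]
  rw [mul_mul_mul_comm, ← Complex.ofReal_mul, turn_mul_ofReal]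
  positivity

/-! ### The coefficient along the curve and its index -/

namespace Uniformization

variable {D : RBMData} (U : Uniformization D)

lemma X_curve (η : ℝ) : U.X (D.beta - Complex.I * η)
    = ((U.r₁ * (Real.cos (U.s₀ - D.beta) - Real.cosh η) : ℝ) : ℂ) := by
  rw [U.X_mem_real (by simp)]
  simp

lemma cos_curve (D : RBMData) (η : ℝ) : Complex.cos (D.beta - Complex.I * η)
    = ⟨Real.cos D.beta * Real.cosh η, Real.sin D.beta * Real.sinh η⟩ := by
  apply Complex.ext
  · rw [Complex.cos_re_eq]; simp
  · rw [Complex.cos_im_eq]; simp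

lemma gam1_curve (η : ℝ) : D.gam1 (U.X (D.beta - Complex.I * η)) (U.Y (D.beta - Complex.I * η))
    = hypArc (D.R 0 0 * U.r₁ * Real.cos (U.s₀ - D.beta) + D.R 1 0 * U.r₂ * Real.cos U.s₀)
      (D.R 0 0 * U.r₁ + D.R 1 0 * U.r₂ * Real.cos D.beta)
      (D.R 1 0 * U.r₂ * Real.sin D.beta) η := by
  rw [RBMData.gam1, X_curve, Y, cos_curve, ← Complex.ofReal_cos, hypArc]
  apply Complex.ext
  · simp only [Complex.add_re, Complex.re_ofReal_mul, Complex.sub_re, Complex.ofReal_re]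
    ring
  · simp only [Complex.add_im, Complex.im_ofReal_mul, Complex.sub_im, Complex.ofReal_im]
    ring

lemma gam2_curve (η : ℝ) : D.gam2 (U.X (D.beta - Complex.I * η)) (U.Y (D.beta - Complex.I * η))
    = hypArc (D.R 0 1 * U.r₁ * Real.cos (U.s₀ - D.beta) + D.R 1 1 * U.r₂ * Real.cos U.s₀)
      (D.R 0 1 * U.r₁ + D.R 1 1 * U.r₂ * Real.cos D.beta)
      (D.R 1 1 * U.r₂ * Real.sin D.beta) η := by
  rw [RBMData.gam2, X_curve, Y, cos_curve, ← Complex.ofReal_cos, hypArc]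
  apply Complex.ext
  · simp only [Complex.add_re, Complex.re_ofReal_mul, Complex.sub_re, Complex.ofReal_re]
    ring
  · simp only [Complex.add_im, Complex.im_ofReal_mul, Complex.sub_im, Complex.ofReal_im]
    ring

/-- Conjugate points of the curve share the same real value of Θ₁⁻, so γ₁ and γ₂ at the conjugate
point are the conjugates of their values. Thus G is the quotient of N = γ₁ · conj γ₂ by its
conjugate. -/
lemma G_curve (η : ℝ) : D.G (U.Y (D.beta - Complex.I * η))
    = -(turn (D.gam1 (U.X (D.beta - Complex.I * η)) (U.Y (D.beta - Complex.I * η)) *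
      starRingEnd ℂ (D.gam2 (U.X (D.beta - Complex.I * η)) (U.Y (D.beta - Complex.I * η))))) ^ 2 := by
  have hb := U.beta_pos
  have hb' := U.beta_lt
  set s : ℂ := D.beta - Complex.I * η with hs
  have hsre : s.re = D.beta := by simp [hs]
  have hconj : star (U.Y s) = U.Y (starRingEnd ℂ s) := by
    rw [Y, Y, Complex.star_def]
    simp [← Complex.cos_conj]
  have h1 : D.Theta1Minus (U.Y s) = U.X s := U.Theta1Minus_Y (by linarith) (by linarith)
  have h2 : D.Theta1Minus (star (U.Y s)) = U.X s := by
    rw [hconj, U.Theta1Minus_Y (by simpa [hsre]) (by simpa [hsre]), hs, U.X_curve]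
    have : starRingEnd ℂ (D.beta - Complex.I * η) = D.beta - Complex.I * (-η : ℝ) := by simp
    rw [this, U.X_curve, Real.cosh_neg]
  have hX : starRingEnd ℂ (U.X s) = U.X s := by rw [hs, U.X_curve, Complex.conj_ofReal]
  have g1 : D.gam1 (U.X s) (star (U.Y s)) = starRingEnd ℂ (D.gam1 (U.X s) (U.Y s)) := by
    simp [RBMData.gam1, hX]
  have g2 : D.gam2 (U.X s) (star (U.Y s)) = starRingEnd ℂ (D.gam2 (U.X s) (U.Y s)) := by
    simp [RBMData.gam2, hX]
  rw [neg_turn_sq, RBMData.G, h1, h2, g1, g2, map_mul, Complex.conj_conj, div_mul_div_comm]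
  congr 1
  ring

/-- After a positive half-angle factor is removed, the sign is that of r₂₂ r₂ sin m - r₁₂ r₁ sin(β -
m) at m = (β + s₀)/2. At m = s₀ this expression is positive by the drift condition. For r₁₂ ≤ 0
positivity at the midpoint is immediate, and for r₁₂ > 0 the ratio to sin m increases from s₀ on. -/
lemma gam2_vertex_pos (U : Uniformization D) (h : D.Stable) :
    0 < D.R 0 1 * U.r₁ * (Real.cos (U.s₀ - D.beta) - 1)
      + D.R 1 1 * U.r₂ * (Real.cos U.s₀ - Real.cos D.beta) := by
  have h1 := U.r₁_pos
  have h2 := U.r₂_pos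
  have hk := U.k_pos
  have hs := U.sin_beta_pos
  have hs0 := U.s₀_pos
  have hs1 := U.s₀_lt
  have hb := U.beta_lt
  have hR := h.r22_pos
  have hd := h.drift1
  rw [U.mu1, U.mu2] at hd
  have e : D.R 1 1 * -(U.k / U.r₁ * Real.sin D.beta * Real.sin U.s₀)
      - D.R 0 1 * -(U.k / U.r₂ * Real.sin D.beta * Real.sin (D.beta - U.s₀))
      = -(U.k / (U.r₁ * U.r₂) * Real.sin D.beta * (D.R 1 1 * U.r₂ * Real.sin U.s₀
        - D.R 0 1 * U.r₁ * Real.sin (D.beta - U.s₀))) := by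
    field_simp
    ring
  rw [e, neg_lt_zero] at hd
  replace hd : 0 < D.R 1 1 * U.r₂ * Real.sin U.s₀ - D.R 0 1 * U.r₁ * Real.sin (D.beta - U.s₀) :=
    pos_of_mul_pos_right hd (by positivity)
  set m := (D.beta + U.s₀) / 2 with hm
  have p0 : 0 < Real.sin ((D.beta - U.s₀) / 2) := U.sin_half_sub_pos U.s₀_lt le_rfl
  have pm : 0 < Real.sin m := Real.sin_pos_of_pos_of_lt_pi (by linarith) (by linarith)
  have pbm : 0 < Real.sin (D.beta - m) := Real.sin_pos_of_pos_of_lt_pi (by linarith) (by linarith)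
  have ps : 0 < Real.sin U.s₀ := U.sin_s₀_pos
  have pms : 0 < Real.sin (m - U.s₀) := Real.sin_pos_of_pos_of_lt_pi (by linarith) (by linarith)
  have e2 : D.R 0 1 * U.r₁ * (Real.cos (U.s₀ - D.beta) - 1)
      + D.R 1 1 * U.r₂ * (Real.cos U.s₀ - Real.cos D.beta)
      = 2 * Real.sin ((D.beta - U.s₀) / 2) *
        (D.R 1 1 * U.r₂ * Real.sin m - D.R 0 1 * U.r₁ * Real.sin (D.beta - m)) := by
    have a1 : Real.cos (U.s₀ - D.beta) - 1
        = -2 * Real.sin ((D.beta - U.s₀) / 2) * Real.sin (D.beta - m) := by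
      have := Real.cos_sub_cos (U.s₀ - D.beta) 0
      rw [Real.cos_zero] at this
      rw [this, show (U.s₀ - D.beta + 0) / 2 = -((D.beta - U.s₀) / 2) by ring,
        show (U.s₀ - D.beta - 0) / 2 = -((D.beta - U.s₀) / 2) by ring,
        show D.beta - m = (D.beta - U.s₀) / 2 by rw [hm]; ring, Real.sin_neg]
      ring
    have a2 : Real.cos U.s₀ - Real.cos D.beta = 2 * Real.sin ((D.beta - U.s₀) / 2) * Real.sin m := by
      rw [Real.cos_sub_cos, show (U.s₀ - D.beta) / 2 = -((D.beta - U.s₀) / 2) by ring,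
        add_comm U.s₀, Real.sin_neg]
      ring
    rw [a1, a2]
    ring
  rw [e2]
  refine mul_pos (by positivity) ?_
  rcases le_or_gt (D.R 0 1) 0 with hr | hr
  · have : 0 < D.R 1 1 * U.r₂ * Real.sin m := by positivity
    have : 0 ≤ -D.R 0 1 * (U.r₁ * Real.sin (D.beta - m)) := mul_nonneg (by linarith) (by positivity)
    linarith
  · have e3 : (D.R 1 1 * U.r₂ * Real.sin m - D.R 0 1 * U.r₁ * Real.sin (D.beta - m)) * Real.sin U.s₀
        = (D.R 1 1 * U.r₂ * Real.sin U.s₀ - D.R 0 1 * U.r₁ * Real.sin (D.beta - U.s₀)) * Real.sin m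
          + D.R 0 1 * U.r₁ * (Real.sin D.beta * Real.sin (m - U.s₀)) := by
      simp only [Real.sin_sub]
      ring
    refine pos_of_mul_pos_left ?_ ps.le
    rw [e3]
    positivity

lemma gam1Vertex_eq' (U : Uniformization D) : D.gam1Vertex =
    D.R 0 0 * U.r₁ * Real.cos (U.s₀ - D.beta) + D.R 1 0 * U.r₂ * Real.cos U.s₀ -
      (D.R 0 0 * U.r₁ + D.R 1 0 * U.r₂ * Real.cos D.beta) := by
  rw [RBMData.gam1Vertex, RBMData.gam1Real, U.vertex_eq, U.theta1Minus_eq, YReal]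
  ring

/-- The index of the boundary value problem. -/
lemma index_eq (U : Uniformization D) (h : D.Stable) :
    (∃ α : ℝ → ℝ, IsArgLift D.H α) ∧ D.index = if 0 < D.gam1Vertex then -1 else 0 := by
  obtain ⟨c, hc, hcq⟩ := U.exists_w_q h
  have h1 := U.r₁_pos
  have h2 := U.r₂_pos
  have hs := U.sin_beta_pos
  have hs0 := U.s₀_pos
  have hs1 := U.s₀_lt
  have hb := U.beta_lt
  have hpi := Real.pi_pos
  set A₁ := D.R 0 0 * U.r₁ * Real.cos (U.s₀ - D.beta) + D.R 1 0 * U.r₂ * Real.cos U.s₀ with hA₁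
  set B₁ := D.R 0 0 * U.r₁ + D.R 1 0 * U.r₂ * Real.cos D.beta with hB₁
  set E₁ := D.R 1 0 * U.r₂ * Real.sin D.beta with hE₁
  set A₂ := D.R 0 1 * U.r₁ * Real.cos (U.s₀ - D.beta) + D.R 1 1 * U.r₂ * Real.cos U.s₀ with hA₂
  set B₂ := D.R 0 1 * U.r₁ + D.R 1 1 * U.r₂ * Real.cos D.beta with hB₂
  set E₂ := D.R 1 1 * U.r₂ * Real.sin D.beta with hE₂
  have hV : D.gam1Vertex = A₁ - B₁ := U.gam1Vertex_eq'
  have hV2 : 0 < A₂ - B₂ := by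
    have := U.gam2_vertex_pos h
    rw [hA₂, hB₂]
    linarith
  have hd : B₁ * E₂ - B₂ * E₁
      = U.r₁ * U.r₂ * Real.sin D.beta * (D.R 0 0 * D.R 1 1 - D.R 0 1 * D.R 1 0) := by
    rw [hB₁, hB₂, hE₁, hE₂]; ring
  have hd' : A₁ * E₂ - A₂ * E₁ = (B₁ * E₂ - B₂ * E₁) * Real.cos (U.s₀ - D.beta) := by
    rw [hd, hA₁, hA₂, hE₁, hE₂]; ring
  have hdpos : 0 < B₁ * E₂ - B₂ * E₁ := by
    rw [hd]
    have := h.det_pos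
    positivity
  -- At the vertex the first coordinate is negative and the second is positive, so γ₁ can vanish
  -- there only if r₂₁ > 0.
  have hE : A₁ = B₁ → 0 < E₁ := by
    intro hAB
    have hv0 : D.gam1Vertex = 0 := by rw [hV, hAB, sub_self]
    rw [RBMData.gam1Vertex, RBMData.gam1Real, U.vertex_eq, U.theta1Minus_eq] at hv0
    have hvpos := U.YReal_pos U.s₀_lt hb.le
    have hlt : Real.cos (U.s₀ - D.beta) < 1 := by
      refine lt_of_le_of_ne (Real.cos_le_one _) fun he => ?_
      rw [Real.cos_eq_one_iff_of_lt_of_lt (by linarith) (by linarith)] at he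
      linarith
    have : 0 < D.R 0 0 * (U.r₁ * (1 - Real.cos (U.s₀ - D.beta))) := by
      have := h.r11_pos
      have : 0 < 1 - Real.cos (U.s₀ - D.beta) := by linarith
      positivity
    have : 0 < D.R 1 0 * U.YReal D.beta := by linarith
    have : 0 < D.R 1 0 := pos_of_mul_pos_left this hvpos.le
    positivity
  set N : ℝ → ℂ := fun η => hypArc A₁ B₁ E₁ η * starRingEnd ℂ (hypArc A₂ B₂ E₂ η) with hN
  -- By `hd'` the imaginary part equals -(det) sinh η (cosh η - cos(s₀ - β)), where det is a
  -- positive multiple of det R.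
  have hNim : ∀ η, 0 < η → (N η).im < 0 := by
    intro η hη
    rw [hN, hypArc_mul_conj_im, hd', ← mul_sub]
    have h1 := Real.sinh_pos_iff.2 hη
    have h2 := Real.one_lt_cosh.2 hη.ne'
    have h3 := Real.cos_le_one (U.s₀ - D.beta)
    have h4 : 0 < Real.cosh η - Real.cos (U.s₀ - D.beta) := by linarith
    have : 0 < Real.sinh η * ((B₁ * E₂ - B₂ * E₁) * (Real.cosh η - Real.cos (U.s₀ - D.beta))) := by
      positivity
    linarith
  have hNne : ∀ η, 0 < η → N η ≠ 0 := by
    intro η hη h0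
    have := hNim η hη
    rw [h0] at this
    simp at this
  have hNc : Continuous N :=
    (continuous_hypArc _ _ _).mul (Complex.continuous_conj.comp (continuous_hypArc _ _ _))
  obtain ⟨M1, hM1, hM1lim⟩ := tendsto_turn_hypArc_atTop (A₁ := A₁) (A₂ := A₂) hdpos
  have hM0lim := tendsto_turn_hypArc_zero (E₂ := E₂) hV2 hE
  set M0 : ℂ := if 0 < A₁ - B₁ then Complex.I else if A₁ - B₁ < 0 then -Complex.I else 1 with hM0
  have hM0slit : M0 ∈ Complex.slitPlane := by
    rw [hM0]
    split_ifs <;> simp [Complex.mem_slitPlane_iff]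
  have key := isArgLift_of_neg_sq (f := fun t => D.G (D.WinvMinus t))
    (M := fun t => turn (N (height D c t))) (M0 := M0) (M1 := M1) ?_ ?_ ?_ ?_ ?_ ?_ hM0slit
    (Or.inl hM1)
  rotate_left
  · intro t ht
    refine ContinuousAt.comp_continuousWithinAt (g := turn) (f := fun t => N (height D c t))
      (continuousAt_turn (hNne _ (U.height_pos hc ht.1 ht.2))) ?_
    refine hNc.continuousAt.comp_continuousWithinAt ?_
    exact (continuousOn_height hc).mono Set.Ioo_subset_Ico_self t ht
  · intro t ht
    rw [U.WinvMinus_eq h hc hcq ht.1 ht.2, U.G_curve, U.gam1_curve, U.gam2_curve]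
  · intro t ht
    exact norm_turn (hNne _ (U.height_pos hc ht.1 ht.2))
  · intro t ht
    exact turn_re_pos (hNim _ (U.height_pos hc ht.1 ht.2))
  · refine hM0lim.comp (tendsto_nhdsWithin_iff.2 ⟨tendsto_height_zero hc, ?_⟩)
    rw [← nhdsWithin_Ioo_eq_nhdsGT (one_pos : (0 : ℝ) < 1)]
    filter_upwards [self_mem_nhdsWithin] with t ht
    exact U.height_pos hc ht.1 ht.2
  · exact hM1lim.comp (U.tendsto_height_one hc)
  obtain ⟨k1, k2, k3⟩ := key
  refine ⟨k1, ?_⟩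
  have a1 := Complex.abs_arg_lt_pi_div_two_iff.2 (Or.inl hM1)
  rw [abs_lt] at a1
  have hdelta : D.delta = (-M0 ^ 2).arg := by rw [RBMData.delta, RBMData.H, k2]
  have hDelta : D.Delta = 2 * (M1.arg - M0.arg) := k3
  rw [RBMData.index, hdelta, hDelta, hV, Int.floor_eq_iff, le_div_iff₀ (by positivity),
    div_lt_iff₀ (by positivity), hM0]
  -- With |arg M1| < π/2, the sum δ + Δ is 2 arg M1 - π, 2 arg M1 + π and 2 arg M1 + π in the three
  -- cases. In the last one the π comes from δ and not from Δ.
  split_ifs with hp hn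
  · have : (-Complex.I ^ 2 : ℂ).arg = 0 := by simp
    rw [this, Complex.arg_I]
    push_cast
    constructor <;> linarith
  · have : (-(-Complex.I) ^ 2 : ℂ).arg = 0 := by simp
    rw [this, Complex.arg_neg_I]
    push_cast
    constructor <;> linarith
  · have : (-1 ^ 2 : ℂ).arg = Real.pi := by simp
    rw [this, Complex.arg_one]
    push_cast
    constructor <;> linarith

end Uniformization

/-! ### Riemann–Stieltjes sums -/

/-- The nodes of the uniform partition of `[0,1]` into `n + 1` intervals. -/
noncomputable def node (n k : ℕ) : ℝ≥0 := k / (n + 1)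

lemma node_zero (n : ℕ) : node n 0 = 0 := by simp [node]

lemma node_last (n : ℕ) : node n (n + 1) = 1 := by
  rw [node]; push_cast; exact div_self (by positivity)

lemma node_mono (n : ℕ) : Monotone (node n) := by
  intro a b h
  unfold node
  gcongr

lemma node_le_one {n k : ℕ} (h : k ≤ n + 1) : node n k ≤ 1 := by
  rw [← node_last n]; exact node_mono n h

lemma node_succ_sub (n k : ℕ) : ((node n (k + 1) : ℝ≥0) : ℝ) - node n k = 1 / (n + 1) := by
  simp only [node]; push_cast; ring

lemma pathMeasure_Ioc {l : ℝ≥0 → ℝ} (hm : Monotone l) (hc : Continuous l) (a b : ℝ≥0) :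
    pathMeasure l (Set.Ioc a b) = ENNReal.ofReal (l b - l a) := by
  have h : ∀ x, hm.stieltjesFunction x = l x := fun x => by
    rw [hm.stieltjesFunction_eq]
    exact (hc.continuousAt.continuousWithinAt).rightLim_eq
  rw [pathMeasure, dif_pos hm, StieltjesFunction.measure_Ioc, h, h]

/-- The time 0 is the bottom element, where a Stieltjes measure has no atom; integrals over [0,1]
and (0,1] therefore agree. -/
lemma pathMeasure_zero (l : ℝ≥0 → ℝ) : pathMeasure l {0} = 0 := by
  by_cases hm : Monotone l
  · rw [pathMeasure, dif_pos hm, ← bot_eq_zero, ← botSet_eq_singleton_of_isBot isBot_bot]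
    exact StieltjesFunction.measure_botSet _
  · rw [pathMeasure, dif_neg hm]; rfl

lemma Iic_one_eq : Set.Iic (1 : ℝ≥0) = Set.Icc 0 1 := by
  ext x; simp

lemma pathMeasure_Iic_one {l : ℝ≥0 → ℝ} (hm : Monotone l) (hc : Continuous l) :
    pathMeasure l (Set.Iic 1) = ENNReal.ofReal (l 1 - l 0) := by
  have h : Set.Iic (1 : ℝ≥0) = {0} ∪ Set.Ioc 0 1 := by
    rw [Iic_one_eq, Set.singleton_union, Set.Ioc_insert_left zero_le_one]
  rw [h, measure_union (by simp) measurableSet_Ioc, pathMeasure_zero, zero_add,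
    pathMeasure_Ioc hm hc]

lemma exists_node_mem {n : ℕ} {t : ℝ≥0} (h0 : 0 < t) (h1 : t ≤ 1) :
    ∃ k < n + 1, t ∈ Set.Ioc (node n k) (node n (k + 1)) ∧ k + 1 = ⌈t * (n + 1)⌉₊ := by
  have hn : (0 : ℝ≥0) < n + 1 := by positivity
  have hpos : 0 < ⌈t * (n + 1)⌉₊ := Nat.ceil_pos.2 (by positivity)
  obtain ⟨k, hk⟩ := Nat.exists_eq_succ_of_ne_zero hpos.ne'
  have hk' : k + 1 = ⌈t * (n + 1)⌉₊ := hk.symm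
  refine ⟨k, ?_, ⟨?_, ?_⟩, hk'⟩
  · have : ⌈t * (n + 1)⌉₊ ≤ n + 1 := by
      rw [Nat.ceil_le]
      push_cast
      exact mul_le_of_le_one_left hn.le h1
    omega
  · rw [node, div_lt_iff₀ hn]
    exact Nat.lt_ceil.1 (by omega)
  · rw [node, le_div_iff₀ hn, hk']
    exact Nat.le_ceil _

lemma node_disjoint {n j k : ℕ} {t : ℝ≥0} (hj : t ∈ Set.Ioc (node n j) (node n (j + 1)))
    (hk : t ∈ Set.Ioc (node n k) (node n (k + 1))) : j = k := by
  by_contra hne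
  rcases lt_or_gt_of_ne hne with h | h
  · exact absurd (hj.2.trans (node_mono n h)) (not_le.2 hk.1)
  · exact absurd (hk.2.trans (node_mono n h)) (not_le.2 hj.1)

lemma tendsto_node_ceil {t : ℝ≥0} :
    Tendsto (fun n : ℕ => node n ⌈t * (n + 1)⌉₊) atTop (𝓝 t) := by
  have h1 : Tendsto (fun n : ℕ => (n : ℝ) + 1) atTop atTop :=
    tendsto_atTop_add_const_right _ _ tendsto_natCast_atTop_atTop
  have h := (tendsto_nat_ceil_mul_div_atTop (R := ℝ) (a := t) t.2).comp h1
  rw [← NNReal.tendsto_coe]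
  refine h.congr fun n => ?_
  have : ⌈t * (n + 1)⌉₊ = ⌈(t : ℝ) * ((n : ℝ) + 1)⌉₊ := by
    refine eq_of_forall_ge_iff fun c => ?_
    rw [Nat.ceil_le, Nat.ceil_le, ← NNReal.coe_le_coe]
    push_cast
    rfl
  simp only [Function.comp, node, this]
  push_cast
  rfl

/-- The right-endpoint sums are integrals of step functions which converge to f pointwise, since
⌈t(n+1)⌉/(n+1) → t, and which are bounded by the maximum of ‖f‖ on [0,1]. -/
lemma tendsto_stieltjesSum {F : Type*} [NormedAddCommGroup F] [NormedSpace ℝ F] [CompleteSpace F]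
    {l : ℝ≥0 → ℝ} (hm : Monotone l) (hc : Continuous l) {f : ℝ≥0 → F} (hf : Continuous f) :
    Tendsto (fun n : ℕ => ∑ k ∈ Finset.range (n + 1),
      (l (node n (k + 1)) - l (node n k)) • f (node n (k + 1))) atTop
      (𝓝 (∫ t in Set.Iic 1, f t ∂pathMeasure l)) := by
  set m := (pathMeasure l).restrict (Set.Ioc 0 1) with hmdef
  have hfin : IsFiniteMeasure m := ⟨by
    rw [hmdef, Measure.restrict_apply_univ, pathMeasure_Ioc hm hc]
    exact ENNReal.ofReal_lt_top⟩
  rw [Iic_one_eq, integral_Icc_eq_integral_Ioc' (pathMeasure_zero l)]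
  set g : ℕ → ℝ≥0 → F := fun n t => ∑ k ∈ Finset.range (n + 1),
    (Set.Ioc (node n k) (node n (k + 1))).indicator (fun _ => f (node n (k + 1))) t with hg
  have hgt : ∀ n, ∀ t ∈ Set.Ioc (0 : ℝ≥0) 1, g n t = f (node n ⌈t * (n + 1)⌉₊) ∧
      node n ⌈t * (n + 1)⌉₊ ≤ 1 := by
    intro n t ht
    obtain ⟨k, hk, hmem, hceil⟩ := exists_node_mem (n := n) ht.1 ht.2
    refine ⟨?_, by rw [← hceil]; exact node_le_one hk⟩
    simp only [hg]
    rw [Finset.sum_eq_single_of_mem k (Finset.mem_range.2 hk), Set.indicator_of_mem hmem, hceil]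
    intro j _ hj
    exact Set.indicator_of_notMem (fun h => hj (node_disjoint h hmem)) _
  have hsub : ∀ n, ∀ k ∈ Finset.range (n + 1),
      Set.Ioc (node n k) (node n (k + 1)) ⊆ Set.Ioc 0 1 := fun n k hk =>
    Set.Ioc_subset_Ioc zero_le (node_le_one (Finset.mem_range.1 hk))
  have hint : ∀ n, ∫ t, g n t ∂m = ∑ k ∈ Finset.range (n + 1),
      (l (node n (k + 1)) - l (node n k)) • f (node n (k + 1)) := by
    intro n
    rw [integral_finsetSum]
    · refine Finset.sum_congr rfl fun k hk => ?_
      rw [integral_indicator_const _ measurableSet_Ioc, measureReal_def,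
        Measure.restrict_apply measurableSet_Ioc, Set.inter_eq_self_of_subset_left (hsub n k hk),
        pathMeasure_Ioc hm hc, ENNReal.toReal_ofReal (sub_nonneg.2 (hm (node_mono n (Nat.le_succ k))))]
    · intro k _
      exact (integrable_const _).indicator measurableSet_Ioc
  simp only [← hint]
  obtain ⟨C, hC⟩ := isCompact_Icc.exists_bound_of_continuousOn (hf.continuousOn (s := Set.Icc 0 1))
  refine tendsto_integral_of_dominated_convergence (fun _ => C) ?_ (integrable_const _) ?_ ?_
  · intro n
    refine Finset.aestronglyMeasurable_fun_sum _ fun k _ => ?_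
    exact (stronglyMeasurable_const.indicator measurableSet_Ioc).aestronglyMeasurable
  · intro n
    filter_upwards [ae_restrict_mem measurableSet_Ioc] with t ht
    rw [(hgt n t ht).1]
    exact hC _ ⟨zero_le, (hgt n t ht).2⟩
  · filter_upwards [ae_restrict_mem measurableSet_Ioc] with t ht
    refine ((hf.tendsto t).comp tendsto_node_ceil).congr fun n => ?_
    exact (hgt n t ht).1.symm

lemma tendsto_sum_sq_increments {m : ℝ≥0 → ℝ} (hm : Monotone m) (hc : Continuous m) :
    Tendsto (fun n : ℕ => ∑ k ∈ Finset.range (n + 1), (m (node n (k + 1)) - m (node n k)) ^ 2)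
      atTop (𝓝 0) := by
  have huc := isCompact_Icc.uniformContinuousOn_of_continuous (hc.continuousOn (s := Set.Icc 0 1))
  rw [Metric.uniformContinuousOn_iff] at huc
  rw [Metric.tendsto_atTop]
  intro ε hε
  have hV : 0 ≤ m 1 - m 0 := sub_nonneg.2 (hm zero_le_one)
  -- The sum of squares is at most the largest increment times the total variation m 1 - m 0. The
  -- added 1 keeps the divisor positive when that variation is zero.
  obtain ⟨δ, hδ, hδ'⟩ := huc (ε / (m 1 - m 0 + 1)) (by positivity)
  obtain ⟨N, hN⟩ := exists_nat_one_div_lt hδ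
  refine ⟨N, fun n hn => ?_⟩
  have hnn : ∀ k, 0 ≤ m (node n (k + 1)) - m (node n k) := fun k =>
    sub_nonneg.2 (hm (node_mono n (Nat.le_succ k)))
  have hle : ∑ k ∈ Finset.range (n + 1), (m (node n (k + 1)) - m (node n k)) ^ 2
      ≤ ∑ k ∈ Finset.range (n + 1), ε / (m 1 - m 0 + 1) * (m (node n (k + 1)) - m (node n k)) := by
    refine Finset.sum_le_sum fun k hk => ?_
    have hk := Finset.mem_range.1 hk
    have := hδ' (node n (k + 1)) ⟨zero_le, node_le_one hk⟩ (node n k)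
      ⟨zero_le, node_le_one hk.le⟩ (by
        rw [NNReal.dist_eq, node_succ_sub, abs_of_pos (by positivity)]
        refine lt_of_le_of_lt ?_ hN
        gcongr)
    rw [Real.dist_eq, abs_of_nonneg (hnn k)] at this
    rw [sq]
    exact mul_le_mul_of_nonneg_right this.le (hnn k)
  rw [← Finset.mul_sum, Finset.sum_range_sub (fun k => m (node n k)), node_last, node_zero] at hle
  rw [Real.dist_eq, sub_zero, abs_of_nonneg (Finset.sum_nonneg fun k _ => sq_nonneg _)]
  refine hle.trans_lt ?_
  rw [div_mul_eq_mul_div, div_lt_iff₀ (by positivity)]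
  nlinarith

lemma norm_one_sub_exp_neg_mul_I_sub_le (x : ℝ) :
    ‖1 - Complex.exp (-(x * Complex.I)) - x * Complex.I‖ ≤ 3 * x ^ 2 := by
  rcases le_or_gt |x| 1 with h | h
  · have hn : ‖-(x * Complex.I : ℂ)‖ = |x| := by simp
    have := Complex.norm_exp_sub_one_sub_id_le (x := -(x * Complex.I)) (by rw [hn]; exact h)
    rw [hn, sq_abs] at this
    rw [← norm_neg]
    refine le_trans (le_of_eq ?_) (this.trans (by nlinarith [sq_nonneg x]))
    congr 1
    ring
  · have h1 : ‖Complex.exp (-(x * Complex.I))‖ = 1 := by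
      rw [← neg_mul, ← Complex.ofReal_neg, Complex.norm_exp_ofReal_mul_I]
    have h2 : ‖(x * Complex.I : ℂ)‖ = |x| := by simp
    have h3 : ‖1 - Complex.exp (-(x * Complex.I)) - x * Complex.I‖ ≤ 1 + 1 + |x| := by
      refine (norm_sub_le _ _).trans ?_
      rw [h2]
      gcongr
      refine (norm_sub_le _ _).trans ?_
      rw [h1, norm_one]
    have h4 : x ^ 2 = |x| ^ 2 := (sq_abs x).symm
    rw [h4]
    nlinarith

lemma norm_one_sub_exp_neg_mul_I_le (x : ℝ) : ‖1 - Complex.exp (-(x * Complex.I))‖ ≤ |x| := by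
  have := Real.norm_exp_I_mul_ofReal_sub_one_le (x := -x)
  rw [← norm_neg, neg_sub]
  rw [Real.norm_eq_abs, abs_neg] at this
  refine le_trans (le_of_eq ?_) this
  congr 2
  push_cast
  ring_nf

/-- The contribution of the drift and of the local times to the increments of a bounded
exponential. -/
lemma tendsto_exponentialSum {l₁ l₂ : ℝ≥0 → ℝ} (hm₁ : Monotone l₁) (hc₁ : Continuous l₁)
    (hm₂ : Monotone l₂) (hc₂ : Continuous l₂) {e : ℝ≥0 → ℂ} (he : Continuous e)
    (hn : ∀ t, ‖e t‖ = 1) (c b₁ b₂ : ℝ) :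
    Tendsto (fun n : ℕ => ∑ k ∈ Finset.range (n + 1), (e (node n (k + 1)) *
      (1 - Complex.exp (-((c * (1 / (n + 1)) + b₁ * (l₁ (node n (k + 1)) - l₁ (node n k))
        + b₂ * (l₂ (node n (k + 1)) - l₂ (node n k)) : ℝ) * Complex.I)))
      - Complex.I * c * (1 / (n + 1)) * e (node n (k + 1)))) atTop
      (𝓝 (Complex.I * b₁ * (∫ t in Set.Iic 1, e t ∂pathMeasure l₁)
        + Complex.I * b₂ * (∫ t in Set.Iic 1, e t ∂pathMeasure l₂))) := by
  have h1 := (tendsto_stieltjesSum hm₁ hc₁ he).const_mul (Complex.I * b₁)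
  have h2 := (tendsto_stieltjesSum hm₂ hc₂ he).const_mul (Complex.I * b₂)
  have h12 := h1.add h2
  -- The increments of `m` dominate the exponents, so the second-order remainders are controlled by
  -- sums of squared increments of a continuous monotone path.
  set m : ℝ≥0 → ℝ := fun t => |c| * t + |b₁| * l₁ t + |b₂| * l₂ t with hmdef
  have hmm : Monotone m := by
    intro s t hst
    simp only [hmdef]
    have := hm₁ hst
    have := hm₂ hst
    gcongr
  have hmc : Continuous m := by fun_prop
  have hsq := (tendsto_sum_sq_increments hmm hmc).const_mul 3
  rw [mul_zero] at hsq
  refine tendsto_of_tendsto_of_dist h12 (squeeze_zero (fun _ => dist_nonneg) (fun n => ?_) hsq)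
  rw [dist_comm, dist_eq_norm, Finset.mul_sum, Finset.mul_sum, ← Finset.sum_add_distrib,
    ← Finset.sum_sub_distrib, Finset.mul_sum]
  refine (norm_sum_le _ _).trans (Finset.sum_le_sum fun k _ => ?_)
  set x : ℝ := c * (1 / (n + 1)) + b₁ * (l₁ (node n (k + 1)) - l₁ (node n k))
        + b₂ * (l₂ (node n (k + 1)) - l₂ (node n k)) with hx
  have hxm : |x| ≤ m (node n (k + 1)) - m (node n k) := by
    have e1 : m (node n (k + 1)) - m (node n k) = |c| * (1 / (n + 1))
        + |b₁| * (l₁ (node n (k + 1)) - l₁ (node n k))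
        + |b₂| * (l₂ (node n (k + 1)) - l₂ (node n k)) := by
      rw [← node_succ_sub n k]; simp only [hmdef]; ring
    have d1 : 0 ≤ l₁ (node n (k + 1)) - l₁ (node n k) :=
      sub_nonneg.2 (hm₁ (node_mono n (Nat.le_succ k)))
    have d2 : 0 ≤ l₂ (node n (k + 1)) - l₂ (node n k) :=
      sub_nonneg.2 (hm₂ (node_mono n (Nat.le_succ k)))
    rw [e1, hx]
    refine (abs_add_three _ _ _).trans (le_of_eq ?_)
    rw [abs_mul, abs_mul, abs_mul, abs_of_nonneg d1, abs_of_nonneg d2,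
      abs_of_nonneg (by positivity : (0 : ℝ) ≤ 1 / (n + 1))]
  have hsqle : x ^ 2 ≤ (m (node n (k + 1)) - m (node n k)) ^ 2 := by
    rw [← sq_abs x]
    exact pow_le_pow_left₀ (abs_nonneg _) hxm 2
  have e2 : e (node n (k + 1)) * (1 - Complex.exp (-(x * Complex.I)))
      - Complex.I * c * (1 / (n + 1)) * e (node n (k + 1))
      - (Complex.I * b₁ * ((l₁ (node n (k + 1)) - l₁ (node n k)) • e (node n (k + 1)))
        + Complex.I * b₂ * ((l₂ (node n (k + 1)) - l₂ (node n k)) • e (node n (k + 1))))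
      = e (node n (k + 1)) * (1 - Complex.exp (-(x * Complex.I)) - x * Complex.I) := by
    rw [hx]
    simp only [Complex.real_smul]
    push_cast
    ring
  rw [e2, norm_mul, hn, one_mul]
  exact (norm_one_sub_exp_neg_mul_I_sub_le x).trans (by linarith)

/-! ### Measure theory -/

/-- The truncation of a real number to `[-n, n]`. -/
noncomputable def clampTo (n : ℕ) (x : ℝ) : ℝ := max (-n) (min x n)

lemma abs_clampTo_le (n : ℕ) (x : ℝ) : |clampTo n x| ≤ n := by
  have : (0 : ℝ) ≤ n := n.cast_nonneg
  rw [clampTo, abs_le]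
  exact ⟨le_max_left _ _, max_le (by linarith) (min_le_right _ _)⟩

lemma measurable_clampTo (n : ℕ) : Measurable (clampTo n) := by unfold clampTo; fun_prop

lemma abs_clampTo_sub_le (n : ℕ) (x y : ℝ) : |clampTo n x - clampTo n y| ≤ |x - y| := by
  unfold clampTo
  refine (abs_max_sub_max_le_max _ _ _ _).trans (max_le (by simp) ?_)
  exact (abs_min_sub_min_le_max _ _ _ _).trans (max_le le_rfl (by simp))

lemma clampTo_mono (n : ℕ) : Monotone (clampTo n) := by
  intro x y h
  unfold clampTo
  gcongr

lemma clampTo_eq {n : ℕ} {x : ℝ} (h : |x| ≤ n) : clampTo n x = x := by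
  rw [abs_le] at h
  rw [clampTo, min_eq_left h.2, max_eq_right h.1]

lemma tendsto_clampTo (x : ℝ) : Tendsto (fun n => clampTo n x) atTop (𝓝 x) := by
  refine tendsto_const_nhds.congr' ?_
  filter_upwards [eventually_ge_atTop ⌈|x|⌉₊] with n hn
  exact (clampTo_eq (Nat.ceil_le.1 hn)).symm

/-- If `X` and `Y` have the same law and the negative part of `Y - X` is integrable, then `Y - X`
is integrable and centered. -/
lemma integrable_sub_of_map_eq {Ω : Type*} {mΩ : MeasurableSpace Ω} {P : Measure Ω}
    [IsProbabilityMeasure P] {X Y g : Ω → ℝ} (hX : Measurable X) (hY : Measurable Y)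
    (h : P.map X = P.map Y) (hg : Integrable g P) (hle : ∀ᵐ ω ∂P, -g ω ≤ Y ω - X ω) :
    Integrable (fun ω => Y ω - X ω) P ∧ ∫ ω, Y ω - X ω ∂P = 0 := by
  set d : ℕ → Ω → ℝ := fun n ω => clampTo n (Y ω) - clampTo n (X ω) with hd
  have hint : ∀ n, ∀ {V : Ω → ℝ}, Measurable V → Integrable (fun ω => clampTo n (V ω)) P :=
    fun n V hV => Integrable.of_bound ((measurable_clampTo n).comp hV).aestronglyMeasurable n
      (Eventually.of_forall fun ω => by simpa using abs_clampTo_le n (V ω))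
  have hdint : ∀ n, Integrable (d n) P := fun n => (hint n hY).sub (hint n hX)
  have hd0 : ∀ n, ∫ ω, d n ω ∂P = 0 := by
    intro n
    rw [hd, integral_sub (hint n hY) (hint n hX)]
    have e : ∀ {V : Ω → ℝ}, Measurable V →
        ∫ ω, clampTo n (V ω) ∂P = ∫ x, clampTo n x ∂(P.map V) := fun hV =>
      (integral_map hV.aemeasurable (measurable_clampTo n).aestronglyMeasurable).symm
    rw [e hY, e hX, h, sub_self]
  have hlim : ∀ ω, Tendsto (fun n => d n ω) atTop (𝓝 (Y ω - X ω)) := fun ω =>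
    (tendsto_clampTo _).sub (tendsto_clampTo _)
  -- The truncated differences have mean zero, so the mean of |d| is that of |d| - d, twice the
  -- negative part, which `g` controls uniformly in n. Fatou then gives integrability, and dominated
  -- convergence the mean.
  have hbound : ∀ n, ∫ ω, |d n ω| ∂P ≤ ∫ ω, 2 * |g ω| ∂P := by
    intro n
    have h1 : ∫ ω, |d n ω| ∂P = ∫ ω, |d n ω| - d n ω ∂P := by
      rw [integral_sub (hdint n).abs (hdint n), hd0, sub_zero]
    rw [h1]
    refine integral_mono_ae ((hdint n).abs.sub (hdint n)) (hg.abs.const_mul 2) ?_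
    filter_upwards [hle] with ω hω
    change |d n ω| - d n ω ≤ 2 * |g ω|
    rcases le_or_gt (X ω) (Y ω) with hxy | hxy
    · have : 0 ≤ d n ω := sub_nonneg.2 (clampTo_mono n hxy)
      rw [abs_of_nonneg this, sub_self]
      positivity
    · have h2 : d n ω ≤ 0 := sub_nonpos.2 (clampTo_mono n hxy.le)
      have h3 := abs_clampTo_sub_le n (Y ω) (X ω)
      rw [abs_of_neg (sub_neg.2 hxy)] at h3
      have h4 : |d n ω| = -d n ω := abs_of_nonpos h2
      have h5 : |d n ω| ≤ -(Y ω - X ω) := h3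
      have h6 := le_abs_self (g ω)
      linarith
  have hYX : Integrable (fun ω => Y ω - X ω) P := by
    refine ⟨(hY.sub hX).aestronglyMeasurable, ?_⟩
    have h1 : ∫⁻ ω, ‖Y ω - X ω‖ₑ ∂P ≤ liminf (fun n => ∫⁻ ω, ‖d n ω‖ₑ ∂P) atTop :=
      lintegral_congr (fun ω => (hlim ω).enorm.liminf_eq) ▸
        (lintegral_liminf_le' fun n => (hdint n).aestronglyMeasurable.enorm)
    refine lt_of_le_of_lt h1 (lt_of_le_of_lt (b := ENNReal.ofReal (∫ ω, 2 * |g ω| ∂P)) ?_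
      ENNReal.ofReal_lt_top)
    refine liminf_le_of_le (by isBoundedDefault) fun b hb => ?_
    obtain ⟨n, hn⟩ := hb.exists
    refine hn.trans ?_
    rw [← ofReal_integral_norm_eq_lintegral_enorm (hdint n)]
    exact ENNReal.ofReal_le_ofReal (hbound n)
  refine ⟨hYX, ?_⟩
  have := tendsto_integral_of_dominated_convergence (μ := P) (F := d) (fun ω => |Y ω - X ω|)
    (fun n => (hdint n).aestronglyMeasurable) hYX.abs
    (fun n => Eventually.of_forall fun ω => abs_clampTo_sub_le n _ _)
    (Eventually.of_forall hlim)
  simp only [hd0] at this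
  exact tendsto_nhds_unique this tendsto_const_nhds

section Bind

variable {Ω β : Type*} {mΩ : MeasurableSpace Ω} {mβ : MeasurableSpace β} {P : Measure Ω}
  {κ : Ω → Measure β}

lemma integral_bind_of_nonneg (hκ : AEMeasurable κ P) [IsFiniteMeasure (P.bind κ)]
    (hfin : ∀ᵐ ω ∂P, IsFiniteMeasure (κ ω)) {g : β → ℝ} (hg : Measurable g) {C : ℝ}
    (hC : ∀ x, |g x| ≤ C) (h0 : ∀ x, 0 ≤ g x) :
    Integrable (fun ω => ∫ x, g x ∂κ ω) P ∧
      ∫ x, g x ∂(P.bind κ) = ∫ ω, ∫ x, g x ∂κ ω ∂P := by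
  have hgm : Measurable fun x => ENNReal.ofReal (g x) := hg.ennreal_ofReal
  have e1 : ∀ ω, ∫ x, g x ∂κ ω = (∫⁻ x, ENNReal.ofReal (g x) ∂κ ω).toReal := fun ω =>
    integral_eq_lintegral_of_nonneg_ae (Eventually.of_forall h0) hg.aestronglyMeasurable
  have hae : AEMeasurable (fun ω => ∫⁻ x, ENNReal.ofReal (g x) ∂κ ω) P :=
    (Measure.measurable_lintegral hgm).comp_aemeasurable hκ
  have hb := Measure.lintegral_bind hκ (f := fun x => ENNReal.ofReal (g x)) hgm.aemeasurable
  have hint : Integrable g (P.bind κ) :=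
    Integrable.of_bound hg.aestronglyMeasurable C (Eventually.of_forall hC)
  have hne : ∫⁻ x, ENNReal.ofReal (g x) ∂(P.bind κ) ≠ ⊤ := by
    have := hint.2
    rw [hasFiniteIntegral_iff_ofReal (Eventually.of_forall h0)] at this
    exact this.ne
  have hlt : ∀ᵐ ω ∂P, ∫⁻ x, ENNReal.ofReal (g x) ∂κ ω < ⊤ := by
    filter_upwards [hfin] with ω hω
    have : Integrable g (κ ω) :=
      Integrable.of_bound hg.aestronglyMeasurable C (Eventually.of_forall hC)
    have := this.2
    rwa [hasFiniteIntegral_iff_ofReal (Eventually.of_forall h0)] at this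
  simp only [e1]
  refine ⟨integrable_toReal_of_lintegral_ne_top hae (by rwa [← hb]), ?_⟩
  rw [integral_toReal hae hlt, ← hb]
  exact integral_eq_lintegral_of_nonneg_ae (Eventually.of_forall h0) hg.aestronglyMeasurable

lemma integral_bind_of_bounded (hκ : AEMeasurable κ P) [IsFiniteMeasure (P.bind κ)]
    (hfin : ∀ᵐ ω ∂P, IsFiniteMeasure (κ ω)) {g : β → ℝ} (hg : Measurable g) {C : ℝ}
    (hC : ∀ x, |g x| ≤ C) :
    Integrable (fun ω => ∫ x, g x ∂κ ω) P ∧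
      ∫ x, g x ∂(P.bind κ) = ∫ ω, ∫ x, g x ∂κ ω ∂P := by
  have b : ∀ x, |max (g x) 0| ≤ C := fun x => by
    rw [abs_of_nonneg (le_max_right _ _)]
    exact max_le ((le_abs_self _).trans (hC x)) ((abs_nonneg _).trans (hC x))
  have b' : ∀ x, |max (-g x) 0| ≤ C := fun x => by
    rw [abs_of_nonneg (le_max_right _ _)]
    exact max_le ((neg_le_abs _).trans (hC x)) ((abs_nonneg _).trans (hC x))
  have m1 : Measurable fun x => max (g x) 0 := hg.max measurable_const
  have m2 : Measurable fun x => max (-g x) 0 := hg.neg.max measurable_const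
  obtain ⟨i1, e1⟩ := integral_bind_of_nonneg hκ hfin m1 b fun x => le_max_right _ _
  obtain ⟨i2, e2⟩ := integral_bind_of_nonneg hκ hfin m2 b' fun x => le_max_right _ _
  have hsplit : ∀ x, g x = max (g x) 0 - max (-g x) 0 := fun x => by
    rcases le_total (g x) 0 with h | h
    · rw [max_eq_right h, max_eq_left (by linarith)]; ring
    · rw [max_eq_left h, max_eq_right (by linarith)]; ring
  have hs : ∀ (m : Measure β) [IsFiniteMeasure m],
      ∫ x, g x ∂m = ∫ x, max (g x) 0 ∂m - ∫ x, max (-g x) 0 ∂m := by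
    intro m _
    rw [← integral_sub (Integrable.of_bound m1.aestronglyMeasurable C (Eventually.of_forall b))
      (Integrable.of_bound m2.aestronglyMeasurable C (Eventually.of_forall b'))]
    exact integral_congr_ae (Eventually.of_forall hsplit)
  have hcongr : (fun ω => ∫ x, g x ∂κ ω)
      =ᵐ[P] fun ω => ∫ x, max (g x) 0 ∂κ ω - ∫ x, max (-g x) 0 ∂κ ω := by
    filter_upwards [hfin] with ω hω
    exact hs (κ ω)
  refine ⟨(i1.sub i2).congr hcongr.symm, ?_⟩
  rw [integral_congr_ae hcongr, integral_sub i1 i2, ← e1, ← e2, hs]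

lemma integral_bind_complex (hκ : AEMeasurable κ P) [IsFiniteMeasure (P.bind κ)]
    (hfin : ∀ᵐ ω ∂P, IsFiniteMeasure (κ ω)) {g : β → ℂ} (hg : Measurable g) {C : ℝ}
    (hC : ∀ x, ‖g x‖ ≤ C) :
    Integrable (fun ω => ∫ x, g x ∂κ ω) P ∧
      ∫ x, g x ∂(P.bind κ) = ∫ ω, ∫ x, g x ∂κ ω ∂P := by
  obtain ⟨i1, e1⟩ := integral_bind_of_bounded hκ hfin (Complex.measurable_re.comp hg)
    (C := C) fun x => (Complex.abs_re_le_norm _).trans (hC x)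
  obtain ⟨i2, e2⟩ := integral_bind_of_bounded hκ hfin (Complex.measurable_im.comp hg)
    (C := C) fun x => (Complex.abs_im_le_norm _).trans (hC x)
  have hs : ∀ (m : Measure β) [IsFiniteMeasure m], ∫ x, g x ∂m
      = ((∫ x, (g x).re ∂m : ℝ) : ℂ) + ((∫ x, (g x).im ∂m : ℝ) : ℂ) * Complex.I := by
    intro m _
    have hi : Integrable g m :=
      Integrable.of_bound hg.aestronglyMeasurable C (Eventually.of_forall hC)
    exact (integral_re_add_im hi).symm
  have hcongr : (fun ω => ∫ x, g x ∂κ ω) =ᵐ[P] fun ω =>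
      ((∫ x, (g x).re ∂κ ω : ℝ) : ℂ) + ((∫ x, (g x).im ∂κ ω : ℝ) : ℂ) * Complex.I := by
    filter_upwards [hfin] with ω hω
    exact hs (κ ω)
  have j1 := i1.ofReal (𝕜 := ℂ)
  have j2 := (i2.ofReal (𝕜 := ℂ)).mul_const Complex.I
  refine ⟨(j1.add j2).congr hcongr.symm, ?_⟩
  rw [integral_congr_ae hcongr, hs]
  refine Eq.trans ?_ (integral_add j1 j2).symm
  rw [integral_mul_const]
  refine congrArg₂ (fun a b : ℂ => a + b * Complex.I) ?_ ?_
  · exact (congrArg Complex.ofReal e1).trans integral_ofReal.symm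
  · exact (congrArg Complex.ofReal e2).trans integral_ofReal.symm

/-- A random finite measure is measurable as soon as the integrals of continuous functions are
limits of measurable functions. -/
lemma aemeasurable_of_tendsto_integral {κ : Ω → Measure ℝ} {A : Set Ω} (hA : MeasurableSet A)
    (hPA : ∀ᵐ ω ∂P, ω ∈ A) (hfin : ∀ ω ∈ A, IsFiniteMeasure (κ ω))
    (h : ∀ f : ℝ → ℝ, Continuous f → ∃ S : ℕ → Ω → ℝ, (∀ n, Measurable (S n)) ∧
      ∀ ω ∈ A, Tendsto (fun n => S n ω) atTop (𝓝 (∫ x, f x ∂κ ω))) :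
    AEMeasurable κ P := by
  classical
  set κ' : Ω → Measure ℝ := fun ω => if ω ∈ A then κ ω else 0 with hκ'
  have hfin' : ∀ ω, IsFiniteMeasure (κ' ω) := by
    intro ω
    by_cases hω : ω ∈ A
    · simp only [hκ', if_pos hω]; exact hfin ω hω
    · simp only [hκ', if_neg hω]; infer_instance
  have hI : ∀ f : ℝ → ℝ, Continuous f → Measurable fun ω => ∫ x, f x ∂κ' ω := by
    intro f hf
    obtain ⟨S, hS, hlim⟩ := h f hf
    refine measurable_of_tendsto_metrizable (f := fun n => A.indicator (S n))
      (fun n => (hS n).indicator hA) (tendsto_pi_nhds.2 fun ω => ?_)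
    by_cases hω : ω ∈ A
    · simp only [hκ', if_pos hω, Set.indicator_of_mem hω]
      exact hlim ω hω
    · simp [hκ', if_neg hω, Set.indicator_of_notMem hω]
  -- Indicators of closed sets are limits of thickened indicators, which are continuous; closed sets
  -- form a π-system that generates the Borel sets.
  have hcl : ∀ F : Set ℝ, IsClosed F → Measurable fun ω => κ' ω F := by
    intro F hF
    have hlim : ∀ ω, Tendsto (fun n : ℕ => ∫ x, (thickenedIndicator
        (Nat.one_div_pos_of_nat (α := ℝ) (n := n)) F x : ℝ) ∂κ' ω) atTop (𝓝 ((κ' ω).real F)) := fun ω =>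
      tendsto_integral_thickenedIndicator_of_isClosed (κ' ω) hF
        (fun n => Nat.one_div_pos_of_nat (α := ℝ) (n := n)) tendsto_one_div_add_atTop_nhds_zero_nat
    have hm : Measurable fun ω => (κ' ω).real F := by
      refine measurable_of_tendsto_metrizable (fun n => hI _ ?_) (tendsto_pi_nhds.2 hlim)
      exact NNReal.continuous_coe.comp (thickenedIndicator _ F).continuous
    have e : (fun ω => κ' ω F) = fun ω => ENNReal.ofReal ((κ' ω).real F) := by
      funext ω
      rw [ofReal_measureReal]
    rw [e]
    exact hm.ennreal_ofReal
  refine ⟨κ', ?_, ?_⟩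
  · refine Measurable.measure_of_isPiSystem (S := {s | IsClosed s}) ?_ isPiSystem_isClosed hcl
      (hcl _ isClosed_univ)
    rw [← borel_eq_generateFrom_isClosed]
    exact BorelSpace.measurable_eq
  · filter_upwards [hPA] with ω hω
    simp only [hκ', if_pos hω]

end Bind

/-! ### Paths of the reflected Brownian motion -/

namespace RBMData

variable {D : RBMData}

/-- The properties of almost every path of a reflected Brownian motion. -/
structure GoodPath (D : RBMData) (z b l : ℝ≥0 → Fin 2 → ℝ) : Prop where
  decomp : ∀ t : ℝ≥0, z t = z 0 + b t + (t : ℝ) • D.mu + D.R *ᵥ l t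
  quadrant : ∀ t i, 0 ≤ z t i
  continuous_b : Continuous b
  local_start : l 0 = 0
  local_cont : ∀ i, Continuous fun t => l t i
  local_mono : ∀ i, Monotone fun t => l t i
  local_support : ∀ i, pathMeasure (fun t => l t i) {t | z t i ≠ 0} = 0

/-- The boundary measure of a path on the axis `{z i = 0}`, seen in the coordinate `j`. -/
noncomputable def pathBoundary (z l : ℝ≥0 → Fin 2 → ℝ) (i j : Fin 2) : Measure ℝ :=
  ((pathMeasure fun t => l t i).restrict {t | t ≤ 1 ∧ z t i = 0}).map fun t => z t j

/-- The boundary measure on the axis `{z i = 0}`, seen in the coordinate `j`. -/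
noncomputable def boundaryMeasure {Ω : Type*} {mΩ : MeasurableSpace Ω} (P : Measure Ω)
    (Z L : ℝ≥0 → Ω → Fin 2 → ℝ) (i j : Fin 2) : Measure ℝ :=
  P.bind fun ω => pathBoundary (fun t => Z t ω) (fun t => L t ω) i j

namespace GoodPath

variable {z b l : ℝ≥0 → Fin 2 → ℝ} (h : D.GoodPath z b l)
include h

lemma continuous_z : Continuous z := by
  have e : z = fun t : ℝ≥0 => z 0 + b t + (t : ℝ) • D.mu + D.R *ᵥ l t := funext h.decomp
  have hb := h.continuous_b
  have hl : Continuous l := continuous_pi h.local_cont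
  rw [e]
  have : Continuous fun t => D.R *ᵥ l t := by
    refine continuous_pi fun i => ?_
    simp only [Matrix.mulVec, dotProduct]
    fun_prop
  fun_prop

lemma isFiniteMeasure_restrict (i : Fin 2) :
    IsFiniteMeasure ((pathMeasure fun t => l t i).restrict (Set.Iic 1)) := ⟨by
  rw [Measure.restrict_apply_univ, pathMeasure_Iic_one (h.local_mono i) (h.local_cont i)]
  exact ENNReal.ofReal_lt_top⟩

/-- The local time increases only while the path is on the axis, so restricting to those times
changes nothing. -/
lemma pathBoundary_eq (i j : Fin 2) : pathBoundary z l i j =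
    ((pathMeasure fun t => l t i).restrict (Set.Iic 1)).map fun t => z t j := by
  rw [pathBoundary, Measure.restrict_congr_set]
  have : ∀ᵐ t ∂(pathMeasure fun t => l t i), z t i = 0 := h.local_support i
  filter_upwards [this] with t ht
  exact propext ⟨fun hh => hh.1, fun hh => ⟨hh, ht⟩⟩

lemma isFiniteMeasure_pathBoundary (i j : Fin 2) : IsFiniteMeasure (pathBoundary z l i j) := by
  rw [h.pathBoundary_eq]
  have := h.isFiniteMeasure_restrict i
  infer_instance

lemma integral_pathBoundary {F : Type*} [NormedAddCommGroup F] [NormedSpace ℝ F] (i j : Fin 2)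
    {f : ℝ → F} (hf : StronglyMeasurable f) : ∫ x, f x ∂(pathBoundary z l i j) =
      ∫ t in Set.Iic 1, f (z t j) ∂(pathMeasure fun t => l t i) := by
  rw [h.pathBoundary_eq, integral_map]
  · exact ((continuous_apply j).comp h.continuous_z).measurable.aemeasurable
  · exact hf.aestronglyMeasurable

lemma pathBoundary_univ (i j : Fin 2) :
    pathBoundary z l i j Set.univ = ENNReal.ofReal (l 1 i) := by
  have hz : Measurable fun t => z t j := ((continuous_apply j).comp h.continuous_z).measurable
  rw [h.pathBoundary_eq, Measure.map_apply hz MeasurableSet.univ, Set.preimage_univ,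
    Measure.restrict_apply_univ, pathMeasure_Iic_one (h.local_mono i) (h.local_cont i),
    h.local_start]
  simp

lemma pathBoundary_Iio (i j : Fin 2) : pathBoundary z l i j (Set.Iio 0) = 0 := by
  have hz : Measurable fun t => z t j := ((continuous_apply j).comp h.continuous_z).measurable
  rw [h.pathBoundary_eq, Measure.map_apply hz measurableSet_Iio]
  have : (fun t => z t j) ⁻¹' Set.Iio 0 = ∅ := by
    ext t
    simpa using h.quadrant t j
  rw [this, measure_empty]

lemma tendsto_pathBoundary (i j : Fin 2) {f : ℝ → ℝ} (hf : Continuous f) :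
    Tendsto (fun n : ℕ => ∑ k ∈ Finset.range (n + 1),
      (l (node n (k + 1)) i - l (node n k) i) * f (z (node n (k + 1)) j)) atTop
      (𝓝 (∫ x, f x ∂(pathBoundary z l i j))) := by
  rw [h.integral_pathBoundary i j hf.stronglyMeasurable]
  exact tendsto_stieltjesSum (h.local_mono i) (h.local_cont i)
    (hf.comp ((continuous_apply j).comp h.continuous_z))

lemma setIntegral_eq (i j : Fin 2) {g : (Fin 2 → ℝ) → ℂ} {f : ℝ → ℂ}
    (hf : StronglyMeasurable f) (hg : ∀ x, x i = 0 → g x = f (x j)) :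
    ∫ t in Set.Iic 1, g (z t) ∂(pathMeasure fun t => l t i) = ∫ x, f x ∂(pathBoundary z l i j) := by
  rw [h.integral_pathBoundary i j hf]
  have : ∀ᵐ t ∂(pathMeasure fun t => l t i), z t i = 0 := h.local_support i
  refine integral_congr_ae (ae_restrict_of_ae ?_)
  filter_upwards [this] with t ht
  exact hg _ ht

lemma local_nonneg (t : ℝ≥0) (i : Fin 2) : 0 ≤ l t i := by
  have := h.local_mono i (zero_le (a := t))
  simpa [h.local_start] using this

lemma sub_eq (v : Fin 2 → ℝ) (s t : ℝ≥0) : v ⬝ᵥ z t - v ⬝ᵥ z s = v ⬝ᵥ (b t - b s)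
    + ((t : ℝ) - s) * (v ⬝ᵥ D.mu) + (v ⬝ᵥ fun i => D.R i 0) * (l t 0 - l s 0)
    + (v ⬝ᵥ fun i => D.R i 1) * (l t 1 - l s 1) := by
  rw [h.decomp t, h.decomp s]
  simp only [dotProduct, Fin.sum_univ_two, Matrix.mulVec, Pi.add_apply, Pi.sub_apply, Pi.smul_apply,
    smul_eq_mul]
  ring

end GoodPath

namespace IsRBM

variable {Ω : Type*} {mΩ : MeasurableSpace Ω} {P : Measure Ω}
  {ℱ : Filtration ℝ≥0 mΩ} {Z B L : ℝ≥0 → Ω → Fin 2 → ℝ} (hZ : D.IsRBM ℱ P Z B L)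
include hZ

lemma goodPath : ∀ᵐ ω ∂P, D.GoodPath (fun t => Z t ω) (fun t => B t ω) (fun t => L t ω) := by
  filter_upwards [hZ.decomp, hZ.quadrant, hZ.bm.continuous_paths, hZ.local_start,
    hZ.local_cont, hZ.local_mono, hZ.local_support] with ω h1 h2 h3 h4 h5 h6 h7
  exact ⟨h1, h2, h3, h4, h5, h6, h7⟩

lemma measurable_Z (t : ℝ≥0) : Measurable (Z t) := (hZ.adapted t).mono (ℱ.le t) le_rfl

lemma measurable_L (t : ℝ≥0) : Measurable (L t) := (hZ.adapted_local t).mono (ℱ.le t) le_rfl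

lemma measurable_B (t : ℝ≥0) : Measurable (B t) := (hZ.bm.adapted t).mono (ℱ.le t) le_rfl

/-- Integrals of continuous functions are limits of Riemann–Stieltjes sums in finitely many values
of Z and L, which are measurable. Without this measurability the integrals against `P.bind` could
not be computed. -/
lemma aemeasurable_pathBoundary (i j : Fin 2) :
    AEMeasurable (fun ω => pathBoundary (fun t => Z t ω) (fun t => L t ω) i j) P := by
  obtain ⟨A, hPA, hA, hgood⟩ := hZ.goodPath.exists_measurable_mem
  refine aemeasurable_of_tendsto_integral hA hPA
    (fun ω hω => (hgood ω hω).isFiniteMeasure_pathBoundary i j) fun f hf => ?_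
  refine ⟨fun n ω => ∑ k ∈ Finset.range (n + 1),
      (L (node n (k + 1)) ω i - L (node n k) ω i) * f (Z (node n (k + 1)) ω j), fun n => ?_,
    fun ω hω => (hgood ω hω).tendsto_pathBoundary i j hf⟩
  refine Finset.measurable_fun_sum _ fun k _ => ?_
  refine Measurable.mul (Measurable.sub ?_ ?_) (hf.measurable.comp ?_)
  · exact (measurable_pi_apply i).comp (hZ.measurable_L _)
  · exact (measurable_pi_apply i).comp (hZ.measurable_L _)
  · exact (measurable_pi_apply j).comp (hZ.measurable_Z _)

lemma integrable_increment [IsProbabilityMeasure P] (v : Fin 2 → ℝ) :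
    Integrable (fun ω => v ⬝ᵥ (B 1 ω - B 0 ω)) P ∧ ∫ ω, v ⬝ᵥ (B 1 ω - B 0 ω) ∂P = 0 := by
  have hm : Measurable fun ω => v ⬝ᵥ (B 1 ω - B 0 ω) := by
    have h1 := hZ.measurable_B 1
    have h0 := hZ.measurable_B 0
    simp only [dotProduct, Pi.sub_apply]
    fun_prop
  have hlaw := hZ.bm.law 0 1 zero_le_one v
  have hi : Integrable (fun x : ℝ => x) (P.map fun ω => v ⬝ᵥ (B 1 ω - B 0 ω)) := by
    rw [hlaw]
    exact (memLp_id_gaussianReal 1).integrable le_rfl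
  refine ⟨hi.comp_measurable hm, ?_⟩
  have := integral_map (μ := P) hm.aemeasurable (f := fun x : ℝ => x) (by fun_prop)
  rw [← this, hlaw, integral_id_gaussianReal]

/-- The mean of the local times at time one. -/
lemma integrable_dot [IsProbabilityMeasure P] {π : Measure (Fin 2 → ℝ)}
    (hstat : ∀ t, P.map (Z t) = π) (v : Fin 2 → ℝ)
    (h0 : 0 ≤ v ⬝ᵥ fun i => D.R i 0) (h1 : 0 ≤ v ⬝ᵥ fun i => D.R i 1) :
    Integrable (fun ω => (v ⬝ᵥ fun i => D.R i 0) * L 1 ω 0 + (v ⬝ᵥ fun i => D.R i 1) * L 1 ω 1) P ∧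
    ∫ ω, (v ⬝ᵥ fun i => D.R i 0) * L 1 ω 0 + (v ⬝ᵥ fun i => D.R i 1) * L 1 ω 1 ∂P
      = -(v ⬝ᵥ D.mu) := by
  obtain ⟨iB, eB⟩ := hZ.integrable_increment v
  have hv : Measurable fun x : Fin 2 → ℝ => v ⬝ᵥ x := by
    simp only [dotProduct]
    fun_prop
  have hm : ∀ t, Measurable fun ω => v ⬝ᵥ Z t ω := fun t => hv.comp (hZ.measurable_Z t)
  have hmap : ∀ t, P.map (fun ω => v ⬝ᵥ Z t ω) = π.map fun x => v ⬝ᵥ x := fun t => by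
    rw [← hstat t, Measure.map_map hv (hZ.measurable_Z t)]
    rfl
  -- No moment of Z or L is assumed. By stationarity v · Z has the same law at times 0 and 1, and
  -- its increment is bounded below by an integrable variable because the local times enter with
  -- non-negative coefficients.
  obtain ⟨iZ, eZ⟩ := integrable_sub_of_map_eq (hm 0) (hm 1) ((hmap 0).trans (hmap 1).symm)
    (iB.abs.add (integrable_const |v ⬝ᵥ D.mu|)) (by
      filter_upwards [hZ.goodPath] with ω hω
      rw [hω.sub_eq v 0 1, hω.local_start]
      have a1 := neg_abs_le (v ⬝ᵥ (B 1 ω - B 0 ω))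
      have a2 := neg_abs_le (v ⬝ᵥ D.mu)
      have a3 := mul_nonneg h0 (hω.local_nonneg 1 0)
      have a4 := mul_nonneg h1 (hω.local_nonneg 1 1)
      simp only [Pi.add_apply, NNReal.coe_one, NNReal.coe_zero, sub_zero, one_mul, Pi.zero_apply]
      linarith)
  have hae : (fun ω => v ⬝ᵥ Z 1 ω - v ⬝ᵥ Z 0 ω - v ⬝ᵥ (B 1 ω - B 0 ω) - v ⬝ᵥ D.mu) =ᵐ[P]
      fun ω => (v ⬝ᵥ fun i => D.R i 0) * L 1 ω 0 + (v ⬝ᵥ fun i => D.R i 1) * L 1 ω 1 := by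
    filter_upwards [hZ.goodPath] with ω hω
    rw [hω.sub_eq v 0 1, hω.local_start]
    simp only [NNReal.coe_one, NNReal.coe_zero, Pi.zero_apply]
    ring
  refine ⟨((iZ.sub iB).sub (integrable_const _)).congr hae, ?_⟩
  rw [← integral_congr_ae hae, integral_sub, integral_sub iZ iB, eZ, eB]
  · simp
  · exact iZ.sub iB
  · exact integrable_const _

/-- The rows (r₂₂, -r₁₂) and (-r₂₁, r₁₁) of the adjugate of R annihilate one column of R and pair
with the other to det R. Their products with the drift are negative by stability, which makes the
mean local times finite and positive. -/
lemma integrable_local [IsProbabilityMeasure P] (hR : D.Stable) {π : Measure (Fin 2 → ℝ)}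
    (hstat : ∀ t, P.map (Z t) = π) (i : Fin 2) :
    Integrable (fun ω => L 1 ω i) P ∧ 0 < ∫ ω, L 1 ω i ∂P := by
  have hd := hR.det_pos
  set d := D.R 0 0 * D.R 1 1 - D.R 0 1 * D.R 1 0 with hdd
  have key : ∀ v : Fin 2 → ℝ, (v ⬝ᵥ D.mu < 0) →
      ∀ i, (∀ ω, (v ⬝ᵥ fun i => D.R i 0) * L 1 ω 0 + (v ⬝ᵥ fun i => D.R i 1) * L 1 ω 1
        = d * L 1 ω i) → 0 ≤ (v ⬝ᵥ fun i => D.R i 0) → 0 ≤ (v ⬝ᵥ fun i => D.R i 1) →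
      Integrable (fun ω => L 1 ω i) P ∧ 0 < ∫ ω, L 1 ω i ∂P := by
    intro v hv i he h0 h1
    obtain ⟨a, b⟩ := hZ.integrable_dot hstat v h0 h1
    simp only [he] at a b
    rw [integral_const_mul] at b
    refine ⟨(integrable_const_mul_iff (IsUnit.mk0 _ hd.ne') _).1 a, ?_⟩
    refine pos_of_mul_pos_right (a := d) ?_ hd.le
    rw [b]
    linarith
  have h1 := hR.drift1
  have h2 := hR.drift2
  fin_cases i
  · refine key ![D.R 1 1, -D.R 0 1] ?_ 0 (fun ω => ?_) ?_ ?_ <;>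
      simp only [dotProduct, Fin.sum_univ_two, Matrix.cons_val_zero, Matrix.cons_val_one]
    · linarith
    · ring
    · linarith
    · linarith
  · refine key ![-D.R 1 0, D.R 0 0] ?_ 1 (fun ω => ?_) ?_ ?_ <;>
      simp only [dotProduct, Fin.sum_univ_two, Matrix.cons_val_zero, Matrix.cons_val_one]
    · linarith
    · ring
    · linarith
    · linarith

lemma boundaryMeasure_univ [IsProbabilityMeasure P] (hR : D.Stable) {π : Measure (Fin 2 → ℝ)}
    (hstat : ∀ t, P.map (Z t) = π) (i j : Fin 2) :
    boundaryMeasure P Z L i j Set.univ = ENNReal.ofReal (∫ ω, L 1 ω i ∂P) := by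
  rw [boundaryMeasure, Measure.bind_apply MeasurableSet.univ (hZ.aemeasurable_pathBoundary i j),
    ofReal_integral_eq_lintegral_ofReal (hZ.integrable_local hR hstat i).1]
  · refine lintegral_congr_ae ?_
    filter_upwards [hZ.goodPath] with ω hω
    exact hω.pathBoundary_univ i j
  · filter_upwards [hZ.goodPath] with ω hω
    exact hω.local_nonneg 1 i

lemma isFiniteMeasure_boundaryMeasure [IsProbabilityMeasure P] (hR : D.Stable)
    {π : Measure (Fin 2 → ℝ)} (hstat : ∀ t, P.map (Z t) = π) (i j : Fin 2) :
    IsFiniteMeasure (boundaryMeasure P Z L i j) := ⟨by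
  rw [hZ.boundaryMeasure_univ hR hstat]
  exact ENNReal.ofReal_lt_top⟩

lemma boundaryMeasure_ne_zero [IsProbabilityMeasure P] (hR : D.Stable)
    {π : Measure (Fin 2 → ℝ)} (hstat : ∀ t, P.map (Z t) = π) (i j : Fin 2) :
    boundaryMeasure P Z L i j ≠ 0 := by
  rw [← Measure.measure_univ_ne_zero, hZ.boundaryMeasure_univ hR hstat]
  exact (ENNReal.ofReal_pos.2 (hZ.integrable_local hR hstat i).2).ne'

lemma boundaryMeasure_nonneg (i j : Fin 2) : ∀ᵐ x ∂(boundaryMeasure P Z L i j), 0 ≤ x := by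
  rw [ae_iff]
  have : {x : ℝ | ¬ 0 ≤ x} = Set.Iio 0 := by ext x; simp
  rw [this, boundaryMeasure, Measure.bind_apply measurableSet_Iio
    (hZ.aemeasurable_pathBoundary i j), lintegral_eq_zero_iff']
  · filter_upwards [hZ.goodPath] with ω hω
    exact hω.pathBoundary_Iio i j
  · exact (Measure.measurable_coe measurableSet_Iio).comp_aemeasurable
      (hZ.aemeasurable_pathBoundary i j)

end IsRBM

end RBMData

/-! ### The functional equation for imaginary arguments -/

namespace RBMData

variable {D : RBMData}

/-- The character `x ↦ exp (i b · x)`. -/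
noncomputable def character (b x : Fin 2 → ℝ) : ℂ := Complex.exp ((b ⬝ᵥ x : ℝ) * Complex.I)

lemma norm_character (b x : Fin 2 → ℝ) : ‖character b x‖ = 1 :=
  Complex.norm_exp_ofReal_mul_I _

lemma continuous_character (b : Fin 2 → ℝ) : Continuous (character b) := by
  unfold character
  simp only [dotProduct]
  fun_prop

lemma character_add (b x y : Fin 2 → ℝ) :
    character b (x + y) = character b x * character b y := by
  simp only [character, dotProduct_add, Complex.ofReal_add, add_mul, Complex.exp_add]

lemma integrable_character_comp {Ω : Type*} {mΩ : MeasurableSpace Ω} {P : Measure Ω}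
    [IsFiniteMeasure P] (v : Fin 2 → ℝ) {X : Ω → Fin 2 → ℝ} (hX : Measurable X) :
    Integrable (fun ω => character v (X ω)) P :=
  Integrable.of_bound ((continuous_character v).measurable.comp hX).aestronglyMeasurable 1
    (Eventually.of_forall fun _ => (norm_character _ _).le)

lemma tendsto_mul_one_sub_exp (c : ℝ) : Tendsto (fun n : ℕ => ((n : ℂ) + 1) *
    (1 - Complex.exp (-((1 / ((n : ℝ) + 1) * c : ℝ) : ℂ)))) atTop (𝓝 c) := by
  have hd : HasDerivAt (fun t : ℂ => Complex.exp (-(t * c))) (-c) 0 := by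
    have := (((hasDerivAt_id (0 : ℂ)).mul_const (c : ℂ)).neg).cexp
    simpa using this
  have h1 := hasDerivAt_iff_tendsto_slope_zero.1 hd
  have h2 : Tendsto (fun n : ℕ => ((1 / ((n : ℝ) + 1) : ℝ) : ℂ)) atTop (𝓝[≠] 0) := by
    refine tendsto_nhdsWithin_iff.2 ⟨?_, Eventually.of_forall fun n => ?_⟩
    · have := (Complex.continuous_ofReal.tendsto 0).comp
        (tendsto_one_div_add_atTop_nhds_zero_nat (𝕜 := ℝ))
      rw [Complex.ofReal_zero] at this
      exact this
    · simp only [Set.mem_compl_iff, Set.mem_singleton_iff, Complex.ofReal_eq_zero]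
      positivity
  have h3 := (h1.comp h2).neg
  rw [neg_neg] at h3
  refine h3.congr fun n => ?_
  simp only [Function.comp, zero_add, zero_mul, neg_zero, Complex.exp_zero, smul_eq_mul]
  push_cast
  rw [one_div, inv_inv]
  ring

namespace GoodPath

variable {z b l : ℝ≥0 → Fin 2 → ℝ} (h : D.GoodPath z b l)
include h

/-- Only the Brownian increment stays attached to the left endpoint, where it is independent of the
past. The rest, at the right endpoint, involves finite-variation increments alone, so no stochastic
integral is needed. -/
lemma character_step (v : Fin 2 → ℝ) (n k : ℕ) :
    character v (z (node n (k + 1))) * (1 - Complex.exp (-(((v ⬝ᵥ D.mu) * (1 / (n + 1))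
      + (v ⬝ᵥ fun i => D.R i 0) * (l (node n (k + 1)) 0 - l (node n k) 0)
      + (v ⬝ᵥ fun i => D.R i 1) * (l (node n (k + 1)) 1 - l (node n k) 1) : ℝ) * Complex.I)))
    = character v (z (node n (k + 1)))
      - character v (z (node n k)) * character v (b (node n (k + 1)) - b (node n k)) := by
  have e := h.sub_eq v (node n k) (node n (k + 1))
  rw [node_succ_sub] at e
  rw [mul_sub, mul_one]
  congr 1
  simp only [character]
  rw [← Complex.exp_add, ← Complex.exp_add]
  congr 1
  rw [← add_mul, ← neg_mul, ← add_mul]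
  congr 1
  rw [← Complex.ofReal_neg, ← Complex.ofReal_add, ← Complex.ofReal_add]
  congr 1
  linarith

lemma norm_exponentialSum_le (v : Fin 2 → ℝ) (n : ℕ) :
    ‖∑ k ∈ Finset.range (n + 1), (character v (z (node n (k + 1))) *
      (1 - Complex.exp (-(((v ⬝ᵥ D.mu) * (1 / (n + 1))
      + (v ⬝ᵥ fun i => D.R i 0) * (l (node n (k + 1)) 0 - l (node n k) 0)
      + (v ⬝ᵥ fun i => D.R i 1) * (l (node n (k + 1)) 1 - l (node n k) 1) : ℝ) * Complex.I)))
      - Complex.I * (v ⬝ᵥ D.mu : ℝ) * (1 / (n + 1)) * character v (z (node n (k + 1))))‖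
    ≤ 2 * |v ⬝ᵥ D.mu| + |v ⬝ᵥ fun i => D.R i 0| * l 1 0 + |v ⬝ᵥ fun i => D.R i 1| * l 1 1 := by
  -- The drift is counted twice: once in the exponential and once in the term subtracted from it.
  set m : ℝ≥0 → ℝ := fun t => 2 * |v ⬝ᵥ D.mu| * t + |v ⬝ᵥ fun i => D.R i 0| * l t 0
    + |v ⬝ᵥ fun i => D.R i 1| * l t 1 with hm
  have h01 : m 1 - m 0 = 2 * |v ⬝ᵥ D.mu| + |v ⬝ᵥ fun i => D.R i 0| * l 1 0
      + |v ⬝ᵥ fun i => D.R i 1| * l 1 1 := by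
    simp [hm, h.local_start]
  rw [← h01]
  have hs : m 1 - m 0 = ∑ k ∈ Finset.range (n + 1), (m (node n (k + 1)) - m (node n k)) := by
    rw [Finset.sum_range_sub (fun k => m (node n k)), node_last, node_zero]
  rw [hs]
  refine (norm_sum_le _ _).trans (Finset.sum_le_sum fun k _ => ?_)
  have d1 : 0 ≤ l (node n (k + 1)) 0 - l (node n k) 0 :=
    sub_nonneg.2 (h.local_mono 0 (node_mono n (Nat.le_succ k)))
  have d2 : 0 ≤ l (node n (k + 1)) 1 - l (node n k) 1 :=
    sub_nonneg.2 (h.local_mono 1 (node_mono n (Nat.le_succ k)))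
  have dn : (0 : ℝ) ≤ 1 / (n + 1) := by positivity
  have e1 : m (node n (k + 1)) - m (node n k) = |v ⬝ᵥ D.mu| * (1 / (n + 1))
      + |v ⬝ᵥ fun i => D.R i 0| * (l (node n (k + 1)) 0 - l (node n k) 0)
      + |v ⬝ᵥ fun i => D.R i 1| * (l (node n (k + 1)) 1 - l (node n k) 1)
      + |v ⬝ᵥ D.mu| * (1 / (n + 1)) := by
    rw [← node_succ_sub n k]; simp only [hm]; ring
  rw [e1]
  refine (norm_sub_le _ _).trans (add_le_add ?_ (le_of_eq ?_))
  · rw [norm_mul, norm_character, one_mul]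
    refine (norm_one_sub_exp_neg_mul_I_le _).trans ((abs_add_three _ _ _).trans (le_of_eq ?_))
    rw [abs_mul, abs_mul, abs_mul, abs_of_nonneg d1, abs_of_nonneg d2, abs_of_nonneg dn]
  · rw [norm_mul, norm_character, norm_mul, norm_mul, Complex.norm_I, Complex.norm_real]
    have : ‖(1 / ((n : ℂ) + 1))‖ = 1 / (n + 1) := by
      have e : (1 / ((n : ℂ) + 1)) = ((1 / ((n : ℝ) + 1) : ℝ) : ℂ) := by push_cast; rfl
      rw [e, Complex.norm_real, Real.norm_eq_abs, abs_of_nonneg dn]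
    rw [this, Real.norm_eq_abs]
    ring

end GoodPath

namespace IsRBM

variable {Ω : Type*} {mΩ : MeasurableSpace Ω} {P : Measure Ω}
  {ℱ : Filtration ℝ≥0 mΩ} {Z B L : ℝ≥0 → Ω → Fin 2 → ℝ} (hZ : D.IsRBM ℱ P Z B L)
include hZ

lemma measurable_dot_increment (v : Fin 2 → ℝ) (s t : ℝ≥0) :
    Measurable fun ω => v ⬝ᵥ (B t ω - B s ω) := by
  have h1 := hZ.measurable_B t
  have h0 := hZ.measurable_B s
  simp only [dotProduct, Pi.sub_apply]
  fun_prop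

lemma integral_character_increment (v : Fin 2 → ℝ) (hv : 0 ≤ v ⬝ᵥ (D.Sig *ᵥ v)) {s t : ℝ≥0}
    (hst : s ≤ t) : ∫ ω, character v (B t ω - B s ω) ∂P
      = Complex.exp (-((((t : ℝ) - s) * (v ⬝ᵥ (D.Sig *ᵥ v) / 2) : ℝ) : ℂ)) := by
  have hst' : (0 : ℝ) ≤ (t : ℝ) - s := sub_nonneg.2 hst
  have h1 : ∫ ω, character v (B t ω - B s ω) ∂P
      = ∫ x : ℝ, Complex.exp (x * Complex.I) ∂(P.map fun ω => v ⬝ᵥ (B t ω - B s ω)) := by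
    rw [integral_map (hZ.measurable_dot_increment v s t).aemeasurable
      (by fun_prop)]
    rfl
  have h2 := charFun_gaussianReal (μ := 0)
    (v := Real.toNNReal (((t : ℝ) - s) * (v ⬝ᵥ (D.Sig *ᵥ v)))) (t := 1)
  rw [charFun_apply_real] at h2
  simp only [Complex.ofReal_one, one_mul, Complex.ofReal_zero, mul_zero, zero_mul, one_pow,
    mul_one, zero_sub] at h2
  rw [h1, hZ.bm.law s t hst v, h2]
  congr 2
  rw [Real.coe_toNNReal _ (mul_nonneg hst' hv)]
  push_cast
  ring

lemma integral_character_mul (v : Fin 2 → ℝ) (hv : 0 ≤ v ⬝ᵥ (D.Sig *ᵥ v)) {s t : ℝ≥0}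
    (hst : s ≤ t) : ∫ ω, character v (Z s ω) * character v (B t ω - B s ω) ∂P
      = (∫ ω, character v (Z s ω) ∂P)
        * Complex.exp (-((((t : ℝ) - s) * (v ⬝ᵥ (D.Sig *ᵥ v) / 2) : ℝ) : ℂ)) := by
  have hind : IndepFun (fun ω => B t ω - B s ω) (Z s) P := by
    rw [IndepFun_iff_Indep]
    exact indep_of_indep_of_le_right (hZ.bm.indep s t hst) (hZ.adapted s).comap_le
  have hmB : Measurable fun ω => B t ω - B s ω := (hZ.measurable_B t).sub (hZ.measurable_B s)
  have hc := (continuous_character v).measurable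
  have h2 := (hind.symm.comp hc hc).integral_fun_mul_eq_mul_integral
    (hc.comp (hZ.measurable_Z s)).aestronglyMeasurable (hc.comp hmB).aestronglyMeasurable
  rw [← hZ.integral_character_increment v hv hst]
  exact h2

variable [IsProbabilityMeasure P]

lemma integral_boundary (hR : D.Stable) {π : Measure (Fin 2 → ℝ)}
    (hstat : ∀ t, P.map (Z t) = π) (v : Fin 2 → ℝ) (i j : Fin 2)
    (hg : ∀ x : Fin 2 → ℝ, x i = 0 → v ⬝ᵥ x = v j * x j) :
    Integrable (fun ω => ∫ t in Set.Iic 1, character v (Z t ω)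
      ∂(pathMeasure fun t => L t ω i)) P ∧
    ∫ ω, ∫ t in Set.Iic 1, character v (Z t ω) ∂(pathMeasure fun t => L t ω i) ∂P
      = laplace (boundaryMeasure P Z L i j) (v j * Complex.I) := by
  have hfin := hZ.isFiniteMeasure_boundaryMeasure hR hstat i j
  have hmeas : Measurable fun x : ℝ => Complex.exp (v j * Complex.I * x) := by fun_prop
  have hbd : ∀ x : ℝ, ‖Complex.exp (v j * Complex.I * x)‖ ≤ 1 := fun x => by
    rw [show (v j * Complex.I * x : ℂ) = ((v j * x : ℝ) : ℂ) * Complex.I by push_cast; ring,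
      Complex.norm_exp_ofReal_mul_I]
  have hfin' : IsFiniteMeasure
      (P.bind fun ω => pathBoundary (fun t => Z t ω) (fun t => L t ω) i j) := hfin
  obtain ⟨h1, h2⟩ := integral_bind_complex (hZ.aemeasurable_pathBoundary i j) (by
      filter_upwards [hZ.goodPath] with ω hω
      exact hω.isFiniteMeasure_pathBoundary i j) hmeas hbd
  have hae : (fun ω => ∫ x, Complex.exp (v j * Complex.I * x)
      ∂pathBoundary (fun t => Z t ω) (fun t => L t ω) i j) =ᵐ[P]
      fun ω => ∫ t in Set.Iic 1, character v (Z t ω) ∂(pathMeasure fun t => L t ω i) := by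
    filter_upwards [hZ.goodPath] with ω hω
    refine (hω.setIntegral_eq i j hmeas.stronglyMeasurable fun x hx => ?_).symm
    rw [character, hg x hx]
    congr 1
    push_cast
    ring
  exact ⟨h1.congr hae, (integral_congr_ae hae).symm.trans h2.symm⟩

/-- The stationary distribution and the boundary measures satisfy the functional equation at
imaginary points. -/
lemma functional_equation_imaginary (hSig : D.Sig.PosDef) (hR : D.Stable)
    {π : Measure (Fin 2 → ℝ)} (hstat : ∀ t, P.map (Z t) = π) (v : Fin 2 → ℝ) :
    D.gam (v 0 * Complex.I) (v 1 * Complex.I) * ∫ x, character v x ∂π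
      + D.gam1 (v 0 * Complex.I) (v 1 * Complex.I)
        * laplace (boundaryMeasure P Z L 0 1) (v 1 * Complex.I)
      + D.gam2 (v 0 * Complex.I) (v 1 * Complex.I)
        * laplace (boundaryMeasure P Z L 1 0) (v 0 * Complex.I) = 0 := by
  have hv : 0 ≤ v ⬝ᵥ (D.Sig *ᵥ v) := by
    have := hSig.posSemidef.dotProduct_mulVec_nonneg v
    simpa using this
  set Φ := ∫ x, character v x ∂π with hΦ
  have hΦt : ∀ t, ∫ ω, character v (Z t ω) ∂P = Φ := fun t => by
    rw [hΦ, ← hstat t, integral_map (hZ.measurable_Z t).aemeasurable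
      (continuous_character v).aestronglyMeasurable]
  obtain ⟨i0, e0⟩ := hZ.integral_boundary hR hstat v 0 1 (fun x hx => by
    simp [dotProduct, Fin.sum_univ_two, hx])
  obtain ⟨i1, e1⟩ := hZ.integral_boundary hR hstat v 1 0 (fun x hx => by
    simp [dotProduct, Fin.sum_univ_two, hx])
  set T : ℕ → Ω → ℂ := fun n ω => ∑ k ∈ Finset.range (n + 1), (character v (Z (node n (k + 1)) ω) *
      (1 - Complex.exp (-(((v ⬝ᵥ D.mu) * (1 / (n + 1))
      + (v ⬝ᵥ fun i => D.R i 0) * (L (node n (k + 1)) ω 0 - L (node n k) ω 0)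
      + (v ⬝ᵥ fun i => D.R i 1) * (L (node n (k + 1)) ω 1 - L (node n k) ω 1) : ℝ) * Complex.I)))
      - Complex.I * (v ⬝ᵥ D.mu : ℝ) * (1 / (n + 1)) * character v (Z (node n (k + 1)) ω)) with hT
  have hTae : ∀ n, T n =ᵐ[P] fun ω => ∑ k ∈ Finset.range (n + 1),
      (character v (Z (node n (k + 1)) ω)
        - character v (Z (node n k) ω) * character v (B (node n (k + 1)) ω - B (node n k) ω)
        - Complex.I * (v ⬝ᵥ D.mu : ℝ) * (1 / (n + 1)) * character v (Z (node n (k + 1)) ω)) := by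
    intro n
    filter_upwards [hZ.goodPath] with ω hω
    refine Finset.sum_congr rfl fun k _ => ?_
    rw [← hω.character_step v n k]
  have iZ : ∀ t, Integrable (fun ω => character v (Z t ω)) P := fun t =>
    integrable_character_comp v (hZ.measurable_Z t)
  have iZB : ∀ s t, Integrable
      (fun ω => character v (Z s ω) * character v (B t ω - B s ω)) P := fun s t => by
    simp only [← character_add]
    exact integrable_character_comp v
      ((hZ.measurable_Z s).add ((hZ.measurable_B t).sub (hZ.measurable_B s)))
  -- By stationarity and independence all n + 1 steps have the same mean. It involves only Φ, the
  -- Gaussian characteristic function and the drift.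
  have hTint : ∀ n, ∫ ω, T n ω ∂P = Φ * (((n : ℂ) + 1) *
      (1 - Complex.exp (-((1 / ((n : ℝ) + 1) * (v ⬝ᵥ (D.Sig *ᵥ v) / 2) : ℝ) : ℂ))))
      - Complex.I * (v ⬝ᵥ D.mu : ℝ) * Φ := by
    intro n
    rw [integral_congr_ae (hTae n), integral_finsetSum]
    · have hk : ∀ k ∈ Finset.range (n + 1), ∫ ω, (character v (Z (node n (k + 1)) ω)
        - character v (Z (node n k) ω) * character v (B (node n (k + 1)) ω - B (node n k) ω)
        - Complex.I * (v ⬝ᵥ D.mu : ℝ) * (1 / (n + 1)) * character v (Z (node n (k + 1)) ω)) ∂P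
          = Φ - Φ * Complex.exp (-((1 / ((n : ℝ) + 1) * (v ⬝ᵥ (D.Sig *ᵥ v) / 2) : ℝ) : ℂ))
            - Complex.I * (v ⬝ᵥ D.mu : ℝ) * (1 / (n + 1)) * Φ := by
        intro k _
        rw [integral_sub, integral_sub (iZ _) (iZB _ _),
          integral_const_mul, hΦt, hZ.integral_character_mul v hv (node_mono n (Nat.le_succ k)),
          hΦt, node_succ_sub]
        · exact (iZ _).sub (iZB _ _)
        · exact (iZ _).const_mul _
      rw [Finset.sum_congr rfl hk, Finset.sum_const, Finset.card_range, nsmul_eq_mul]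
      have : (n : ℂ) + 1 ≠ 0 := by exact_mod_cast n.succ_ne_zero
      push_cast
      field_simp
    · intro k _
      exact ((iZ _).sub (iZB _ _)).sub ((iZ _).const_mul _)
  have hlim1 : Tendsto (fun n => ∫ ω, T n ω ∂P) atTop
      (𝓝 (Φ * ((v ⬝ᵥ (D.Sig *ᵥ v) / 2 : ℝ) : ℂ) - Complex.I * (v ⬝ᵥ D.mu : ℝ) * Φ)) := by
    simp only [hTint]
    exact ((tendsto_mul_one_sub_exp _).const_mul _).sub_const _
  have hlim2 : Tendsto (fun n => ∫ ω, T n ω ∂P) atTop (𝓝 (∫ ω,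
      (Complex.I * (v ⬝ᵥ fun i => D.R i 0 : ℝ)
        * (∫ t in Set.Iic 1, character v (Z t ω) ∂(pathMeasure fun t => L t ω 0))
      + Complex.I * (v ⬝ᵥ fun i => D.R i 1 : ℝ)
        * (∫ t in Set.Iic 1, character v (Z t ω) ∂(pathMeasure fun t => L t ω 1))) ∂P)) := by
    refine tendsto_integral_of_dominated_convergence
      (fun ω => 2 * |v ⬝ᵥ D.mu| + |v ⬝ᵥ fun i => D.R i 0| * L 1 ω 0
        + |v ⬝ᵥ fun i => D.R i 1| * L 1 ω 1) (fun n => ?_) ?_ (fun n => ?_) ?_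
    · refine AEStronglyMeasurable.congr ?_ (hTae n).symm
      refine Finset.aestronglyMeasurable_fun_sum _ fun k _ => ?_
      exact (((iZ _).sub (iZB _ _)).sub ((iZ _).const_mul _)).aestronglyMeasurable
    · exact ((integrable_const _).add ((hZ.integrable_local hR hstat 0).1.const_mul _)).add
        ((hZ.integrable_local hR hstat 1).1.const_mul _)
    · filter_upwards [hZ.goodPath] with ω hω
      exact hω.norm_exponentialSum_le v n
    · filter_upwards [hZ.goodPath] with ω hω
      exact tendsto_exponentialSum (hω.local_mono 0) (hω.local_cont 0) (hω.local_mono 1)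
        (hω.local_cont 1) ((continuous_character v).comp hω.continuous_z)
        (fun t => norm_character _ _) _ _ _
  have key := tendsto_nhds_unique hlim1 hlim2
  rw [integral_add (i0.const_mul _) (i1.const_mul _), integral_const_mul, integral_const_mul,
    e0, e1] at key
  have hsym : D.Sig 1 0 = D.Sig 0 1 := by
    have := hSig.isHermitian.apply 0 1
    simpa using this
  simp only [dotProduct, Matrix.mulVec, Fin.sum_univ_two, hsym] at key
  push_cast at key
  simp only [gam, gam1, gam2]
  linear_combination (-1 : ℂ) * key + Φ * (1 / 2) * (D.Sig 0 0 * v 0 ^ 2 + 2 * D.Sig 0 1 * v 0 * v 1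
    + D.Sig 1 1 * v 1 ^ 2) * Complex.I_sq

end IsRBM

end RBMData

/-! ### Bounded analytic functions on the left half-plane -/

/-- `f` is bounded and continuous on the closed left half-plane and analytic inside. -/
structure LeftHalfBounded (f : ℂ → ℂ) : Prop where
  continuousOn : ContinuousOn f {z | z.re ≤ 0}
  differentiableOn : DifferentiableOn ℂ f {z | z.re < 0}
  bounded : ∃ C, ∀ z, z.re ≤ 0 → ‖f z‖ ≤ C

namespace LeftHalfBounded

lemma const (c : ℂ) : LeftHalfBounded fun _ => c :=
  ⟨continuousOn_const, differentiableOn_const c, ‖c‖, fun _ _ => le_rfl⟩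

lemma add {f g : ℂ → ℂ} (hf : LeftHalfBounded f) (hg : LeftHalfBounded g) :
    LeftHalfBounded fun z => f z + g z := by
  obtain ⟨C, hC⟩ := hf.bounded
  obtain ⟨C', hC'⟩ := hg.bounded
  exact ⟨hf.continuousOn.add hg.continuousOn, hf.differentiableOn.add hg.differentiableOn,
    C + C', fun z hz => (norm_add_le _ _).trans (add_le_add (hC z hz) (hC' z hz))⟩

lemma const_mul {f : ℂ → ℂ} (hf : LeftHalfBounded f) (c : ℂ) :
    LeftHalfBounded fun z => c * f z := by
  obtain ⟨C, hC⟩ := hf.bounded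
  refine ⟨continuousOn_const.mul hf.continuousOn, hf.differentiableOn.const_mul c,
    ‖c‖ * C, fun z hz => ?_⟩
  rw [norm_mul]
  exact mul_le_mul_of_nonneg_left (hC z hz) (norm_nonneg _)

/-- A quadratic combination of bounded functions that vanishes on the imaginary axis vanishes. -/
lemma eq_zero {f₀ f₁ f₂ : ℂ → ℂ} (h₀ : LeftHalfBounded f₀) (h₁ : LeftHalfBounded f₁)
    (h₂ : LeftHalfBounded f₂)
    (him : ∀ t : ℝ, f₀ (t * Complex.I) + t * Complex.I * f₁ (t * Complex.I)
      + (t * Complex.I) ^ 2 * f₂ (t * Complex.I) = 0) {z : ℂ} (hz : z.re ≤ 0) :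
    f₀ z + z * f₁ z + z ^ 2 * f₂ z = 0 := by
  obtain ⟨C₀, hC₀⟩ := h₀.bounded
  obtain ⟨C₁, hC₁⟩ := h₁.bounded
  obtain ⟨C₂, hC₂⟩ := h₂.bounded
  -- Reflection moves the problem to the right half-plane, and division by (z + 1)², whose zero lies
  -- outside, makes the quadratic combination bounded. Phragmén–Lindelöf then applies with boundary
  -- values 0.
  set F : ℂ → ℂ := fun z => (f₀ (-z) + -z * f₁ (-z) + (-z) ^ 2 * f₂ (-z)) / (z + 1) ^ 2 with hF
  have hne : ∀ z : ℂ, 0 ≤ z.re → z + 1 ≠ 0 := fun z hz h => by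
    have := congrArg Complex.re h
    simp at this
    linarith
  have h1 : ∀ z : ℂ, 0 ≤ z.re → 1 ≤ ‖z + 1‖ := fun z hz =>
    le_trans (by simpa using hz) (Complex.re_le_norm (z + 1))
  have hzz : ∀ z : ℂ, 0 ≤ z.re → ‖z‖ ≤ ‖z + 1‖ := fun z hz => by
    rw [← sq_le_sq₀ (norm_nonneg _) (norm_nonneg _), Complex.sq_norm, Complex.sq_norm,
      Complex.normSq_apply, Complex.normSq_apply]
    simp
    nlinarith
  have hbd : ∀ z : ℂ, 0 ≤ z.re → ‖F z‖ ≤ C₀ + C₁ + C₂ := fun z hz => by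
    have hz' : (-z).re ≤ 0 := by simpa using hz
    have hp : 0 < ‖z + 1‖ := norm_pos_iff.2 (hne z hz)
    have k1 := h1 z hz
    have k2 := hzz z hz
    have a0 := hC₀ _ hz'
    have a1 := hC₁ _ hz'
    have a2 := hC₂ _ hz'
    have p0 := (norm_nonneg _).trans a0
    have p1 := (norm_nonneg _).trans a1
    have p2 := (norm_nonneg _).trans a2
    simp only [hF]
    rw [norm_div, norm_pow, div_le_iff₀ (by positivity)]
    have b1 : (1 : ℝ) ≤ ‖z + 1‖ ^ 2 := one_le_pow₀ k1
    have b2 : ‖z‖ ^ 2 ≤ ‖z + 1‖ ^ 2 := pow_le_pow_left₀ (norm_nonneg _) k2 2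
    have b3 : ‖z‖ ≤ ‖z + 1‖ ^ 2 := k2.trans (by nlinarith)
    refine (norm_add₃_le).trans ?_
    rw [norm_mul, norm_mul, norm_pow, norm_neg]
    have c0 : ‖f₀ (-z)‖ ≤ C₀ * ‖z + 1‖ ^ 2 := a0.trans (le_mul_of_one_le_right p0 b1)
    have c1 : ‖z‖ * ‖f₁ (-z)‖ ≤ ‖z + 1‖ ^ 2 * C₁ := by gcongr
    have c2 : ‖z‖ ^ 2 * ‖f₂ (-z)‖ ≤ ‖z + 1‖ ^ 2 * C₂ := by gcongr
    linarith
  have hcl : closure {z : ℂ | 0 < z.re} = {z | 0 ≤ z.re} := Complex.closure_setOfPred_lt_re 0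
  have hmc : Set.MapsTo (fun z : ℂ => -z) {z | 0 ≤ z.re} {z | z.re ≤ 0} := fun z hz => by
    have : 0 ≤ z.re := hz
    simpa using this
  have hmd : Set.MapsTo (fun z : ℂ => -z) {z | 0 < z.re} {z | z.re < 0} := fun z hz => by
    have : 0 < z.re := hz
    simpa using this
  have hdc : DiffContOnCl ℂ F {z | 0 < z.re} := by
    refine ⟨?_, ?_⟩
    · have e0 := h₀.differentiableOn.comp differentiable_neg.differentiableOn hmd
      have e1 := h₁.differentiableOn.comp differentiable_neg.differentiableOn hmd
      have e2 := h₂.differentiableOn.comp differentiable_neg.differentiableOn hmd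
      refine DifferentiableOn.div ((e0.add (differentiable_neg.differentiableOn.mul e1)).add
        ((differentiable_neg.differentiableOn.pow 2).mul e2))
        ((differentiableOn_id.add_const 1).pow 2) fun z hz => pow_ne_zero 2 (hne z (le_of_lt hz))
    · rw [hcl]
      have e0 := h₀.continuousOn.comp continuous_neg.continuousOn hmc
      have e1 := h₁.continuousOn.comp continuous_neg.continuousOn hmc
      have e2 := h₂.continuousOn.comp continuous_neg.continuousOn hmc
      refine ContinuousOn.div ((e0.add (continuous_neg.continuousOn.mul e1)).add
        ((continuous_neg.continuousOn.pow 2).mul e2))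
        ((continuousOn_id.add continuousOn_const).pow 2) fun z hz => pow_ne_zero 2 (hne z hz)
  have hres := PhragmenLindelof.right_half_plane_of_bounded_on_real (C := 0) (f := F) (z := -z) hdc
    ⟨0, by norm_num, 0, by
      refine Asymptotics.IsBigO.of_bound (C₀ + C₁ + C₂) ?_
      filter_upwards [mem_inf_of_right (mem_principal_self _)] with w hw
      simpa using hbd w (le_of_lt hw)⟩
    (isBoundedUnder_of_eventually_le (a := C₀ + C₁ + C₂) (by
      filter_upwards [eventually_ge_atTop (0 : ℝ)] with x hx
      exact hbd x (by simpa using hx)))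
    (fun t => by
      have := him (-t)
      simp only [hF]
      rw [show -((t : ℂ) * Complex.I) = ((-t : ℝ) : ℂ) * Complex.I by push_cast; ring, this]
      simp) (by simpa using hz)
  have h0 : F (-z) = 0 := norm_le_zero_iff.1 hres
  simp only [hF, neg_neg] at h0
  exact (div_eq_zero_iff.1 h0).resolve_right (pow_ne_zero 2 (hne _ (by simpa using hz)))

/-- Laplace transforms are bounded analytic functions. -/
lemma integral_exp {α : Type*} {mα : MeasurableSpace α} {μ : Measure α} [IsFiniteMeasure μ]
    {X : α → ℝ} (hX : Measurable X) (h0 : ∀ᵐ a ∂μ, 0 ≤ X a) {g : α → ℂ} (hg : Measurable g)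
    (hg1 : ∀ᵐ a ∂μ, ‖g a‖ ≤ 1) :
    LeftHalfBounded fun z => ∫ a, g a * Complex.exp (z * X a) ∂μ := by
  have hnorm : ∀ (z : ℂ) a, ‖Complex.exp (z * X a)‖ = Real.exp (z.re * X a) := fun z a => by
    rw [Complex.norm_exp]; simp
  have hle : ∀ z : ℂ, z.re ≤ 0 → ∀ᵐ a ∂μ, ‖g a * Complex.exp (z * X a)‖ ≤ 1 := fun z hz => by
    filter_upwards [h0, hg1] with a ha ha1
    rw [norm_mul, hnorm]
    exact mul_le_one₀ ha1 (Real.exp_nonneg _)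
      (Real.exp_le_one_iff.2 (mul_nonpos_of_nonpos_of_nonneg hz ha))
  have hm : ∀ z : ℂ, AEStronglyMeasurable (fun a => g a * Complex.exp (z * X a)) μ := fun z => by
    have : Measurable fun a => g a * Complex.exp (z * X a) := by fun_prop
    exact this.aestronglyMeasurable
  refine ⟨?_, ?_, μ.real Set.univ, fun z hz => ?_⟩
  · refine continuousOn_of_dominated (bound := fun _ => 1) (fun z _ => hm z) hle
      (integrable_const _) (Eventually.of_forall fun a => ?_)
    fun_prop
  · intro z₀ hz₀
    have hz₀ : z₀.re < 0 := hz₀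
    -- Half the distance to the imaginary axis: where Re z < -d, the derivative in z is at most X
    -- exp(-dX) ≤ 1/d.
    set d := -z₀.re / 2 with hd
    have hdpos : 0 < d := by rw [hd]; linarith
    have hs : {z : ℂ | z.re < -d} ∈ 𝓝 z₀ :=
      (isOpen_lt Complex.continuous_re continuous_const).mem_nhds (by
        change z₀.re < -d
        rw [hd]; linarith)
    have := hasDerivAt_integral_of_dominated_loc_of_deriv_le (μ := μ) (bound := fun _ => 1 / d)
      (F := fun z a => g a * Complex.exp (z * X a))
      (F' := fun z a => g a * (Complex.exp (z * X a) * X a)) hs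
      (Eventually.of_forall hm) (Integrable.of_bound (hm z₀) 1 (hle z₀ hz₀.le)) (by
        have : Measurable fun a => g a * (Complex.exp (z₀ * X a) * X a) := by fun_prop
        exact this.aestronglyMeasurable) (by
        filter_upwards [h0, hg1] with a ha ha1 z hz
        have hz : z.re < -d := hz
        rw [norm_mul, norm_mul, hnorm, Complex.norm_real, Real.norm_eq_abs, abs_of_nonneg ha]
        have e1 : Real.exp (z.re * X a) ≤ Real.exp (-(d * X a)) :=
          Real.exp_le_exp.2 (by nlinarith)
        have e2 : d * X a ≤ Real.exp (d * X a) := by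
          have := Real.add_one_le_exp (d * X a)
          linarith
        have e3 : Real.exp (z.re * X a) * X a ≤ 1 / d := by
          rw [le_div_iff₀ hdpos]
          calc Real.exp (z.re * X a) * X a * d = Real.exp (z.re * X a) * (d * X a) := by ring
            _ ≤ Real.exp (-(d * X a)) * Real.exp (d * X a) := by
              apply mul_le_mul e1 e2 (by positivity) (Real.exp_nonneg _)
            _ = 1 := by rw [← Real.exp_add]; simp
        exact (mul_le_of_le_one_left (by positivity) ha1).trans e3)
      (integrable_const _) (Eventually.of_forall fun a z _ => by
        have := ((hasDerivAt_id z).mul_const (X a : ℂ)).cexp.const_mul (g a)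
        simpa using this)
    exact this.2.differentiableAt.differentiableWithinAt
  · have := norm_integral_le_of_norm_le_const (hle z hz)
    simpa using this

lemma laplace {ν : Measure ℝ} [IsFiniteMeasure ν] (h0 : ∀ᵐ x ∂ν, 0 ≤ x) :
    LeftHalfBounded (laplace ν) := by
  have := integral_exp measurable_id h0 (g := fun _ => 1) measurable_const (by simp)
  have e : _root_.laplace ν = fun z => ∫ x, Complex.exp (z * x) ∂ν := rfl
  rw [e]
  simpa using this

end LeftHalfBounded

namespace RBMData

variable {D : RBMData}

/-- The functional equation on the product of the left half-planes follows from the functional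
equation at imaginary points. -/
lemma functional_equation_of_imaginary {π : Measure (Fin 2 → ℝ)} [IsProbabilityMeasure π]
    (hπ : ∀ᵐ x ∂π, ∀ i, 0 ≤ x i) {ν₁ ν₂ : Measure ℝ} [IsFiniteMeasure ν₁] [IsFiniteMeasure ν₂]
    (h₁ : ∀ᵐ x ∂ν₁, 0 ≤ x) (h₂ : ∀ᵐ x ∂ν₂, 0 ≤ x)
    (him : ∀ v : Fin 2 → ℝ,
      D.gam (v 0 * Complex.I) (v 1 * Complex.I) * ∫ x, character v x ∂π
      + D.gam1 (v 0 * Complex.I) (v 1 * Complex.I) * laplace ν₁ (v 1 * Complex.I)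
      + D.gam2 (v 0 * Complex.I) (v 1 * Complex.I) * laplace ν₂ (v 0 * Complex.I) = 0)
    {x y : ℂ} (hx : x.re ≤ 0) (hy : y.re ≤ 0) :
    D.gam x y * ∫ z, Complex.exp (y * z 1) * Complex.exp (x * z 0) ∂π
      + D.gam1 x y * laplace ν₁ y + D.gam2 x y * laplace ν₂ x = 0 := by
  have hm : ∀ i, Measurable fun z : Fin 2 → ℝ => z i := fun i => measurable_pi_apply i
  have hp : ∀ i, ∀ᵐ z ∂π, 0 ≤ z i := fun i => hπ.mono fun z hz => hz i
  have hbd : ∀ (w : ℂ) (i : Fin 2), w.re ≤ 0 → ∀ᵐ z ∂π, ‖Complex.exp (w * z i)‖ ≤ 1 := by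
    intro w i hw
    filter_upwards [hp i] with z hz
    rw [Complex.norm_exp, Real.exp_le_one_iff]
    simpa using mul_nonpos_of_nonpos_of_nonneg hw hz
  have hL₁ := LeftHalfBounded.laplace h₁
  have hL₂ := LeftHalfBounded.laplace h₂
  have step : ∀ t : ℝ, D.gam x (t * Complex.I)
      * ∫ z, Complex.exp (t * Complex.I * z 1) * Complex.exp (x * z 0) ∂π
      + D.gam1 x (t * Complex.I) * laplace ν₁ (t * Complex.I)
      + D.gam2 x (t * Complex.I) * laplace ν₂ x = 0 := by
    intro t
    set y : ℂ := t * Complex.I with hy'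
    have hF := LeftHalfBounded.integral_exp (hm 0) (hp 0) (g := fun z => Complex.exp (y * z 1))
      (by fun_prop) (hbd y 1 (by simp [hy']))
    have := LeftHalfBounded.eq_zero
      (((hF.const_mul (1 / 2 * D.Sig 1 1 * y ^ 2 + D.mu 1 * y)).add (hL₂.const_mul (D.R 1 1 * y))).add
        (LeftHalfBounded.const (D.R 1 0 * y * laplace ν₁ y)))
      (((hF.const_mul (D.Sig 0 1 * y + D.mu 0)).add (hL₂.const_mul (D.R 0 1))).add
        (LeftHalfBounded.const (D.R 0 0 * laplace ν₁ y)))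
      (hF.const_mul (1 / 2 * D.Sig 0 0)) (fun s => by
        have := him ![s, t]
        simp only [Matrix.cons_val_zero, Matrix.cons_val_one] at this
        have e : ∫ z, character ![s, t] z ∂π
            = ∫ z, Complex.exp (y * z 1) * Complex.exp (s * Complex.I * z 0) ∂π := by
          refine integral_congr_ae (Eventually.of_forall fun z => ?_)
          simp only [character, hy']
          rw [← Complex.exp_add]
          congr 1
          simp only [dotProduct, Fin.sum_univ_two, Matrix.cons_val_zero, Matrix.cons_val_one]
          push_cast
          ring
        rw [e, ← hy'] at this
        simp only [gam, gam1, gam2] at this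
        linear_combination this) hx
    simp only [gam, gam1, gam2]
    linear_combination this
  have hF := LeftHalfBounded.integral_exp (hm 1) (hp 1) (g := fun z => Complex.exp (x * z 0))
    (by fun_prop) (hbd x 0 hx)
  have := LeftHalfBounded.eq_zero
    (((hF.const_mul (1 / 2 * D.Sig 0 0 * x ^ 2 + D.mu 0 * x)).add (hL₁.const_mul (D.R 0 0 * x))).add
      (LeftHalfBounded.const (D.R 0 1 * x * laplace ν₂ x)))
    (((hF.const_mul (D.Sig 0 1 * x + D.mu 1)).add (hL₁.const_mul (D.R 1 0))).add
      (LeftHalfBounded.const (D.R 1 1 * laplace ν₂ x)))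
    (hF.const_mul (1 / 2 * D.Sig 1 1)) (fun t => by
      have := step t
      have e : ∫ z, Complex.exp (t * Complex.I * z 1) * Complex.exp (x * z 0) ∂π
          = ∫ z, Complex.exp (x * z 0) * Complex.exp (t * Complex.I * z 1) ∂π :=
        integral_congr_ae (Eventually.of_forall fun z => mul_comm _ _)
      rw [e] at this
      simp only [gam, gam1, gam2] at this
      linear_combination this) hy
  have e : ∫ z, Complex.exp (y * z 1) * Complex.exp (x * z 0) ∂π
      = ∫ z, Complex.exp (x * z 0) * Complex.exp (y * z 1) ∂π :=
    integral_congr_ae (Eventually.of_forall fun z => mul_comm _ _)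
  rw [e]
  simp only [gam, gam1, gam2]
  linear_combination this

/-- On the zero set of the kernel, the functional equation relates the boundary measures. -/
lemma IsRBM.boundary_relation {Ω : Type*} {mΩ : MeasurableSpace Ω} {P : Measure Ω}
    [IsProbabilityMeasure P] {ℱ : Filtration ℝ≥0 mΩ} {Z B L : ℝ≥0 → Ω → Fin 2 → ℝ}
    (hZ : D.IsRBM ℱ P Z B L) (hSig : D.Sig.PosDef) (hR : D.Stable) {π : Measure (Fin 2 → ℝ)}
    (hstat : ∀ t, P.map (Z t) = π) {x y : ℂ} (hx : x.re ≤ 0) (hy : y.re ≤ 0)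
    (hxy : D.gam x y = 0) :
    D.gam1 x y * laplace (boundaryMeasure P Z L 0 1) y
      + D.gam2 x y * laplace (boundaryMeasure P Z L 1 0) x = 0 := by
  have hπ1 : IsProbabilityMeasure π := by
    rw [← hstat 0]
    exact Measure.isProbabilityMeasure_map (hZ.measurable_Z 0).aemeasurable
  have hπ : ∀ᵐ z ∂π, ∀ i, 0 ≤ z i := by
    rw [← hstat 0, ae_map_iff (hZ.measurable_Z 0).aemeasurable]
    · filter_upwards [hZ.quadrant] with ω hω i
      exact hω 0 i
    · have : {z : Fin 2 → ℝ | ∀ i, 0 ≤ z i} = ⋂ i, {z | 0 ≤ z i} := by ext; simp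
      rw [this]
      exact MeasurableSet.iInter fun i => measurableSet_le measurable_const (measurable_pi_apply i)
  have := hZ.isFiniteMeasure_boundaryMeasure hR hstat 0 1
  have := hZ.isFiniteMeasure_boundaryMeasure hR hstat 1 0
  have key := functional_equation_of_imaginary (D := D) hπ (hZ.boundaryMeasure_nonneg 0 1)
    (hZ.boundaryMeasure_nonneg 1 0) (hZ.functional_equation_imaginary hSig hR hstat) hx hy
  rw [hxy, zero_mul, zero_add] at key
  exact key

end RBMData

/-! ### The continuation of the boundary transform -/

/-- The inverse function theorem for analytic functions of one variable. -/
lemma AnalyticAt.exists_local_inverse {f : ℂ → ℂ} {a : ℂ} (hf : AnalyticAt ℂ f a)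
    (hd : deriv f a ≠ 0) : ∃ g : ℂ → ℂ, AnalyticAt ℂ g (f a) ∧ g (f a) = a ∧
      deriv g (f a) ≠ 0 ∧ ∀ᶠ y in 𝓝 (f a), f (g y) = y := by
  have hs := hf.hasStrictDerivAt
  have hs' := hs.hasStrictFDerivAt_equiv hd
  have hc : ContDiffAt ℂ ⊤ f a := hf.contDiffAt
  refine ⟨hc.localInverse hs'.hasFDerivAt (by simp), ?_, ?_, ?_, ?_⟩
  · exact (hc.to_localInverse hs'.hasFDerivAt (by simp)).analyticAt
  · exact hc.localInverse_apply_image hs'.hasFDerivAt (by simp)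
  · have h1 := (hs.to_localInverse hd).hasDerivAt.deriv
    have : deriv (hc.localInverse hs'.hasFDerivAt (by simp)) (f a) = (deriv f a)⁻¹ := h1
    rw [this]
    exact inv_ne_zero hd
  · exact hs'.eventually_right_inverse

namespace RBMData

variable {D : RBMData}

lemma gam_Theta1Minus (h : 0 < D.Sig 0 0) (y : ℂ) : D.gam (D.Theta1Minus y) y = 0 := by
  have h' : (D.Sig 0 0 : ℂ) ≠ 0 := by exact_mod_cast h.ne'
  set q := y ^ 2 * ((D.Sig 0 1 : ℂ) ^ 2 - D.Sig 0 0 * D.Sig 1 1)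
        + 2 * y * (D.mu 0 * D.Sig 0 1 - D.mu 1 * D.Sig 0 0) + D.mu 0 ^ 2 with hq
  have hsq := Complex.sq_sqrt' q
  have e : D.Sig 0 0 * D.Theta1Minus y + (D.Sig 0 1 * y + D.mu 0) = -Complex.sqrt q := by
    rw [Theta1Minus, ← hq]
    field_simp
    ring
  have e2 : (D.Sig 0 0 * D.Theta1Minus y + (D.Sig 0 1 * y + D.mu 0)) ^ 2 = q := by
    rw [e, neg_sq, hsq]
  have e3 : 2 * (D.Sig 0 0 : ℂ) * D.gam (D.Theta1Minus y) y = 0 := by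
    rw [gam]
    rw [hq] at e2
    linear_combination e2
  exact (mul_eq_zero.1 e3).resolve_left (mul_ne_zero two_ne_zero h')

lemma p_pos (h : D.Stable) (hl : 0 < D.lineForm) : 0 < D.p := by
  have h1 := h.r11_pos
  have h2 := h.drift2
  rw [p]
  exact div_pos (mul_pos (by linarith) (by linarith)) hl

/-- The product of the two values of `γ₁` above a point. -/
lemma gam1_mul_gam1_conjugate (h : 0 < D.Sig 0 0) (hl : 0 < D.lineForm) (y : ℂ) :
    D.gam1 (D.Theta1Minus y) y *
      D.gam1 (-(2 * (D.Sig 0 1 * y + D.mu 0) / D.Sig 0 0) - D.Theta1Minus y) y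
      = D.lineForm / D.Sig 0 0 * (y * (y - D.p)) := by
  have h' : (D.Sig 0 0 : ℂ) ≠ 0 := by exact_mod_cast h.ne'
  have hg := gam_Theta1Minus h y
  have hp : (D.lineForm : ℂ) * D.p = 2 * D.R 0 0 * (D.mu 0 * D.R 1 0 - D.mu 1 * D.R 0 0) := by
    have : D.lineForm * D.p = 2 * D.R 0 0 * (D.mu 0 * D.R 1 0 - D.mu 1 * D.R 0 0) := by
      rw [p]
      exact mul_div_cancel₀ _ hl.ne'
    exact_mod_cast congrArg (fun x : ℝ => (x : ℂ)) this
  rw [gam] at hg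
  have e : (D.lineForm : ℂ) = D.R 0 0 ^ 2 * D.Sig 1 1 - 2 * D.R 0 0 * D.R 1 0 * D.Sig 0 1
      + D.R 1 0 ^ 2 * D.Sig 0 0 := by rw [lineForm]; push_cast; rfl
  have e1 : (D.lineForm : ℂ) / D.Sig 0 0 * (y * (y - D.p))
      = (D.lineForm * y ^ 2 - (D.lineForm * D.p) * y) / D.Sig 0 0 := by ring
  rw [e1, hp, e, gam1, gam1]
  field_simp
  linear_combination (-2 * (D.R 0 0 : ℂ) ^ 2) * hg

/-- The quotient that continues the transform of the first boundary measure. -/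
noncomputable def ratio (D : RBMData) (f₂ : ℂ → ℂ) (y : ℂ) : ℂ :=
  -(D.gam2 (D.Theta1Minus y) y * f₂ (D.Theta1Minus y)) / D.gam1 (D.Theta1Minus y) y

open Classical in
/-- The continuation of the transform of the first boundary measure. -/
noncomputable def continuation (D : RBMData) (f₁ f₂ : ℂ → ℂ) (y : ℂ) : ℂ :=
  if y.re ≤ 0 then f₁ y else D.ratio f₂ y

end RBMData

namespace Uniformization

open RBMData

variable {D : RBMData} (U : Uniformization D)

lemma analyticAt_Y (s : ℂ) : AnalyticAt ℂ U.Y s :=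
  (show Differentiable ℂ U.Y by unfold Y; fun_prop).analyticAt s

lemma analyticAt_X (s : ℂ) : AnalyticAt ℂ U.X s :=
  (show Differentiable ℂ U.X by unfold X; fun_prop).analyticAt s

lemma deriv_Y_ne_zero {s : ℂ} (h0 : 0 < s.re) (h1 : s.re < Real.pi) : deriv U.Y s ≠ 0 := by
  have h : HasDerivAt U.Y (U.r₂ * Complex.sin s) s := by
    have := ((hasDerivAt_const s (Complex.cos U.s₀)).sub (Complex.hasDerivAt_cos s)).const_mul
      (U.r₂ : ℂ)
    exact this.congr_deriv (by ring)
  rw [h.deriv]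
  refine mul_ne_zero (by exact_mod_cast U.r₂_pos.ne') fun h2 => ?_
  have := Complex.sin_re_pos h0 h1
  rw [h2] at this
  simp at this

/-- The derivative of `Y` does not vanish in this strip, so Θ₁⁻ is locally `X` composed with an
analytic inverse of `Y`. This avoids locating the cut of the principal square root. -/
lemma analyticAt_Theta1Minus_Y {s : ℂ} (h0 : 0 < s.re) (h1 : s.re < Real.pi) :
    AnalyticAt ℂ D.Theta1Minus (U.Y s) := by
  obtain ⟨g, hg, hgs, -, hinv⟩ := (U.analyticAt_Y s).exists_local_inverse (U.deriv_Y_ne_zero h0 h1)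
  have hX : AnalyticAt ℂ (fun y => U.X (g y)) (U.Y s) := (U.analyticAt_X _).comp hg
  refine hX.congr ?_
  have hc := hg.continuousAt
  rw [ContinuousAt, hgs] at hc
  have hopen : IsOpen {s : ℂ | 0 < s.re ∧ s.re < Real.pi} :=
    (isOpen_lt continuous_const Complex.continuous_re).inter
      (isOpen_lt Complex.continuous_re continuous_const)
  filter_upwards [hinv, hc.eventually (hopen.mem_nhds ⟨h0, h1⟩)] with y hy hy'
  rw [← U.Theta1Minus_Y hy'.1 hy'.2, hy]

/-- The line Re s = 0 is mapped into (-∞, θ₂⁻], which lies in the open left half-plane. -/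
lemma exists_pos_of_mem_domain {y : ℂ} (hy : y ∈ D.domain) (h : 0 ≤ y.re) :
    ∃ s : ℂ, 0 < s.re ∧ s.re < D.beta ∧ U.Y s = y := by
  obtain ⟨s, h0, h1, rfl⟩ := U.exists_of_mem_domain hy
  refine ⟨s, lt_of_le_of_ne h0 fun he => ?_, h1, rfl⟩
  rw [U.Y_re, ← he, Real.cos_zero, one_mul] at h
  have := U.r₂_pos
  have h3 : Real.cos U.s₀ < 1 := by
    rw [← Real.cos_zero]
    exact Real.cos_lt_cos_of_nonneg_of_le_pi le_rfl (U.s₀_lt.trans U.beta_lt).le U.s₀_pos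
  have := Real.one_le_cosh s.im
  nlinarith

lemma analyticAt_Theta1Minus (U : Uniformization D) {y : ℂ} (hy : y ∈ D.domain) (h : 0 ≤ y.re) :
    AnalyticAt ℂ D.Theta1Minus y := by
  obtain ⟨s, h0, h1, rfl⟩ := U.exists_pos_of_mem_domain hy h
  exact U.analyticAt_Theta1Minus_Y h0 (h1.trans U.beta_lt)

/-- This is what makes `ratio` meaningful: at a nonzero point of the domain with Re y ≥ 0, the
transform f₂ is analytic at Θ₁⁻(y). -/
lemma re_neg_or (U : Uniformization D) {y : ℂ} (hy : y ∈ D.domain) (h : y ≠ 0) :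
    y.re < 0 ∨ (D.Theta1Minus y).re < 0 := by
  by_contra! hcon
  obtain ⟨s, h0, h1, rfl⟩ := U.exists_pos_of_mem_domain hy hcon.1
  rw [U.Theta1Minus_Y h0 (h1.trans U.beta_lt)] at hcon
  rw [U.eq_s₀_of_re_nonneg h0.le h1 hcon.2 hcon.1] at h
  exact h U.Y_s₀

lemma zero_mem_domain (U : Uniformization D) : (0 : ℂ) ∈ D.domain := by
  have := U.beta_lt
  have := U.s₀_lt
  have := U.s₀_pos
  rw [← U.Y_s₀, U.Y_mem_domain_iff] <;> simp <;> linarith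

lemma Theta1Minus_zero (U : Uniformization D) : D.Theta1Minus 0 = 0 := by
  have := U.beta_lt
  have := U.s₀_lt
  have := U.Theta1Minus_Y (s := U.s₀) (by simpa using U.s₀_pos) (by simp; linarith)
  rwa [U.Y_s₀, U.X_s₀] at this

lemma gam1_ne_zero (U : Uniformization D) (h : D.Stable) {y : ℂ} (h0 : y ≠ 0) (hp : y ≠ D.p) :
    D.gam1 (D.Theta1Minus y) y ≠ 0 := fun hg =>
  (eq_zero_or_eq_p h.r11_pos (U.lineForm_pos h).ne' (gam_Theta1Minus U.sig11_pos y) hg).elim h0 hp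

lemma deriv_Theta1Minus_zero (U : Uniformization D) :
    D.mu 0 * deriv D.Theta1Minus 0 + D.mu 1 = 0 := by
  have hT := (U.analyticAt_Theta1Minus U.zero_mem_domain le_rfl).differentiableAt.hasDerivAt
  have h0 := U.Theta1Minus_zero
  have hg : HasDerivAt (fun y => D.gam (D.Theta1Minus y) y)
      (D.mu 0 * deriv D.Theta1Minus 0 + D.mu 1) 0 := by
    unfold gam
    have hid := hasDerivAt_id (0 : ℂ)
    have := (((((hT.pow 2).const_mul (D.Sig 0 0 : ℂ)).add
      ((hT.const_mul (2 * D.Sig 0 1 : ℂ)).mul hid)).add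
      ((hid.pow 2).const_mul (D.Sig 1 1 : ℂ))).const_mul (1 / 2 : ℂ)).add
      (hT.const_mul (D.mu 0 : ℂ)) |>.add (hid.const_mul (D.mu 1 : ℂ))
    refine this.congr_deriv ?_
    simp [h0]
  have hz : (fun y => D.gam (D.Theta1Minus y) y) = fun _ => 0 :=
    funext fun y => gam_Theta1Minus U.sig11_pos y
  rw [hz] at hg
  exact hg.unique (hasDerivAt_const _ _)

section

variable {f₁ f₂ : ℂ → ℂ}

lemma analyticAt_num (U : Uniformization D) (h₂ : LeftHalfBounded f₂) {y : ℂ} (hy : y ∈ D.domain)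
    (h : 0 ≤ y.re) (h0 : y ≠ 0) :
    AnalyticAt ℂ (fun y => -(D.gam2 (D.Theta1Minus y) y * f₂ (D.Theta1Minus y))) y := by
  have hT := U.analyticAt_Theta1Minus hy h
  have hre := (U.re_neg_or hy h0).resolve_left (not_lt.2 h)
  have hf : AnalyticAt ℂ f₂ (D.Theta1Minus y) :=
    h₂.differentiableOn.analyticAt ((isOpen_lt Complex.continuous_re continuous_const).mem_nhds hre)
  have hf' : AnalyticAt ℂ (fun y => f₂ (D.Theta1Minus y)) y := hf.comp hT
  unfold gam2
  fun_prop

lemma analyticAt_gam1 (U : Uniformization D) {y : ℂ} (hy : y ∈ D.domain) (h : 0 ≤ y.re) :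
    AnalyticAt ℂ (fun y => D.gam1 (D.Theta1Minus y) y) y := by
  have hT := U.analyticAt_Theta1Minus hy h
  unfold gam1
  fun_prop

/-- The boundary relation makes the two definitions agree on the overlap, where both y and Θ₁⁻(y)
are in the left half-plane; this glues them across the imaginary axis. -/
lemma continuation_eq_ratio (U : Uniformization D) (hs : D.Stable)
    (hrel : ∀ x y : ℂ, x.re ≤ 0 → y.re ≤ 0 → D.gam x y = 0 →
      D.gam1 x y * f₁ y + D.gam2 x y * f₂ x = 0)
    {y₀ : ℂ} (hy : y₀ ∈ D.domain) (h : 0 ≤ y₀.re) (h0 : y₀ ≠ 0) :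
    ∀ᶠ y : ℂ in 𝓝 y₀, y ≠ D.p → D.continuation f₁ f₂ y = D.ratio f₂ y := by
  have hT := (U.analyticAt_Theta1Minus hy h).continuousAt
  have hre := (U.re_neg_or hy h0).resolve_left (not_lt.2 h)
  have h1 : ∀ᶠ y in 𝓝 y₀, (D.Theta1Minus y).re < 0 :=
    hT.eventually ((isOpen_lt Complex.continuous_re continuous_const).mem_nhds hre)
  filter_upwards [h1, isOpen_ne.mem_nhds h0] with y hy1 hy0 hyp
  rw [continuation]
  split_ifs with hc
  · have := hrel _ _ hy1.le hc (gam_Theta1Minus U.sig11_pos y)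
    rw [ratio, eq_div_iff (U.gam1_ne_zero hs hy0 hyp)]
    linear_combination this
  · rfl

lemma analyticAt_continuation (U : Uniformization D) (hs : D.Stable)
    (h₁ : LeftHalfBounded f₁) (h₂ : LeftHalfBounded f₂)
    (hrel : ∀ x y : ℂ, x.re ≤ 0 → y.re ≤ 0 → D.gam x y = 0 →
      D.gam1 x y * f₁ y + D.gam2 x y * f₂ x = 0)
    {y₀ : ℂ} (hy : y₀ ∈ D.domain) (h0 : y₀ ≠ 0) (hp : y₀ ≠ D.p) :
    AnalyticAt ℂ (D.continuation f₁ f₂) y₀ := by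
  rcases lt_or_ge y₀.re 0 with h | h
  · have hn : {z : ℂ | z.re < 0} ∈ 𝓝 y₀ :=
      (isOpen_lt Complex.continuous_re continuous_const).mem_nhds h
    refine (h₁.differentiableOn.analyticAt hn).congr ?_
    filter_upwards [hn] with y hy'
    exact (if_pos (le_of_lt hy')).symm
  · have := (U.analyticAt_num h₂ hy h h0).div (U.analyticAt_gam1 hy h) (U.gam1_ne_zero hs h0 hp)
    refine this.congr ?_
    filter_upwards [U.continuation_eq_ratio hs hrel hy h h0, isOpen_ne.mem_nhds hp] with y hy' hyp
    exact (hy' hyp).symm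

/-- Both γ₁ and γ₂ vanish at the origin along Θ₁⁻, so their quotient tends to that of the
derivatives. As Θ₁⁻ has slope -μ₂/μ₁ there, the derivative of γ₁ is nonzero by the drift condition.
-/
lemma continuation_bounded (U : Uniformization D) (hs : D.Stable) (hmu : D.mu 0 < 0)
    (h₁ : LeftHalfBounded f₁) (h₂ : LeftHalfBounded f₂) :
    ∃ C, ∀ᶠ y in 𝓝[≠] (0 : ℂ), ‖D.continuation f₁ f₂ y‖ ≤ C := by
  obtain ⟨C₁, hC₁⟩ := h₁.bounded
  obtain ⟨C₂, hC₂⟩ := h₂.bounded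
  have hT := (U.analyticAt_Theta1Minus U.zero_mem_domain le_rfl).differentiableAt.hasDerivAt
  have hT0 := U.Theta1Minus_zero
  have hmu' : (D.mu 0 : ℂ) ≠ 0 := by exact_mod_cast hmu.ne
  have hd := U.deriv_Theta1Minus_zero
  set d := deriv D.Theta1Minus 0 with hdef
  have hid := hasDerivAt_id (0 : ℂ)
  have k1 : HasDerivAt (fun y => D.gam1 (D.Theta1Minus y) y) (D.R 0 0 * d + D.R 1 0) 0 := by
    have := (hT.const_mul (D.R 0 0 : ℂ)).add (hid.const_mul (D.R 1 0 : ℂ))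
    rwa [mul_one] at this
  have k2 : HasDerivAt (fun y => D.gam2 (D.Theta1Minus y) y) (D.R 0 1 * d + D.R 1 1) 0 := by
    have := (hT.const_mul (D.R 0 1 : ℂ)).add (hid.const_mul (D.R 1 1 : ℂ))
    rwa [mul_one] at this
  have hne : D.R 0 0 * d + D.R 1 0 ≠ 0 := by
    intro he
    have : ((D.R 0 0 * D.mu 1 - D.R 1 0 * D.mu 0 : ℝ) : ℂ) = 0 := by
      push_cast
      linear_combination (-(D.mu 0 : ℂ)) * he + D.R 0 0 * hd
    exact hs.drift2.ne (by exact_mod_cast this)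
  have t1 := hasDerivAt_iff_tendsto_slope_zero.1 k1
  have t2 := hasDerivAt_iff_tendsto_slope_zero.1 k2
  have t3 := (t2.div t1 hne).norm
  refine ⟨max C₁ ((‖(D.R 0 1 * d + D.R 1 1) / (D.R 0 0 * d + D.R 1 0)‖ + 1) * C₂), ?_⟩
  have hdom : ∀ᶠ y in 𝓝[≠] (0 : ℂ), y ∈ D.domain :=
    nhdsWithin_le_nhds (U.isOpen_domain.mem_nhds U.zero_mem_domain)
  filter_upwards [t3.eventually_lt_const (lt_add_one _), hdom, self_mem_nhdsWithin]
    with y hy hyd hy0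
  have hy0 : y ≠ 0 := hy0
  rw [continuation]
  split_ifs with hc
  · exact (hC₁ y hc).trans (le_max_left _ _)
  · refine le_trans ?_ (le_max_right _ _)
    have hre := (U.re_neg_or hyd hy0).resolve_left (fun h => hc h.le)
    have hf := hC₂ _ hre.le
    simp only [Pi.div_apply, zero_add, hT0, gam1, gam2, mul_zero, add_zero, sub_zero,
      smul_eq_mul] at hy
    rw [mul_div_mul_left _ _ (inv_ne_zero hy0)] at hy
    have e : D.ratio f₂ y = -((D.R 0 1 * D.Theta1Minus y + D.R 1 1 * y)
        / (D.R 0 0 * D.Theta1Minus y + D.R 1 0 * y)) * f₂ (D.Theta1Minus y) := by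
      rw [ratio, gam1, gam2]
      ring
    rw [e, norm_mul, norm_neg]
    exact mul_le_mul hy.le hf (norm_nonneg _) (by positivity)

/-- The transform of the first boundary measure has a meromorphic continuation. -/
lemma meromorphicOn_continuation (U : Uniformization D) (hs : D.Stable) (hmu : D.mu 0 < 0)
    (h₁ : LeftHalfBounded f₁) (h₂ : LeftHalfBounded f₂)
    (hrel : ∀ x y : ℂ, x.re ≤ 0 → y.re ≤ 0 → D.gam x y = 0 →
      D.gam1 x y * f₁ y + D.gam2 x y * f₂ x = 0) :
    MeromorphicOn (D.continuation f₁ f₂) D.domain := by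
  have hp := p_pos hs (U.lineForm_pos hs)
  intro y hy
  by_cases h0 : y = 0
  · subst h0
    obtain ⟨C, hC⟩ := U.continuation_bounded hs hmu h₁ h₂
    rw [eventually_nhdsWithin_iff] at hC
    -- A neighbourhood of the origin on which the bound holds and p is excluded; Riemann's theorem
    -- on removable singularities applies.
    set S : Set ℂ := {y | y ∈ D.domain ∧ y ≠ D.p ∧ (y ≠ 0 → ‖D.continuation f₁ f₂ y‖ ≤ C)} with hS
    have hS0 : S ∈ 𝓝 (0 : ℂ) := by
      filter_upwards [hC, U.isOpen_domain.mem_nhds hy,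
        isOpen_ne.mem_nhds (show (0 : ℂ) ≠ D.p by exact_mod_cast hp.ne)] with y a b c
      exact ⟨b, c, a⟩
    have hdiff : DifferentiableOn ℂ (D.continuation f₁ f₂) (S \ {0}) := fun y hy =>
      (U.analyticAt_continuation hs h₁ h₂ hrel hy.1.1 hy.2
        hy.1.2.1).differentiableAt.differentiableWithinAt
    have hb : BddAbove (norm ∘ D.continuation f₁ f₂ '' (S \ {0})) := by
      refine ⟨C, ?_⟩
      rintro _ ⟨y, hy, rfl⟩
      exact hy.1.2.2 hy.2
    have han := (Complex.differentiableOn_update_limUnder_of_bddAbove hS0 hdiff hb).analyticAt hS0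
    refine han.meromorphicAt.congr ?_
    filter_upwards [self_mem_nhdsWithin] with y hy
    exact Function.update_of_ne hy _ _
  · by_cases hyp : y = D.p
    · have hre : 0 ≤ y.re := by rw [hyp]; simpa using hp.le
      have hm := (U.analyticAt_num h₂ hy hre h0).meromorphicAt.div
        (U.analyticAt_gam1 hy hre).meromorphicAt
      refine hm.congr ?_
      filter_upwards [(U.continuation_eq_ratio hs hrel hy hre h0).filter_mono nhdsWithin_le_nhds,
        self_mem_nhdsWithin] with y h1 h2
      rw [h1 (by rw [← hyp]; exact h2)]
      rfl
    · exact (U.analyticAt_continuation hs h₁ h₂ hrel hy h0 hyp).meromorphicAt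

end

end Uniformization

/-! ### The order of the continuation at `q` and at infinity -/

/-- Two meromorphic functions on a connected open set that agree on a neighbourhood of a point
agree near every point. -/
lemma MeromorphicOn.eventuallyEq_of_eventuallyEq {f g : ℂ → ℂ} {U : Set ℂ}
    (hf : MeromorphicOn f U) (hg : MeromorphicOn g U) (hU : IsConnected U) {a b : ℂ} (ha : a ∈ U)
    (hb : b ∈ U) (h : f =ᶠ[𝓝 a] g) : f =ᶠ[𝓝[≠] b] g := by
  have hd : MeromorphicOn (f - g) U := hf.sub hg
  have h1 : meromorphicOrderAt (f - g) a = ⊤ := by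
    rw [meromorphicOrderAt_eq_top_iff]
    refine nhdsWithin_le_nhds ?_
    filter_upwards [h] with z hz
    rw [Pi.sub_apply, hz, sub_self]
  have h2 : meromorphicOrderAt (f - g) b = ⊤ := by
    by_contra hne
    exact (hd.exists_meromorphicOrderAt_ne_top_iff_forall hU).1 ⟨⟨b, hb⟩, hne⟩ ⟨a, ha⟩ h1
  rw [meromorphicOrderAt_eq_top_iff] at h2
  filter_upwards [h2] with z hz
  exact sub_eq_zero.1 hz

lemma laplace_ofReal_ne_zero {ν : Measure ℝ} [IsFiniteMeasure ν] (hν : ν ≠ 0)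
    (h0 : ∀ᵐ t ∂ν, 0 ≤ t) {x : ℝ} (hx : x < 0) : laplace ν x ≠ 0 := by
  have : NeZero ν := ⟨hν⟩
  have hi : Integrable (fun t => Real.exp (x * t)) ν := by
    refine Integrable.of_bound (by fun_prop) 1 ?_
    filter_upwards [h0] with t ht
    rw [Real.norm_eq_abs, abs_of_pos (Real.exp_pos _), Real.exp_le_one_iff]
    exact mul_nonpos_of_nonpos_of_nonneg hx.le ht
  have hpos := integral_exp_pos hi
  have e : laplace ν x = ((∫ t, Real.exp (x * t) ∂ν : ℝ) : ℂ) := by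
    rw [laplace, ← integral_complex_ofReal]
    simp
  rw [e]
  exact_mod_cast hpos.ne'

namespace Uniformization

open RBMData

variable {D : RBMData}

section

variable {f₁ f₂ : ℂ → ℂ}

lemma q_pos (U : Uniformization D) (hs : D.Stable) : 0 < D.q := by
  obtain ⟨s, h1, h2, h3, -⟩ := U.exists_q hs
  rw [h3]
  exact U.YReal_pos h1 (h2.trans U.beta_lt).le

lemma continuation_eq_ratio_q (U : Uniformization D) (hs : D.Stable) :
    D.continuation f₁ f₂ =ᶠ[𝓝 (D.q : ℂ)] D.ratio f₂ := by
  have hq := U.q_pos hs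
  have : {z : ℂ | 0 < z.re} ∈ 𝓝 (D.q : ℂ) :=
    (isOpen_lt continuous_const Complex.continuous_re).mem_nhds (by simpa using hq)
  filter_upwards [this] with y hy
  exact if_neg (not_le.2 hy)

lemma exists_Theta1Minus_q (U : Uniformization D) (hs : D.Stable) :
    ∃ x : ℝ, x < 0 ∧ D.Theta1Minus D.q = x ∧ (D.gam1Vertex ≤ 0 → D.gam1 x D.q ≠ 0) ∧
      (0 < D.gam1Vertex → D.q = D.p ∧ D.gam1 x D.q = 0) := by
  obtain ⟨s, h1, h2, h3, h4⟩ := U.exists_q hs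
  have hs0 := U.s₀_pos
  have e : D.Theta1Minus D.q = U.XReal s := by
    rw [h3, ← Y_ofReal, U.Theta1Minus_Y (by simpa using hs0.trans h1)
      (by simpa using h2.trans U.beta_lt), X_ofReal]
  have eg : D.gam1 (U.XReal s : ℝ) D.q = ((D.gam1Real (U.XReal s) (U.YReal s) : ℝ) : ℂ) := by
    rw [h3, gam1, gam1Real]
    push_cast
    rfl
  refine ⟨U.XReal s, ?_, e, fun hv => ?_, fun hv => ⟨(h4 hv).1, ?_⟩⟩
  · have hq := U.q_pos hs
    have := (U.re_neg_or (U.q_mem_domain hs) (by exact_mod_cast hq.ne')).resolve_left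
      (by simpa using hq.le)
    rwa [e, Complex.ofReal_re] at this
  · rw [eg]
    exact_mod_cast (U.gam1Real_neg hs.r11_pos h1 h2 hv).ne
  · rw [eg, (h4 hv).2, Complex.ofReal_zero]

/-- The product of the values of γ₁ at the two conjugate abscissas is a nonzero multiple of y(y -
p), which has a simple zero at p > 0. The factor that vanishes there must then have a nonzero
derivative. -/
lemma deriv_gam1_ne_zero (U : Uniformization D) (hs : D.Stable) (hp : (D.p : ℂ) ∈ D.domain)
    (h0 : D.gam1 (D.Theta1Minus D.p) D.p = 0) :
    deriv (fun y => D.gam1 (D.Theta1Minus y) y) D.p ≠ 0 := by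
  have hl := U.lineForm_pos hs
  have hpp := p_pos hs hl
  have hT := U.analyticAt_Theta1Minus hp (by simpa using hpp.le)
  have hN := (U.analyticAt_gam1 hp (by simpa using hpp.le)).differentiableAt.hasDerivAt
  have hM : DifferentiableAt ℂ (fun y =>
      D.gam1 (-(2 * (D.Sig 0 1 * y + D.mu 0) / D.Sig 0 0) - D.Theta1Minus y) y) D.p := by
    have := hT.differentiableAt
    unfold gam1
    fun_prop
  have hprod := hN.mul hM.hasDerivAt
  have hfun : ((fun y => D.gam1 (D.Theta1Minus y) y) * fun y =>
      D.gam1 (-(2 * (D.Sig 0 1 * y + D.mu 0) / D.Sig 0 0) - D.Theta1Minus y) y)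
      = fun y : ℂ => D.lineForm / D.Sig 0 0 * (y * (y - D.p)) :=
    funext fun y => gam1_mul_gam1_conjugate U.sig11_pos hl y
  rw [hfun] at hprod
  have hid := hasDerivAt_id (D.p : ℂ)
  have h2 := (hid.mul (hid.sub_const (D.p : ℂ))).const_mul (D.lineForm / D.Sig 0 0 : ℂ)
  have key := hprod.unique h2
  intro hz
  rw [hz, h0] at key
  simp only [zero_mul, add_zero, id_eq, sub_self, mul_zero, mul_one, zero_add] at key
  have h3 : D.lineForm / D.Sig 0 0 * D.p ≠ 0 :=
    (mul_pos (div_pos hl U.sig11_pos) hpp).ne'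
  apply h3
  exact_mod_cast key.symm

/-- The continuation is regular at `q` if `γ₁` is not positive at the vertex, and has a simple
pole there otherwise. -/
lemma order_continuation (U : Uniformization D) (hs : D.Stable) (h₂ : LeftHalfBounded f₂)
    (hne : ∀ x : ℝ, x < 0 → f₂ x ≠ 0) :
    (D.gam1Vertex ≤ 0 → 0 ≤ meromorphicOrderAt (D.continuation f₁ f₂) D.q) ∧
    (0 < D.gam1Vertex →
      meromorphicOrderAt (D.continuation f₁ f₂) D.q = ((-1 : ℤ) : WithTop ℤ)) := by
  obtain ⟨x, hx, hT, hle, hgt⟩ := U.exists_Theta1Minus_q hs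
  have hq := U.q_pos hs
  have hqd := U.q_mem_domain hs
  have hre : 0 ≤ (D.q : ℂ).re := by simpa using hq.le
  have hq0 : (D.q : ℂ) ≠ 0 := by exact_mod_cast hq.ne'
  have hnum := U.analyticAt_num h₂ hqd hre hq0
  have hden := U.analyticAt_gam1 hqd hre
  rw [meromorphicOrderAt_congr ((U.continuation_eq_ratio_q hs).filter_mono nhdsWithin_le_nhds)]
  refine ⟨fun hv => ?_, fun hv => ?_⟩
  · exact (hnum.div hden (by rw [hT]; exact hle hv)).meromorphicOrderAt_nonneg
  · obtain ⟨hqp, hg⟩ := hgt hv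
    have hn0 : meromorphicOrderAt
        (fun y => -(D.gam2 (D.Theta1Minus y) y * f₂ (D.Theta1Minus y))) D.q = 0 := by
      rw [hnum.meromorphicOrderAt_eq, hnum.analyticOrderAt_eq_zero.2]
      · rfl
      -- If γ₂ vanished together with γ₁, invertibility of R would force q = 0; and f₂ does not
      -- vanish at negative reals.
      · rw [hT, neg_ne_zero]
        refine mul_ne_zero (fun h2 => ?_) (hne x hx)
        rw [gam1] at hg
        rw [gam2] at h2
        have : ((D.R 0 0 * D.R 1 1 - D.R 0 1 * D.R 1 0 : ℝ) : ℂ) * D.q = 0 := by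
          push_cast
          linear_combination (D.R 0 0 : ℂ) * h2 - D.R 0 1 * hg
        rcases mul_eq_zero.1 this with h | h
        · exact hs.det_pos.ne' (by exact_mod_cast h)
        · exact hq0 h
    have hd1 : meromorphicOrderAt (fun y => D.gam1 (D.Theta1Minus y) y) D.q = (1 : ℤ) := by
      have h0 : D.gam1 (D.Theta1Minus D.q) D.q = 0 := by rw [hT]; exact hg
      rw [hden.meromorphicOrderAt_eq, hden.analyticOrderAt_eq_one_of_zero_deriv_ne_zero h0]
      · rfl
      · rw [hqp] at hqd h0 ⊢
        exact U.deriv_gam1_ne_zero hs hqd h0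
    have := meromorphicOrderAt_div hnum.meromorphicAt hden.meromorphicAt
    rw [hn0, hd1] at this
    exact this

end

/-- Near infinity, `W⁻¹` is a local analytic isomorphism onto a neighbourhood of `q`. -/
lemma exists_Winv_eq (U : Uniformization D) (hs : D.Stable) :
    ∃ g : ℂ → ℂ, AnalyticAt ℂ g 0 ∧ g 0 = D.q ∧ deriv g 0 ≠ 0 ∧
      ∀ᶠ z in 𝓝[≠] (0 : ℂ), D.Winv z⁻¹ = g z := by
  obtain ⟨s, h1, h2, h3, -⟩ := U.exists_q hs
  obtain ⟨c, hc, hwq⟩ := U.exists_w_q hs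
  have hs0 : 0 < s := U.s₀_pos.trans h1
  have hb := U.beta_pos
  have hpi := Real.pi_pos
  have hwq' : Complex.cos (Real.pi / D.beta * s) = c := by
    rw [← U.w_Y_of_mem (s := s) (by simpa using hs0.le) (by simpa using h2), Y_ofReal, ← h3, hwq]
  have hne : (c : ℂ) + 1 ≠ 0 := by
    have : c + 1 ≠ 0 := by linarith
    exact_mod_cast this
  -- This is 1/W in the coordinate s. It has a simple zero at the parameter of q, because sin(πs/β)
  -- ≠ 0 there, and so it is locally invertible.
  set k : ℂ → ℂ := fun t => (Complex.cos (Real.pi / D.beta * t) - c)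
    / (Complex.cos (Real.pi / D.beta * t) + 1) with hk
  have hcos : AnalyticAt ℂ (fun t : ℂ => Complex.cos (Real.pi / D.beta * t)) s :=
    (show Differentiable ℂ fun t : ℂ => Complex.cos (Real.pi / D.beta * t) by
      fun_prop).analyticAt _
  have hka : AnalyticAt ℂ k s :=
    (hcos.sub analyticAt_const).div (hcos.add analyticAt_const) (by rw [hwq']; exact hne)
  have hk0 : k s = 0 := by simp only [hk]; rw [hwq', sub_self, zero_div]
  have hkd : deriv k s ≠ 0 := by
    have hid := (hasDerivAt_id (s : ℂ)).const_mul (Real.pi / D.beta : ℂ)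
    have hc1 := hid.ccos
    have hd := (hc1.sub_const (c : ℂ)).div (hc1.add_const (1 : ℂ)) (by
      simp only [id]; rw [hwq']; exact hne)
    have hsin : Complex.sin (Real.pi / D.beta * s) ≠ 0 := by
      have hlt : Real.pi / D.beta * s < Real.pi := by
        rw [div_mul_eq_mul_div, div_lt_iff₀ hb]
        gcongr
      have := Real.sin_pos_of_pos_of_lt_pi (by positivity) hlt
      exact_mod_cast this.ne'
    have hd' : HasDerivAt k _ s := hd
    rw [hd'.deriv]
    simp only [id, mul_one]
    rw [hwq', sub_self, zero_mul, sub_zero]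
    have hpb : (Real.pi / D.beta : ℂ) ≠ 0 := by exact_mod_cast (div_pos hpi hb).ne'
    exact div_ne_zero (mul_ne_zero (mul_ne_zero (neg_ne_zero.2 hsin) hpb) hne) (pow_ne_zero 2 hne)
  obtain ⟨κ, hκ, hκ0, hκd, hκinv⟩ := hka.exists_local_inverse hkd
  rw [hk0] at hκ hκ0 hκd hκinv
  have hYd : deriv U.Y s ≠ 0 :=
    U.deriv_Y_ne_zero (by simpa using hs0) (by simpa using h2.trans U.beta_lt)
  refine ⟨fun z => U.Y (κ z), (U.analyticAt_Y _).comp hκ, ?_, ?_, ?_⟩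
  · change U.Y (κ 0) = D.q
    rw [hκ0, Y_ofReal, ← h3]
  · have h4 : HasDerivAt U.Y (deriv U.Y s) (κ 0) := by
      rw [hκ0]
      exact (U.analyticAt_Y _).differentiableAt.hasDerivAt
    have := h4.comp (0 : ℂ) hκ.differentiableAt.hasDerivAt
    have h5 : deriv (fun z => U.Y (κ z)) 0 = deriv U.Y s * deriv κ 0 := this.deriv
    rw [h5]
    exact mul_ne_zero hYd hκd
  · have hopen : IsOpen {t : ℂ | 0 < t.re ∧ t.re < D.beta} :=
      (isOpen_lt continuous_const Complex.continuous_re).inter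
        (isOpen_lt Complex.continuous_re continuous_const)
    have hmem : ∀ᶠ z in 𝓝 (0 : ℂ), 0 < (κ z).re ∧ (κ z).re < D.beta := by
      refine hκ.continuousAt.eventually (hopen.mem_nhds ?_)
      rw [hκ0]
      exact ⟨by simpa using hs0, by simpa using h2⟩
    filter_upwards [nhdsWithin_le_nhds hκinv, nhdsWithin_le_nhds hmem, self_mem_nhdsWithin]
      with z hz hm hz0
    have hw := U.w_Y_of_mem hm.1.le hm.2
    have hz0 : z ≠ 0 := hz0
    simp only [hk] at hz
    rw [← hw] at hz
    refine U.Winv_eq hs ?_ ?_ ?_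
    · exact (U.Y_mem_domain_iff hm.1.le (hm.2.trans U.beta_lt).le).2 hm.2
    · intro he
      rw [he, hwq, sub_self, zero_div] at hz
      exact hz0 hz.symm
    · rw [U.W_eq, hwq, ← inv_div, hz]

lemma isConnected_domain (U : Uniformization D) : IsConnected D.domain :=
  ⟨⟨0, U.zero_mem_domain⟩, isPreconnected_connectedComponentIn⟩

/-- The existence of the continuation of the transform of the first boundary measure, and its
behaviour at infinity. -/
lemma laplace_continuation (U : Uniformization D) (hs : D.Stable) (hmu : D.mu 0 < 0)
    {ν₁ ν₂ : Measure ℝ} [IsFiniteMeasure ν₁] [IsFiniteMeasure ν₂]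
    (h₁ : ∀ᵐ x ∂ν₁, 0 ≤ x) (h₂ : ∀ᵐ x ∂ν₂, 0 ≤ x) (hν₂ : ν₂ ≠ 0)
    (hrel : ∀ x y : ℂ, x.re ≤ 0 → y.re ≤ 0 → D.gam x y = 0 →
      D.gam1 x y * laplace ν₁ y + D.gam2 x y * laplace ν₂ x = 0) :
    (∃ φ, IsMeromorphicLaplace ν₁ D.domain φ) ∧
    ∀ φ, IsMeromorphicLaplace ν₁ D.domain φ →
      (D.gam1Vertex ≤ 0 ↔ NoPoleAtInfinity (φ ∘ D.Winv)) ∧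
      (0 < D.gam1Vertex ↔ SimplePoleAtInfinity (φ ∘ D.Winv)) := by
  have b₁ := LeftHalfBounded.laplace h₁
  have b₂ := LeftHalfBounded.laplace h₂
  have hmer := U.meromorphicOn_continuation hs hmu b₁ b₂ hrel
  refine ⟨⟨D.continuation (laplace ν₁) (laplace ν₂), hmer, fun y _ hy => if_pos hy⟩,
    fun φ hφ => ?_⟩
  obtain ⟨g, hg, hg0, hgd, hgW⟩ := U.exists_Winv_eq hs
  have hqd := U.q_mem_domain hs
  have hcongr : (fun z => (φ ∘ D.Winv) z⁻¹) =ᶠ[𝓝[≠] 0] φ ∘ g := by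
    filter_upwards [hgW] with z hz
    simp only [Function.comp, hz]
  have hmerg : MeromorphicAt (φ ∘ g) 0 := by
    refine MeromorphicAt.comp_analyticAt ?_ hg
    rw [hg0]
    exact hφ.meromorphic _ hqd
  have hmer0 : MeromorphicAt (fun z => (φ ∘ D.Winv) z⁻¹) 0 := hmerg.congr hcongr.symm
  -- Near such a point any continuation equals the Laplace transform, so the identity principle on
  -- the connected domain carries the agreement to q.
  obtain ⟨a, ha, hare⟩ : ∃ a ∈ D.domain, a.re < 0 := by
    have h1 : ∀ᶠ t : ℝ in 𝓝 0, (t : ℂ) ∈ D.domain := by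
      refine Complex.continuous_ofReal.continuousAt.eventually (U.isOpen_domain.mem_nhds ?_)
      rw [Complex.ofReal_zero]
      exact U.zero_mem_domain
    have h2 : ∀ᶠ t : ℝ in 𝓝[<] 0, (t : ℂ) ∈ D.domain := nhdsWithin_le_nhds h1
    obtain ⟨t, ht, ht0⟩ := (h2.and self_mem_nhdsWithin).exists
    exact ⟨t, ht, by simpa using ht0⟩
  have heq : φ =ᶠ[𝓝[≠] (D.q : ℂ)] D.continuation (laplace ν₁) (laplace ν₂) := by
    refine hφ.meromorphic.eventuallyEq_of_eventuallyEq hmer U.isConnected_domain ha hqd ?_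
    filter_upwards [U.isOpen_domain.mem_nhds ha,
      (isOpen_lt Complex.continuous_re continuous_const).mem_nhds hare] with y hy hy'
    have hy' : y.re < 0 := hy'
    rw [hφ.eq_laplace y hy hy'.le, continuation, if_pos hy'.le]
  have hord : meromorphicOrderAt (fun z => (φ ∘ D.Winv) z⁻¹) 0
      = meromorphicOrderAt (D.continuation (laplace ν₁) (laplace ν₂)) D.q := by
    rw [meromorphicOrderAt_congr hcongr, meromorphicOrderAt_comp_of_deriv_ne_zero hg hgd, hg0,
      meromorphicOrderAt_congr heq]
  obtain ⟨o1, o2⟩ := U.order_continuation (f₁ := laplace ν₁) hs b₂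
    fun x hx => laplace_ofReal_ne_zero hν₂ h₂ hx
  have hneg : ¬ (0 : WithTop ℤ) ≤ ((-1 : ℤ) : WithTop ℤ) := by decide
  refine ⟨⟨fun hv => ⟨hmer0, ?_⟩, fun hn => ?_⟩, ⟨fun hv => ⟨hmer0, ?_⟩, fun hn => ?_⟩⟩
  · rw [hord]
    exact o1 hv
  · by_contra! hv
    have := hn.2
    rw [hord, o2 hv] at this
    exact hneg this
  · rw [hord]
    exact o2 hv
  · by_contra! hv
    have := o1 hv
    rw [← hord, hn.2] at this
    exact hneg this

end Uniformization

/-- The index of the Riemann boundary value problem of a stationary reflected Brownian motion in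
the quarter plane. The first two conclusions say that `W⁻¹` and the variation of the argument of
`H` make sense; `φ` is the Laplace transform of the boundary measure, continued to the domain, and
`φ ∘ W⁻¹` is `ψ₁`. -/
theorem lemma6 (D : RBMData) (hSig : D.Sig.PosDef) (hstable : D.Stable)
    (hmu1 : D.mu 0 < 0) (hmu2 : D.mu 1 < 0) :
    Set.BijOn D.W (D.domain \ {(D.q : ℂ)}) (((fun t : ℝ => (t : ℂ)) '' Set.Icc 0 1)ᶜ) ∧
    (∃ α : ℝ → ℝ, IsArgLift D.H α) ∧
    (D.index = 0 ∨ D.index = -1) ∧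
    (D.index = 0 ↔ D.gam1Vertex ≤ 0) ∧
    (D.index = -1 ↔ 0 < D.gam1Vertex) ∧
    ∀ {Ω : Type*} {mΩ : MeasurableSpace Ω} (P : Measure Ω) [IsProbabilityMeasure P]
      (ℱ : Filtration ℝ≥0 mΩ) (Z B L : ℝ≥0 → Ω → Fin 2 → ℝ) (π : Measure (Fin 2 → ℝ)),
      D.IsRBM ℱ P Z B L → (∀ t, P.map (Z t) = π) →
        (∃ φ, IsMeromorphicLaplace (boundaryMeasure1 P Z L) D.domain φ) ∧
        ∀ φ, IsMeromorphicLaplace (boundaryMeasure1 P Z L) D.domain φ →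
          (D.gam1Vertex ≤ 0 ↔ NoPoleAtInfinity (φ ∘ D.Winv)) ∧
          (0 < D.gam1Vertex ↔ SimplePoleAtInfinity (φ ∘ D.Winv)) := by
  have h11 : 0 < D.Sig 0 0 := hSig.diag_pos
  have h22 : 0 < D.Sig 1 1 := hSig.diag_pos
  have hsym : D.Sig 1 0 = D.Sig 0 1 := by
    have := hSig.isHermitian.apply 0 1
    simpa using this
  have hdet : 0 < D.detSig := by
    have := hSig.det_pos
    rw [Matrix.det_fin_two, hsym] at this
    rw [RBMData.detSig, sq]
    exact this
  obtain ⟨U⟩ := exists_uniformization D h11 h22 hdet hmu1 hmu2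
  obtain ⟨harg, hindex⟩ := U.index_eq hstable
  refine ⟨U.bijOn_W hstable, harg, ?_, ?_, ?_, ?_⟩
  · rw [hindex]
    split_ifs <;> simp
  · rw [hindex]
    split_ifs with h <;> simp [h, not_lt.1, not_le.2]
  · rw [hindex]
    split_ifs with h <;> simp [h]
  · intro Ω mΩ P _ ℱ Z B L π hZ hstat
    have : IsFiniteMeasure (boundaryMeasure1 P Z L) :=
      hZ.isFiniteMeasure_boundaryMeasure hstable hstat 0 1
    have := hZ.isFiniteMeasure_boundaryMeasure hstable hstat 1 0
    exact U.laplace_continuation hstable hmu1 (hZ.boundaryMeasure_nonneg 0 1)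
      (hZ.boundaryMeasure_nonneg 1 0) (hZ.boundaryMeasure_ne_zero hstable hstat 1 0)
      fun x y hx hy hxy => hZ.boundary_relation hSig hstable hstat hx hy hxy
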